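/- Let $n\ge 3$, $N=\{1,\dots,n\}$, weights $w\in\mathbb Z_{\ge0}^N$, threshold $W\in\mathbb Z_{\ge0}$, and let $\nu(S)=1$ if $w(S):=\sum_{i\in S}w_i\ge W$ and $\nu(S)=0$ otherwise ($S\subseteq N$). Write $x(S)=\sum_{i\in S}x_i$, let $\chi(S)\in\{0,1\}^n$ be the characteristic vector of $S$, and for a linear program $Q$ in variables $(x,\varepsilon)\in\mathbb R^N\times\mathbb R$ let $Q(\varepsilon)$ be the set of all $x$ with $(x,\varepsilon)$ feasible for $Q$. Let $(P_1)$ be the linear program $\max\varepsilon$ subject to $x(S)\ge\nu(S)+\varepsilon$ for all $S\subseteq N$, $x(N)=\nu(N)$, $x\ge 0$, and for $2\le j\le n$ let $(P_j)$ be the linear program $\max\varepsilon$ subject to $x(S)\ge\nu(S)+\varepsilon$ for all $S\subseteq N$ with $\chi(S)\notin\mathcal L_{j-1}$, and $x\in P_{j-1}(\varepsilon_{j-1})$. Here $\varepsilon_l$ is the optimal value of $(P_l)$, $\mathcal L_1=\operatorname{span}\{\chi(N)\}$, and for $l\ge2$, $\mathcal L_l$ is a subspace with $\mathcal L_{l-1}\subseteq\mathcal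 L_l\subseteq\operatorname{span}\{\chi(S): S\subseteq N,\ x(S)=x'(S)\text{ for all }x,x'\in P_l(\varepsilon_l)\}$ and $\dim\mathcal L_l=l$, given as $\mathcal L_l=\operatorname{span}\{z^l_1,\dots,z^l_l\}$ with $z^l_1,\dots,z^l_l\in\{0,1\}^n$. Let $\mathcal P$ be a set of at least $\log_2(n!)$ distinct primes, each bounded by a fixed polynomial in $n$. For $p\in\mathcal P$ and $1\le l\le n-1$ let $v^l_{p,1},\dots,v^l_{p,n-l}\in\mathbb F_p^n$ be a basis of the orthogonal space of $\operatorname{span}\{z^l_1,\dots,z^l_l\}$ over $\mathbb F_p$ if $z^l_1,\dots,z^l_l$ are linearly independent over $\mathbb F_p$, and let all these vectors be $0$ otherwise. Let $(\bar P_1)=(P_1)$ and for $2\le j\le n$ let $(\bar P_j)$ be the linear program $\max\varepsilon$ subject to $x(S)\ge\nu(S)+\varepsilon$ for all $S\subseteq N$ such that $\langle v^{j-1}_{p,t},\chi(S)\rangle\not\equiv0\pmod p$ for some $p\in\mathcal P$ and $t\in\{1,\dots,n-(j-1)\}$, and $x\in P_{j-1}(\varepsilon_{j-1})$. Then there is an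 algorithm which, given $j\in\{1,\dots,n\}$, the data $n,w,W,\mathcal P$, $(v^l_{p,t})$ and $(\varepsilon_l)$ for $1\le l<j$ that describe $(\bar P_j)$, and a point $(x,\varepsilon)\in\mathbb Q^n\times\mathbb Q$, solves the separation problem for $(\bar P_j)$ and $(x,\varepsilon)$: it either asserts correctly that $(x,\varepsilon)$ is feasible for $(\bar P_j)$, or returns a linear inequality with integer coefficients that is valid for all feasible points of $(\bar P_j)$ and violated by $(x,\varepsilon)$. Its running time is polynomial in $n$, $w_1,\dots,w_n$, $W$ and the size of the binary encoding of $(x,\varepsilon)$. -/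

import Mathlib

namespace WVG

/-! ### Model of computation: a random access machine with logarithmic cost

Programs are structured programs over finitely many integer arrays; the cost of every operation
is measured by the bit lengths of the integers (and addresses) it touches. -/

/-- Bit length of an integer (sign bit included), hence at least `1`. -/
def bitLen (a : ℤ) : ℕ := a.natAbs.size + 1

/-- A memory: `s a i` is the content of cell `i` of array `a`. -/
abbrev Store := ℕ → ℕ → ℤ

/-- Binary operations of the machine. -/
inductive BinOp where
  | add | sub | mul | div | mod | le | eq

/-- Result of a binary operation; comparisons return `1` or `0`. -/
def BinOp.eval : BinOp → ℤ → ℤ → ℤ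
  | .add, a, b => a + b
  | .sub, a, b => a - b
  | .mul, a, b => a * b
  | .div, a, b => a / b
  | .mod, a, b => a % b
  | .le, a, b => if a ≤ b then 1 else 0
  | .eq, a, b => if a = b then 1 else 0

/-- Expressions: integer constants, (indirectly addressed) array cells, binary operations. -/
inductive Expr where
  | lit (c : ℤ)
  | get (a : ℕ) (i : Expr)
  | op (o : BinOp) (e₁ e₂ : Expr)

/-- Value of an expression. A negative address stands for the address `0`. -/
def Expr.eval (s : Store) : Expr → ℤ
  | .lit c => c
  | .get a i => s a (i.eval s).toNat
  | .op o e₁ e₂ => o.eval (e₁.eval s) (e₂.eval s)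

/-- Cost of evaluating an expression. A memory access is charged with the bit lengths of the
address and of the content, an operation with the product of the bit lengths of its operands. -/
def Expr.cost (s : Store) : Expr → ℕ
  | .lit c => bitLen c
  | .get a i => i.cost s + bitLen (i.eval s) + bitLen (s a (i.eval s).toNat)
  | .op _ e₁ e₂ => e₁.cost s + e₂.cost s + bitLen (e₁.eval s) * bitLen (e₂.eval s)

/-- Programs. -/
inductive Prog where
  | assign (a : ℕ) (i e : Expr)
  | seq (p q : Prog)
  | ite (e : Expr) (p q : Prog)
  | loop (e : Expr) (p : Prog)

/-- Memory after writing `c` into cell `i` of array `a`. -/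
def Store.write (s : Store) (a i : ℕ) (c : ℤ) : Store :=
  Function.update s a (Function.update (s a) i c)

/-- `Exec p s t s'`: started in memory `s`, the program `p` halts in memory `s'` after exactly
`t` units of time. A nonzero value of a condition means "true". -/
inductive Exec : Prog → Store → ℕ → Store → Prop
  | assign (a : ℕ) (i e : Expr) (s : Store) :
      Exec (.assign a i e) s
        (i.cost s + e.cost s + bitLen (i.eval s) + bitLen (e.eval s))
        (s.write a (i.eval s).toNat (e.eval s))
  | seq {p q : Prog} {s s' s'' : Store} {t t' : ℕ} :
      Exec p s t s' → Exec q s' t' s'' → Exec (.seq p q) s (t + t') s''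
  | ite_true {e : Expr} {p q : Prog} {s s' : Store} {t : ℕ} :
      e.eval s ≠ 0 → Exec p s t s' → Exec (.ite e p q) s (e.cost s + 1 + t) s'
  | ite_false {e : Expr} {p q : Prog} {s s' : Store} {t : ℕ} :
      e.eval s = 0 → Exec q s t s' → Exec (.ite e p q) s (e.cost s + 1 + t) s'
  | loop_done {e : Expr} {p : Prog} {s : Store} :
      e.eval s = 0 → Exec (.loop e p) s (e.cost s + 1) s
  | loop_step {e : Expr} {p : Prog} {s s' s'' : Store} {t t' : ℕ} :
      e.eval s ≠ 0 → Exec p s t s' → Exec (.loop e p) s' t' s'' →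
      Exec (.loop e p) s (e.cost s + 1 + t + t') s''

/-- Binary size of a rational number. -/
def ratSize (r : ℚ) : ℕ := bitLen r.num + bitLen r.den

/-! ### Cooperative games and the sequence of linear programs -/

section LinearPrograms

/-- Characteristic vector of a coalition, over a ring `R`. -/
def chi (R : Type*) [Zero R] [One R] {n : ℕ} (S : Finset (Fin n)) : Fin n → R :=
  fun k => if k ∈ S then 1 else 0

/-- Utility function of the weighted voting game with weights `w` and threshold `W`. -/
noncomputable def utility {n : ℕ} (w : Fin n → ℕ) (W : ℕ) (S : Finset (Fin n)) : ℝ :=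
  if W ≤ ∑ i ∈ S, w i then 1 else 0

/-- `lpP ν L eps j x e`: the point `(x, e)` is feasible for the linear program `P_j` of the game
`ν`, for given subspaces `L 1, L 2, …` and numbers `eps 1, eps 2, …`. Programs are numbered from
`1`; the value at `0` is irrelevant. -/
def lpP {n : ℕ} (ν : Finset (Fin n) → ℝ) (L : ℕ → Submodule ℝ (Fin n → ℝ)) (eps : ℕ → ℝ) :
    ℕ → (Fin n → ℝ) → ℝ → Prop
  | 0, _, _ => False
  | 1, x, e => (∀ S : Finset (Fin n), ν S + e ≤ ∑ i ∈ S, x i) ∧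
      ∑ i, x i = ν Finset.univ ∧ ∀ i, 0 ≤ x i
  | j + 2, x, e => (∀ S : Finset (Fin n), chi ℝ S ∉ L (j + 1) → ν S + e ≤ ∑ i ∈ S, x i) ∧
      lpP ν L eps (j + 1) x (eps (j + 1))

/-- `e` is the optimal value of the problem of maximizing the last variable subject to `F`. -/
def IsOptimalValue {n : ℕ} (F : (Fin n → ℝ) → ℝ → Prop) (e : ℝ) : Prop :=
  IsGreatest {e' : ℝ | ∃ x, F x e'} e

/-- Coalitions whose total `x(S)` is the same for all `x` with `F x e`. -/
def fixSets {n : ℕ} (F : (Fin n → ℝ) → ℝ → Prop) (e : ℝ) : Set (Finset (Fin n)) :=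
  {S | ∀ x x' : Fin n → ℝ, F x e → F x' e → ∑ i ∈ S, x i = ∑ i ∈ S, x' i}

/-- The real span of the `0/1`-vectors `z ℓ 1, …, z ℓ ℓ` (given as coalitions). -/
def spanL {n : ℕ} (z : (l : ℕ) → Fin l → Finset (Fin n)) (l : ℕ) :
    Submodule ℝ (Fin n → ℝ) :=
  Submodule.span ℝ (Set.range fun s : Fin l => chi ℝ (z l s))

end LinearPrograms

/-! ### Instances of the separation problem -/

/-- The data of the linear program `P̄_j` of a weighted voting game, with a point `(x, ε)`. -/
structure Instance where
  /-- number of players -/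
  n : ℕ
  /-- weights -/
  w : Fin n → ℕ
  /-- threshold -/
  W : ℕ
  /-- index of the linear program -/
  j : ℕ
  /-- number of primes -/
  m : ℕ
  /-- the primes -/
  prime : Fin m → ℕ
  /-- the vectors `v l q t` over the field with `prime q` elements, for `1 ≤ l < j` -/
  v : (l : ℕ) → (q : Fin m) → Fin (n - l) → Fin n → ZMod (prime q)
  /-- the optimal values of the linear programs `1, …, j - 1` -/
  eps : ℕ → ℚ
  /-- the point `(x, ε)` -/
  x : Fin n → ℚ
  ε : ℚ

namespace Instance

/-- Feasibility for the linear program `P_l`, the subspaces being encoded by `z`. -/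
def feasP (I : Instance) (z : (l : ℕ) → Fin l → Finset (Fin I.n)) (l : ℕ) :
    (Fin I.n → ℝ) → ℝ → Prop :=
  lpP (utility I.w I.W) (spanL z) (fun i => (I.eps i : ℝ)) l

/-- Feasibility for the reformulated linear program `P̄_l`. -/
def feasPbar (I : Instance) (z : (l : ℕ) → Fin l → Finset (Fin I.n)) :
    ℕ → (Fin I.n → ℝ) → ℝ → Prop
  | 0, _, _ => False
  | 1, x, e => I.feasP z 1 x e
  | l + 2, x, e =>
      (∀ S : Finset (Fin I.n),
        (∃ (q : Fin I.m) (t : Fin (I.n - (l + 1))),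
          I.v (l + 1) q t ⬝ᵥ chi (ZMod (I.prime q)) S ≠ 0) →
        utility I.w I.W S + e ≤ ∑ i ∈ S, x i) ∧
      I.feasP z (l + 1) x (I.eps (l + 1) : ℝ)

/-- The data are those of the scheme: `eps l` is the optimal value of `P_l`, the `0/1`-vectors
`z l` span a subspace `L_l` allowed by the scheme, and `v l q` is a basis of the orthogonal space
of `z l` over the field with `prime q` elements (or zero, if `z l` is dependent over it). -/
structure IsScheme (I : Instance) (z : (l : ℕ) → Fin l → Finset (Fin I.n)) : Prop where
  three_le : 3 ≤ I.n
  one_le_j : 1 ≤ I.j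
  j_le : I.j ≤ I.n
  isPrime : ∀ q, (I.prime q).Prime
  prime_injective : Function.Injective I.prime
  log_le : Real.logb 2 (I.n.factorial : ℝ) ≤ I.m
  optimal : ∀ l, 1 ≤ l → l < I.j → IsOptimalValue (I.feasP z l) (I.eps l : ℝ)
  span_one : 1 < I.j → spanL z 1 = Submodule.span ℝ {chi ℝ Finset.univ}
  span_le_fix : ∀ l, 2 ≤ l → l < I.j →
    spanL z l ≤ Submodule.span ℝ (chi ℝ '' fixSets (I.feasP z l) (I.eps l : ℝ))
  span_mono : ∀ l, 2 ≤ l → l < I.j → spanL z (l - 1) ≤ spanL z l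
  finrank_span : ∀ l, 2 ≤ l → l < I.j → Module.finrank ℝ (spanL z l) = l
  orth_basis : ∀ l, 1 ≤ l → l < I.j → ∀ q,
    LinearIndependent (ZMod (I.prime q)) (fun s : Fin l => chi (ZMod (I.prime q)) (z l s)) →
      LinearIndependent (ZMod (I.prime q)) (I.v l q) ∧
      (Submodule.span (ZMod (I.prime q)) (Set.range (I.v l q)) :
          Set (Fin I.n → ZMod (I.prime q))) =
        {u | ∀ s : Fin l, u ⬝ᵥ chi (ZMod (I.prime q)) (z l s) = 0}
  orth_zero : ∀ l, 1 ≤ l → l < I.j → ∀ q,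
    ¬ LinearIndependent (ZMod (I.prime q))
        (fun s : Fin l => chi (ZMod (I.prime q)) (z l s)) →
      ∀ t, I.v l q t = 0

/-- Binary size of the point `(x, ε)`. -/
def pointSize (I : Instance) : ℕ := (∑ k, ratSize (I.x k)) + ratSize I.ε

/-- The input as it is stored in memory; all other cells are `0`. Array `0`: `n, W, j, m` and
numerator and denominator of `ε`. Array `1`: weights. Array `2`: primes. Arrays `3, 4`: numerators
and denominators of `eps l`, `1 ≤ l < j`. Arrays `5, 6`: numerators and denominators of `x`.
Array `7`: the entry `k` of `v l q t`, as an integer in `[0, prime q)`, in cell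
`((l * m + q) * n + t) * n + k`. -/
def input (I : Instance) : Store
  | 0, 0 => I.n
  | 0, 1 => I.W
  | 0, 2 => I.j
  | 0, 3 => I.m
  | 0, 4 => I.ε.num
  | 0, 5 => I.ε.den
  | 1, k => if h : k < I.n then I.w ⟨k, h⟩ else 0
  | 2, q => if h : q < I.m then I.prime ⟨q, h⟩ else 0
  | 3, l => if 1 ≤ l ∧ l < I.j then (I.eps l).num else 0
  | 4, l => if 1 ≤ l ∧ l < I.j then (I.eps l).den else 0
  | 5, k => if h : k < I.n then (I.x ⟨k, h⟩).num else 0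
  | 6, k => if h : k < I.n then (I.x ⟨k, h⟩).den else 0
  | 7, c =>
      let k := c % I.n
      let t := c / I.n % I.n
      let q := c / I.n / I.n % I.m
      let l := c / I.n / I.n / I.m
      if h : (1 ≤ l ∧ l < I.j) ∧ q < I.m ∧ t < I.n - l ∧ k < I.n then
        ((I.v l ⟨q, h.2.1⟩ ⟨t, h.2.2.1⟩ ⟨k, h.2.2.2⟩).val : ℤ)
      else 0
  | _, _ => 0

end Instance

/-- The final memory `s` solves the separation problem for the set `F` of feasible points and the
point `(x, e)`. Either cell `0` of array `0` is `1` and the point is feasible; or that cell is `0`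
and the integers `a k` in array `1` and `b, d` in array `2` form a linear inequality
`d ≤ ∑ k, a k * x k + b * e` which holds for all feasible points and which the point violates. -/
def SolvesSeparation {n : ℕ} (F : (Fin n → ℝ) → ℝ → Prop) (x : Fin n → ℝ) (e : ℝ)
    (s : Store) : Prop :=
  (s 0 0 = 1 ∧ F x e) ∨
  (s 0 0 = 0 ∧
    (∀ (x' : Fin n → ℝ) (e' : ℝ), F x' e' →
      (s 2 1 : ℝ) ≤ ∑ k : Fin n, (s 1 k : ℝ) * x' k + (s 2 0 : ℝ) * e') ∧
    ∑ k : Fin n, (s 1 k : ℝ) * x k + (s 2 0 : ℝ) * e < (s 2 1 : ℝ))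

end WVG

open WVG

/-! ### Bit lengths of values and the cost of expressions. -/

namespace WVG

/-! The modular tests reproduce the real ones, so $\bar P_j$ and $P_j$ have the same feasible set.
For independent $0/1$-vectors $z_1,\dots,z_l$, the vector $\chi(S)$ lies outside their span iff
$\chi(S),z_1,\dots,z_l$ are independent, that is, iff some maximal minor of this $0/1$-matrix is
nonzero. The minor is an integer of absolute value at most $n!$, while the product of the given
primes exceeds $n!$, so some prime does not divide it; conversely a minor that is nonzero modulo $p$
is nonzero. Over $\mathbb F_p$, a basis of the orthogonal space detects membership in the span. This
gives `Instance.IsScheme.notMem_spanL_iff`, and unrolling the recursion (`lpP_succ_iff`) turns $\bar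
P_j$ into one explicit list of constraints, `Instance.IsScheme.feasPbar_iff`.

Separation checks the total payoff and the signs of the payoffs. Then, for every program $l+1\le j$,
prime and vector, it minimizes $x(S)-\nu(S)$ minus the level of the program over the coalitions with
nonzero residue (over all coalitions in the first program). This is a knapsack recursion whose state
is the weight capped at $W$ and the residue modulo $p$, hence with $(W+1)p$ states. All quantities
are scaled to integers divisible by $2^n$, and player $k$ costs another $2^k$: the minimum keeps its
sign and shows a minimizing coalition in its $n$ lowest bits (`Instance.run_cost_eq`,
`Separation.den_search`).

Two things remain for the running time. The encoding of the levels $\varepsilon_l$ is not part of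
the size parameter, so it has to be bounded: an extreme point of the optimal set together with
$\varepsilon_1,\dots,\varepsilon_l$ solves a nonsingular system with entries in $\{-1,0,1\}$, and
Cramer's rule gives numerators and denominators at most $(2n)!$
(`Instance.IsScheme.eps_le_factorial`). And the logarithmic cost must not explode: programs are
written in a small loop language in which one assignment lengthens numbers only additively, which
yields a generic polynomial bound, `Cmd.exec_den`. -/

theorem bitLen_pos (a : ℤ) : 1 ≤ bitLen a := Nat.le_add_left _ _

theorem bitLen_le_iff {a : ℤ} {k : ℕ} : bitLen a ≤ k + 1 ↔ a.natAbs < 2 ^ k := by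
  unfold bitLen
  rw [Nat.add_le_add_iff_right, Nat.size_le]

theorem natAbs_lt_bitLen (a : ℤ) : a.natAbs < 2 ^ (bitLen a - 1) := by
  simpa [bitLen] using Nat.lt_size_self a.natAbs

theorem bitLen_mono {a b : ℤ} (h : a.natAbs ≤ b.natAbs) : bitLen a ≤ bitLen b := by
  unfold bitLen
  exact Nat.add_le_add_right (Nat.size_le_size h) 1

theorem bitLen_add (a b : ℤ) : bitLen (a + b) ≤ max (bitLen a) (bitLen b) + 1 := by
  obtain ⟨k, hk⟩ : ∃ k, max (bitLen a) (bitLen b) = k + 1 :=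
    ⟨max (bitLen a) (bitLen b) - 1, by have := bitLen_pos a; omega⟩
  have ha := bitLen_le_iff.1 (hk ▸ le_max_left (bitLen a) (bitLen b))
  have hb := bitLen_le_iff.1 (hk ▸ le_max_right (bitLen a) (bitLen b))
  rw [hk, bitLen_le_iff, pow_succ]
  have := Int.natAbs_add_le a b
  omega

theorem bitLen_neg (a : ℤ) : bitLen (-a) = bitLen a := by simp [bitLen]

theorem bitLen_sub (a b : ℤ) : bitLen (a - b) ≤ max (bitLen a) (bitLen b) + 1 := by
  simpa [sub_eq_add_neg, bitLen_neg] using bitLen_add a (-b)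

theorem bitLen_mul (a b : ℤ) : bitLen (a * b) ≤ bitLen a + bitLen b := by
  have ha := natAbs_lt_bitLen a
  have hb := natAbs_lt_bitLen b
  have h1 := bitLen_pos a
  have h2 := bitLen_pos b
  refine (bitLen_le_iff (k := bitLen a - 1 + (bitLen b - 1)).2 ?_).trans (by omega)
  rw [Int.natAbs_mul, pow_add]
  exact Nat.mul_lt_mul'' ha hb

theorem bitLen_div (a b : ℤ) : bitLen (a / b) ≤ bitLen a :=
  bitLen_mono (Int.natAbs_ediv_le_natAbs a b)

theorem bitLen_mod (a b : ℤ) : bitLen (a % b) ≤ max (bitLen a) (bitLen b) := by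
  rcases eq_or_ne b 0 with rfl | hb
  · simp
  · refine (bitLen_mono ?_).trans (le_max_right _ _)
    have h1 := Int.emod_nonneg a hb
    have h2 := Int.emod_lt_abs a hb
    rw [Int.abs_eq_natAbs] at h2
    omega

theorem bitLen_natCast_le (k : ℕ) : bitLen (k : ℤ) ≤ k + 1 := by
  rw [bitLen_le_iff]
  simpa using Nat.lt_two_pow_self

theorem bitLen_ite_le (P : Prop) [Decidable P] : bitLen (if P then 1 else 0) ≤ 2 := by
  split_ifs <;> decide

namespace Expr

/-- Arrays read by an expression. -/
def reads : Expr → List ℕ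
  | lit _ => []
  | get a i => a :: i.reads
  | op _ e₁ e₂ => e₁.reads ++ e₂.reads

theorem eval_congr {s s' : Store} : ∀ {e : Expr}, (∀ a ∈ e.reads, s' a = s a) →
    e.eval s' = e.eval s
  | lit _, _ => rfl
  | get a i, h => by
    have hi : i.eval s' = i.eval s := eval_congr fun b hb => h b (by simp [reads, hb])
    simp [eval, hi, h a (by simp [reads])]
  | op o e₁ e₂, h => by
    have h₁ : e₁.eval s' = e₁.eval s := eval_congr fun b hb => h b (by simp [reads, hb])
    have h₂ : e₂.eval s' = e₂.eval s := eval_congr fun b hb => h b (by simp [reads, hb])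
    simp [eval, h₁, h₂]

/-- Degree, in the contents of the arrays that are not read-only, of the bit length of a value. -/
def deg (ro : ℕ → Bool) : Expr → ℕ
  | lit _ => 0
  | get a _ => if ro a then 0 else 1
  | op .add e₁ e₂ => max (e₁.deg ro) (e₂.deg ro)
  | op .sub e₁ e₂ => max (e₁.deg ro) (e₂.deg ro)
  | op .mul e₁ e₂ => e₁.deg ro + e₂.deg ro
  | op .div e₁ _ => e₁.deg ro
  | op .mod e₁ e₂ => max (e₁.deg ro) (e₂.deg ro)
  | op .le _ _ => 0
  | op .eq _ _ => 0

/-- Coefficient of the bit length of the read-only data in the bit length of a value. -/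
def offset : Expr → ℕ
  | lit c => bitLen c
  | get _ _ => 1
  | op .add e₁ e₂ => e₁.offset + e₂.offset + 1
  | op .sub e₁ e₂ => e₁.offset + e₂.offset + 1
  | op .mul e₁ e₂ => e₁.offset + e₂.offset
  | op .div e₁ _ => e₁.offset
  | op .mod e₁ e₂ => e₁.offset + e₂.offset
  | op .le _ _ => 2
  | op .eq _ _ => 2

/-- Coefficient of the squared bit length of the memory in the cost of an expression. -/
def costCoeff (ro : ℕ → Bool) : Expr → ℕ
  | lit c => bitLen c
  | get _ i => i.costCoeff ro + (i.deg ro + i.offset) + 1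
  | op _ e₁ e₂ => e₁.costCoeff ro + e₂.costCoeff ro +
      (e₁.deg ro + e₁.offset) * (e₂.deg ro + e₂.offset)

/-- The contents of a memory have at most `B` bits, those of the read-only arrays at most `B₀`. -/
structure _root_.WVG.Store.Bounded (s : Store) (ro : ℕ → Bool) (B₀ B : ℕ) : Prop where
  one_le : 1 ≤ B₀
  readOnly : ∀ a, ro a = true → ∀ i, bitLen (s a i) ≤ B₀
  all : ∀ a i, bitLen (s a i) ≤ B

/-- Products add degrees and sums take maxima, as for polynomials. Read-only contents count towards
`B₀` and not towards the degree, so an expression of degree at most one exceeds `B` only by a fixed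
multiple of `B₀`; this is what excludes repeated squaring. -/
theorem bitLen_eval_le {s : Store} {ro : ℕ → Bool} {B₀ B : ℕ} (hs : s.Bounded ro B₀ B) :
    ∀ e : Expr, bitLen (e.eval s) ≤ e.deg ro * B + e.offset * B₀ := by
  have hB := hs.one_le
  intro e
  induction e with
  | lit c =>
    simp only [eval, deg, offset]
    nlinarith [bitLen_pos c]
  | get a i _ =>
    simp only [eval, deg, offset]
    split_ifs with h
    · have := hs.readOnly a h (i.eval s).toNat
      omega
    · have := hs.all a (i.eval s).toNat
      omega
  | op o e₁ e₂ h₁ h₂ =>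
    have hm₁ : e₁.deg ro * B ≤ max (e₁.deg ro) (e₂.deg ro) * B :=
      Nat.mul_le_mul_right _ (le_max_left _ _)
    have hm₂ : e₂.deg ro * B ≤ max (e₁.deg ro) (e₂.deg ro) * B :=
      Nat.mul_le_mul_right _ (le_max_right _ _)
    cases o <;> simp only [eval, BinOp.eval, deg, offset, add_mul, zero_mul, one_mul]
    · have := bitLen_add (e₁.eval s) (e₂.eval s)
      omega
    · have := bitLen_sub (e₁.eval s) (e₂.eval s)
      omega
    · have := bitLen_mul (e₁.eval s) (e₂.eval s)
      omega
    · exact (bitLen_div _ _).trans h₁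
    · have := bitLen_mod (e₁.eval s) (e₂.eval s)
      omega
    · have := bitLen_ite_le (e₁.eval s ≤ e₂.eval s)
      omega
    · have := bitLen_ite_le (e₁.eval s = e₂.eval s)
      omega

theorem bitLen_eval_le' {s : Store} {ro : ℕ → Bool} {B₀ B : ℕ} (hs : s.Bounded ro B₀ B)
    (e : Expr) : bitLen (e.eval s) ≤ (e.deg ro + e.offset) * (B + B₀) := by
  have := bitLen_eval_le hs e
  nlinarith [Nat.zero_le (e.deg ro * B₀), Nat.zero_le (e.offset * B)]

theorem cost_le {s : Store} {ro : ℕ → Bool} {B₀ B : ℕ} (hs : s.Bounded ro B₀ B) :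
    ∀ e : Expr, e.cost s ≤ e.costCoeff ro * (B + B₀) ^ 2 := by
  have hB := hs.one_le
  have h1 : 1 ≤ B + B₀ := by omega
  have h2 : B + B₀ ≤ (B + B₀) ^ 2 := Nat.le_self_pow two_ne_zero _
  intro e
  induction e with
  | lit c =>
    simp only [cost, costCoeff]
    exact Nat.le_mul_of_pos_right _ (by positivity)
  | get a i hi =>
    simp only [cost, costCoeff]
    have h3 := bitLen_eval_le' hs i
    have h4 := hs.all a (i.eval s).toNat
    have h5 := Nat.mul_le_mul_left (i.deg ro + i.offset) h2
    rw [add_mul, add_mul, one_mul]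
    omega
  | op o e₁ e₂ h₁ h₂ =>
    simp only [cost, costCoeff]
    have h3 := Nat.mul_le_mul (bitLen_eval_le' hs e₁) (bitLen_eval_le' hs e₂)
    have h4 : (e₁.deg ro + e₁.offset) * (B + B₀) * ((e₂.deg ro + e₂.offset) * (B + B₀)) =
      (e₁.deg ro + e₁.offset) * (e₂.deg ro + e₂.offset) * (B + B₀) ^ 2 := by ring
    rw [add_mul, add_mul]
    omega

end Expr

/-! ### A loop language and its generic time bound. -/

/-- Programs whose loops run through an initial segment of the natural numbers. -/
inductive Cmd where
  | assign (a : ℕ) (i e : Expr)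
  | seq (c d : Cmd)
  | when (e : Expr) (c : Cmd)
  | upTo (v : ℕ) (b : Expr) (c : Cmd)

theorem Store.write_of_ne {s : Store} {a b i : ℕ} {x : ℤ} (h : b ≠ a) :
    s.write a i x b = s b := by
  simp [Store.write, h]

theorem Store.write_same {s : Store} {a i k : ℕ} {x : ℤ} :
    s.write a i x a k = if k = i then x else s a k := by
  simp [Store.write, Function.update_apply]

/-- Result of iterating `f`, the number of rounds being kept in cell `0` of array `v`. -/
def iter (f : Store → Store) (v : ℕ) (s : Store) : ℕ → Store
  | 0 => s.write v 0 0
  | i + 1 => (f (iter f v s i)).write v 0 (i + 1 : ℕ)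

namespace Cmd

/-- The function on memories computed by a command. -/
def den : Cmd → Store → Store
  | assign a i e, s => s.write a (i.eval s).toNat (e.eval s)
  | seq c d, s => d.den (c.den s)
  | when e c, s => if e.eval s = 0 then s else c.den s
  | upTo v b c, s => iter c.den v s (b.eval s).toNat

/-- The counter of a loop, incremented. -/
def next (v : ℕ) : Expr := .op .add (.get v (.lit 0)) (.lit 1)

/-- The program that realizes a command. -/
def compile : Cmd → Prog
  | assign a i e => .assign a i e
  | seq c d => .seq c.compile d.compile
  | when e c => .ite e c.compile (.loop (.lit 0) c.compile)
  | upTo v b c => .seq (.assign v (.lit 0) (.lit 0))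
      (.loop (.op .le (next v) b) (.seq c.compile (.assign v (.lit 0) (next v))))

/-- Arrays to which a command writes. -/
def writes : Cmd → List ℕ
  | assign a _ _ => [a]
  | seq c d => c.writes ++ d.writes
  | when _ c => c.writes
  | upTo v _ c => v :: c.writes

/-- Read-only arrays are not written to, the counter and the bound of a loop are not changed by its
body, and bit lengths grow at most additively. -/
def wf (ro : ℕ → Bool) : Cmd → Bool
  | assign a _ e => !ro a && decide (e.deg ro ≤ 1)
  | seq c d => c.wf ro && d.wf ro
  | when _ c => c.wf ro
  | upTo v b c => !ro v && decide (v ∉ c.writes) && decide (v ∉ b.reads) &&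
      decide (∀ a ∈ b.reads, a ∉ c.writes) && c.wf ro

/-- The loops make at most `M` rounds in memories that agree with `s` on read-only arrays. -/
def LoopBound (ro : ℕ → Bool) (s : Store) (M : ℕ) : Cmd → Prop
  | assign _ _ _ => True
  | seq c d => c.LoopBound ro s M ∧ d.LoopBound ro s M
  | when _ c => c.LoopBound ro s M
  | upTo _ b c => (∀ s' : Store, (∀ a, ro a = true → s' a = s a) → b.eval s' ≤ M) ∧
      c.LoopBound ro s M

/-- Bound for the number of steps in terms of the bound for the number of rounds of loops. -/
noncomputable def steps : Cmd → Polynomial ℕ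
  | assign _ _ _ => 1
  | seq c d => c.steps + d.steps
  | when _ c => c.steps + 2
  | upTo _ _ c => Polynomial.X * (c.steps + 2) + 2

/-- Coefficient in the bound for the cost of an assignment. -/
def assignCoeff (ro : ℕ → Bool) (i e : Expr) : ℕ :=
  i.costCoeff ro + e.costCoeff ro + (i.deg ro + i.offset) + (e.deg ro + e.offset)

/-- Coefficient in the bound for the cost of a step. -/
def stepCoeff (ro : ℕ → Bool) : Cmd → ℕ
  | assign _ i e => assignCoeff ro i e
  | seq c d => c.stepCoeff ro + d.stepCoeff ro
  | when e c => e.costCoeff ro + 2 + c.stepCoeff ro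
  | upTo v b c => assignCoeff ro (.lit 0) (.lit 0) + ((Expr.op .le (next v) b).costCoeff ro + 1) +
      assignCoeff ro (.lit 0) (next v) + c.stepCoeff ro

theorem den_of_notMem : ∀ {c : Cmd} {s : Store} {a : ℕ}, a ∉ c.writes → c.den s a = s a
  | assign b i e, s, a, h => by
    simp only [writes, List.mem_singleton] at h
    simp [den, Store.write_of_ne h]
  | seq c d, s, a, h => by
    simp only [writes, List.mem_append, not_or] at h
    simp [den, den_of_notMem h.1, den_of_notMem h.2]
  | when e c, s, a, h => by
    simp only [writes] at h
    simp only [den]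
    split_ifs
    · rfl
    · exact den_of_notMem h
  | upTo v b c, s, a, h => by
    simp only [writes, List.mem_cons, not_or] at h
    simp only [den]
    induction (b.eval s).toNat with
    | zero => simp [iter, Store.write_of_ne h.1]
    | succ i ih => rw [iter, Store.write_of_ne h.1, den_of_notMem h.2, ih]

theorem notMem_writes {ro : ℕ → Bool} : ∀ {c : Cmd}, c.wf ro = true → ∀ {a : ℕ}, ro a = true →
    a ∉ c.writes
  | assign b i e, h, a, ha => by
    simp only [wf, Bool.and_eq_true, Bool.not_eq_true'] at h
    simp only [writes, List.mem_singleton]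
    rintro rfl
    simp [ha] at h
  | seq c d, h, a, ha => by
    simp only [wf, Bool.and_eq_true] at h
    simp [writes, notMem_writes h.1 ha, notMem_writes h.2 ha]
  | when e c, h, a, ha => notMem_writes (c := c) h ha
  | upTo v b c, h, a, ha => by
    simp only [wf, Bool.and_eq_true, Bool.not_eq_true'] at h
    simp only [writes, List.mem_cons, not_or]
    refine ⟨?_, notMem_writes h.2 ha⟩
    rintro rfl
    simp [ha] at h

theorem LoopBound.congr {ro : ℕ → Bool} {s s' : Store} {M : ℕ}
    (hs : ∀ a, ro a = true → s' a = s a) : ∀ {c : Cmd}, c.LoopBound ro s M → c.LoopBound ro s' M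
  | assign _ _ _, _ => trivial
  | seq _ _, h => ⟨LoopBound.congr hs h.1, LoopBound.congr hs h.2⟩
  | when _ c, h => LoopBound.congr (c := c) hs h
  | upTo _ _ _, h =>
    ⟨fun s'' h'' => h.1 s'' fun a ha => (h'' a ha).trans (hs a ha), LoopBound.congr hs h.2⟩

theorem iter_induction {f : Store → Store} {v : ℕ} {s : Store} {N : ℕ} (P : ℕ → Store → Prop)
    (h₀ : P 0 (s.write v 0 0))
    (hstep : ∀ i < N, ∀ s' : Store, s' v 0 = (i : ℕ) → P i s' → P (i + 1) ((f s').write v 0 (i + 1 : ℕ))) :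
    P N (iter f v s N) := by
  suffices ∀ i ≤ N, P i (iter f v s i) from this N le_rfl
  intro i
  induction i with
  | zero => exact fun _ => h₀
  | succ i ih =>
    intro hi
    refine hstep i hi _ ?_ (ih (by omega))
    cases i <;> simp [iter, Store.write]

end Cmd

theorem Store.Bounded.mono {s : Store} {ro : ℕ → Bool} {B₀ B B' : ℕ} (h : s.Bounded ro B₀ B)
    (hB : B ≤ B') : s.Bounded ro B₀ B' :=
  ⟨h.one_le, h.readOnly, fun a i => (h.all a i).trans hB⟩

theorem Store.Bounded.write {s : Store} {ro : ℕ → Bool} {B₀ B : ℕ} (h : s.Bounded ro B₀ B)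
    {a i : ℕ} {x : ℤ} (ha : ro a = false) (hx : bitLen x ≤ B) :
    (s.write a i x).Bounded ro B₀ B := by
  refine ⟨h.one_le, fun b hb k => ?_, fun b k => ?_⟩
  · rw [Store.write_of_ne (by rintro rfl; simp [ha] at hb)]
    exact h.readOnly b hb k
  · rcases eq_or_ne b a with rfl | hba
    · rw [Store.write_same]
      split_ifs
      · exact hx
      · exact h.all _ _
    · rw [Store.write_of_ne hba]
      exact h.all _ _

namespace Cmd

/-- The basic unit of the time analysis: one step costs at most `κ` times a square and raises the
bit bound by `κ * B₀`, independently of `B`. -/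
theorem exec_assign {s : Store} {ro : ℕ → Bool} {B₀ B κ a : ℕ} {i e : Expr}
    (hs : s.Bounded ro B₀ B) (ha : ro a = false) (he : e.deg ro ≤ 1)
    (hκ : assignCoeff ro i e ≤ κ) :
    ∃ t, Exec (.assign a i e) s t (s.write a (i.eval s).toNat (e.eval s)) ∧
      t ≤ κ * (B + B₀) ^ 2 ∧
      (s.write a (i.eval s).toNat (e.eval s)).Bounded ro B₀ (B + κ * B₀) := by
  have h1 := Expr.cost_le hs i
  have h2 := Expr.cost_le hs e
  have h3 := Expr.bitLen_eval_le' hs i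
  have h4 := Expr.bitLen_eval_le' hs e
  have h5 := Expr.bitLen_eval_le hs e
  have hsq : B + B₀ ≤ (B + B₀) ^ 2 := Nat.le_self_pow two_ne_zero _
  refine ⟨_, Exec.assign a i e s, ?_, (hs.mono (Nat.le_add_right _ _)).write ha ?_⟩
  · refine le_trans ?_ (Nat.mul_le_mul_right _ hκ)
    simp only [assignCoeff]
    have h6 := Nat.mul_le_mul_left (i.deg ro + i.offset) hsq
    have h7 := Nat.mul_le_mul_left (e.deg ro + e.offset) hsq
    rw [add_mul, add_mul, add_mul]
    omega
  · have h6 : e.deg ro * B ≤ 1 * B := Nat.mul_le_mul_right _ he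
    have h7 : e.offset * B₀ ≤ κ * B₀ := by
      refine Nat.mul_le_mul_right _ (le_trans ?_ hκ)
      simp only [assignCoeff]
      omega
    omega

/-- Each of the `steps` many unit steps raises the bit bound by at most `κ * B₀`, so all of them can
be charged at the final bound. Loop bounds depend only on read-only arrays and thus survive the
execution of earlier commands. -/
theorem exec_den {ro : ℕ → Bool} {M κ B₀ : ℕ} : ∀ (c : Cmd) {s : Store} {B : ℕ},
    c.wf ro = true → c.stepCoeff ro ≤ κ → c.LoopBound ro s M → s.Bounded ro B₀ B →
    ∃ t, Exec c.compile s t (c.den s) ∧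
      t ≤ c.steps.eval M * (κ * (B + c.steps.eval M * κ * B₀ + B₀) ^ 2) ∧
      (c.den s).Bounded ro B₀ (B + c.steps.eval M * κ * B₀)
  | assign a i e, s, B, hwf, hκ, hM, hs => by
    simp only [wf, Bool.and_eq_true, Bool.not_eq_true', decide_eq_true_eq] at hwf
    obtain ⟨t, h1, h2, h3⟩ := exec_assign (i := i) hs hwf.1 hwf.2 hκ
    refine ⟨t, h1, h2.trans ?_, ?_⟩
    · simp only [steps, Polynomial.eval_one, one_mul]
      gcongr
      omega
    · simpa [steps, den] using h3
  | seq c d, s, B, hwf, hκ, hM, hs => by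
    simp only [wf, Bool.and_eq_true] at hwf
    simp only [stepCoeff] at hκ
    obtain ⟨t, h1, h2, h3⟩ := exec_den (κ := κ) c hwf.1 (by omega) hM.1 hs
    obtain ⟨t', h1', h2', h3'⟩ := exec_den (κ := κ) d hwf.2 (by omega)
      (hM.2.congr fun a ha => den_of_notMem (notMem_writes hwf.1 ha)) h3
    refine ⟨t + t', Exec.seq h1 h1', ?_, h3'.mono (le_of_eq ?_)⟩
    · simp only [steps, Polynomial.eval_add]
      rw [add_mul]
      refine add_le_add (h2.trans ?_) (h2'.trans ?_)
      · gcongr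
        omega
      · refine Nat.mul_le_mul_left _ (Nat.mul_le_mul_left _ (Nat.pow_le_pow_left (le_of_eq ?_) 2))
        ring
    · simp only [steps, Polynomial.eval_add]
      ring
  | when e c, s, B, hwf, hκ, hM, hs => by
    simp only [wf] at hwf
    simp only [stepCoeff] at hκ
    have hB := hs.one_le
    have h0 := Expr.cost_le hs e
    have hle : B + c.steps.eval M * κ * B₀ + B₀ ≤ B + (c.steps.eval M + 2) * κ * B₀ + B₀ := by
      gcongr
      omega
    have hle' : B + B₀ ≤ B + (c.steps.eval M + 2) * κ * B₀ + B₀ := by omega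
    have hpos : 1 ≤ (B + B₀) ^ 2 := Nat.one_le_pow _ _ (by omega)
    have hcost : e.cost s + 2 ≤ κ * (B + (c.steps.eval M + 2) * κ * B₀ + B₀) ^ 2 := by
      calc e.cost s + 2 ≤ (e.costCoeff ro + 2) * (B + B₀) ^ 2 := by rw [add_mul]; omega
        _ ≤ _ := Nat.mul_le_mul (by omega) (Nat.pow_le_pow_left hle' 2)
    simp only [steps, Polynomial.eval_add, Polynomial.eval_ofNat, den, compile]
    -- The language of programs has no empty statement; the missing branch is a loop with the
    -- constant condition `0`, which costs two units.
    split_ifs with he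
    · refine ⟨_, Exec.ite_false he (Exec.loop_done rfl), ?_, hs.mono (by omega)⟩
      have h2 : (Expr.lit 0).cost s = 1 := rfl
      rw [h2, add_mul]
      omega
    · obtain ⟨t, h1, h2, h3⟩ := exec_den (κ := κ) c hwf (by omega) hM hs
      refine ⟨_, Exec.ite_true he h1, ?_, h3.mono (by omega)⟩
      have h4 : t ≤ c.steps.eval M *
          (κ * (B + (c.steps.eval M + 2) * κ * B₀ + B₀) ^ 2) := h2.trans (by gcongr)
      rw [add_mul]
      omega
  | upTo v b c, s, B, hwf, hκ, hM, hs => by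
    simp only [wf, Bool.and_eq_true, Bool.not_eq_true', decide_eq_true_eq] at hwf
    obtain ⟨⟨⟨⟨hv, hvc⟩, hvb⟩, hbc⟩, hwc⟩ := hwf
    simp only [stepCoeff] at hκ
    obtain ⟨hb, hMc⟩ := hM
    have hB := hs.one_le
    simp only [steps, Polynomial.eval_add, Polynomial.eval_mul, Polynomial.eval_X,
      Polynomial.eval_ofNat, den, compile]
    set K := c.steps.eval M with hK
    set N := (b.eval s).toNat with hN
    have hNM : N ≤ M := by
      have := hb s fun _ _ => rfl
      omega
    set F := iter c.den v s with hF
    obtain ⟨t₀, h1₀, h2₀, h3₀⟩ := exec_assign (a := v) (i := .lit 0) (e := .lit 0) (κ := κ) hs hv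
      (Nat.zero_le _) (by omega)
    -- Besides the bit bound, the invariant records the counter, the read-only arrays and the value
    -- of the loop bound, which the body cannot change.
    have hinv : ∀ i ≤ N, (F i).Bounded ro B₀ (B + κ * B₀ + i * ((K + 1) * κ * B₀)) ∧
        F i v 0 = i ∧ (∀ a, ro a = true → F i a = s a) ∧ b.eval (F i) = b.eval s := by
      intro i
      induction i with
      | zero =>
        intro _
        refine ⟨by rw [zero_mul, add_zero]; exact h3₀, by simp [hF, iter, Store.write_same], fun a ha => ?_,
          Expr.eval_congr fun a ha => ?_⟩
        · exact Store.write_of_ne (by rintro rfl; simp [hv] at ha)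
        · exact Store.write_of_ne (by rintro rfl; exact hvb ha)
      | succ i ih =>
        intro hi
        obtain ⟨h1, h2, h3, h4⟩ := ih (by omega)
        obtain ⟨t, -, -, h5⟩ := exec_den (κ := κ) c hwc (by omega) (hMc.congr h3) h1
        have h6 : c.den (F i) v 0 = i := by rw [den_of_notMem hvc, h2]
        obtain ⟨t', -, -, h7⟩ := exec_assign (a := v) (i := .lit 0) (e := next v) (κ := κ) h5 hv
          (by simp [next, Expr.deg, hv]) (by omega)
        have h8 : (next v).eval (c.den (F i)) = ((i + 1 : ℕ) : ℤ) := by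
          simp [next, Expr.eval, BinOp.eval, h6]
        rw [h8] at h7
        refine ⟨h7.mono (le_of_eq (by rw [← hK]; ring)), by simp [hF, iter, Store.write_same],
          fun a ha => ?_, ?_⟩
        · rw [hF, iter, Store.write_of_ne (by rintro rfl; simp [hv] at ha),
            den_of_notMem (notMem_writes hwc ha)]
          exact h3 a ha
        · rw [← h4]
          refine Expr.eval_congr fun a ha => ?_
          rw [hF, iter, Store.write_of_ne (by rintro rfl; exact hvb ha), den_of_notMem (hbc a ha)]
    -- A round consists of `K` steps of the body, the increment and the test; the initialization and
    -- the last test make up the `+ 2`.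
    set B' := B + (M * (K + 2) + 2) * κ * B₀ with hB'
    have hBi : ∀ i ≤ N, B + κ * B₀ + i * ((K + 1) * κ * B₀) ≤ B' := by
      intro i hi
      have h1 : i * (K + 1) ≤ M * (K + 2) := Nat.mul_le_mul (by omega) (by omega)
      have h2 : (1 + i * (K + 1)) * (κ * B₀) ≤ (M * (K + 2) + 2) * (κ * B₀) :=
        Nat.mul_le_mul_right _ (by omega)
      have h3 : B + κ * B₀ + i * ((K + 1) * κ * B₀) = B + (1 + i * (K + 1)) * (κ * B₀) := by ring
      rw [h3, hB', mul_assoc _ κ B₀]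
      omega
    set C := κ * (B' + B₀) ^ 2 with hC
    have hpos : 1 ≤ (B' + B₀) ^ 2 := Nat.one_le_pow _ _ (by omega)
    have hcond : ∀ i ≤ N, (Expr.op .le (next v) b).cost (F i) + 1 ≤ C := by
      intro i hi
      have := Expr.cost_le ((hinv i hi).1.mono (hBi i hi)) (Expr.op .le (next v) b)
      calc _ ≤ ((Expr.op .le (next v) b).costCoeff ro + 1) * (B' + B₀) ^ 2 := by
            rw [add_mul]; omega
        _ ≤ _ := Nat.mul_le_mul_right _ (by omega)
    -- The test compares the incremented counter with the bound, so it holds exactly for `i < N`,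
    -- also when the bound is negative and `N = 0`.
    have hval : ∀ i, i ≤ N → (Expr.op .le (next v) b).eval (F i) = if i < N then 1 else 0 := by
      intro i hi
      obtain ⟨-, h2, -, h4⟩ := hinv i hi
      simp only [next, Expr.eval, BinOp.eval, h4]
      rw [show (0 : ℤ).toNat = 0 from rfl, h2]
      congr 1
      simp only [eq_iff_iff]
      omega
    -- Induction on the number of rounds that are left, because `Exec.loop_step` adds a round in
    -- front.
    have hloop : ∀ d ≤ N, ∃ t, Exec (.loop (.op .le (next v) b)
        (.seq c.compile (.assign v (.lit 0) (next v)))) (F (N - d)) t (F N) ∧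
        t ≤ (d * (K + 2) + 1) * C := by
      intro d
      induction d with
      | zero =>
        intro _
        refine ⟨_, Exec.loop_done (by rw [Nat.sub_zero, hval N le_rfl]; simp), ?_⟩
        simpa using hcond N le_rfl
      | succ d ih =>
        intro hd
        obtain ⟨t₂, e₂, l₂⟩ := ih (by omega)
        set i := N - (d + 1) with hi
        have hi' : N - d = i + 1 := by omega
        rw [hi'] at e₂
        obtain ⟨h1, h2, h3, h4⟩ := hinv i (by omega)
        obtain ⟨t, e₁, l₁, h5⟩ := exec_den (κ := κ) c hwc (by omega) (hMc.congr h3) h1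
        have h6 : c.den (F i) v 0 = i := by rw [den_of_notMem hvc, h2]
        obtain ⟨t', e₃, l₃, -⟩ := exec_assign (a := v) (i := .lit 0) (e := next v) (κ := κ) h5 hv
          (by simp [next, Expr.deg, hv]) (by omega)
        have h8 : (next v).eval (c.den (F i)) = ((i + 1 : ℕ) : ℤ) := by
          simp [next, Expr.eval, BinOp.eval, h6]
        rw [h8] at e₃
        have hBB : B + κ * B₀ + i * ((K + 1) * κ * B₀) + K * κ * B₀ ≤ B' := by
          have h9 := hBi (i + 1) (by omega)
          have h10 : B + κ * B₀ + (i + 1) * ((K + 1) * κ * B₀) = B + κ * B₀ +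
            i * ((K + 1) * κ * B₀) + K * κ * B₀ + κ * B₀ := by ring
          omega
        refine ⟨_, Exec.loop_step (by rw [hval i (by omega), if_pos (by omega)]; simp)
          (Exec.seq e₁ e₃) e₂, ?_⟩
        have hc := hcond i (by omega)
        have hl₁ : t ≤ K * C := l₁.trans (by rw [hC]; gcongr)
        have hl₃ : t' ≤ C := l₃.trans (by rw [hC]; gcongr)
        have : ((d + 1) * (K + 2) + 1) * C = C + (K * C + C) + (d * (K + 2) + 1) * C := by ring
        rw [this]
        omega
    obtain ⟨t, e, l⟩ := hloop N le_rfl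
    rw [Nat.sub_self] at e
    refine ⟨_, Exec.seq h1₀ e, ?_, (hinv N le_rfl).1.mono (hBi N le_rfl)⟩
    have h1 : t₀ ≤ C := h2₀.trans (by rw [hC]; gcongr; omega)
    have h2 : N * (K + 2) ≤ M * (K + 2) := Nat.mul_le_mul_right _ hNM
    calc t₀ + t ≤ C + (N * (K + 2) + 1) * C := by omega
      _ = (N * (K + 2) + 2) * C := by ring
      _ ≤ _ := Nat.mul_le_mul_right _ (by omega)

end Cmd

end WVG

/-! ### Minors, primes and the modular membership test. -/

namespace WVG

open Matrix

/-- A spanning family contains a basis, and a basis of the space of functions on `κ` can be indexed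
by `κ`. -/
theorem exists_det_ne_zero_of_span_eq_top {K κ ι : Type*} [Field K] [Fintype κ] [DecidableEq κ]
    (v : ι → κ → K) (h : Submodule.span K (Set.range v) = ⊤) :
    ∃ f : κ → ι, (Matrix.of fun i => v (f i)).det ≠ 0 := by
  obtain ⟨η, a, -, hspan, hli⟩ := exists_linearIndependent' K v
  have b : Module.Basis η K (κ → K) := Module.Basis.mk hli (by rw [hspan, h])
  let e : κ ≃ η := (Pi.basisFun K κ).indexEquiv b
  refine ⟨a ∘ e, ?_⟩
  have h1 : LinearIndependent K (Matrix.of fun i => v ((a ∘ e) i)).row :=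
    hli.comp e e.injective
  exact ((Matrix.isUnit_iff_isUnit_det _).1 (linearIndependent_rows_iff_isUnit.1 h1)).ne_zero

/-- Row rank equals column rank: independent rows make the columns span, so some columns form a
basis. Conversely, rows are independent if their restrictions to some columns are. -/
theorem linearIndependent_iff_exists_det_ne_zero {K κ ι : Type*} [Field K] [Fintype κ]
    [DecidableEq κ] [Fintype ι] (A : Matrix κ ι K) :
    LinearIndependent K A.row ↔ ∃ f : κ → ι, (A.submatrix id f).det ≠ 0 := by
  constructor
  · intro h
    have hspan : Submodule.span K (Set.range A.col) = ⊤ := by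
      apply Submodule.eq_top_of_finrank_eq
      rw [← rank_eq_finrank_span_cols, h.rank_matrix, Module.finrank_fintype_fun_eq_card]
    obtain ⟨f, hf⟩ := exists_det_ne_zero_of_span_eq_top _ hspan
    refine ⟨f, ?_⟩
    rwa [← det_transpose]
  · rintro ⟨f, hf⟩
    have h := linearIndependent_rows_of_det_ne_zero hf
    exact LinearIndependent.of_comp (LinearMap.funLeft K K f) h

/-- Linear independence of an integer matrix over a field in terms of its integer minors. -/
theorem linearIndependent_map_iff {K κ ι : Type*} [Field K] [Fintype κ] [DecidableEq κ] [Fintype ι]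
    (A : Matrix κ ι ℤ) : LinearIndependent K (A.map (Int.cast : ℤ → K)).row ↔
      ∃ f : κ → ι, (((A.submatrix id f).det : ℤ) : K) ≠ 0 := by
  rw [linearIndependent_iff_exists_det_ne_zero]
  refine exists_congr fun f => ?_
  have h := RingHom.map_det (Int.castRingHom K) (A.submatrix id f)
  simp only [Int.coe_castRingHom] at h
  rw [h]
  rfl

theorem abs_det_le_factorial {κ : Type*} [Fintype κ] [DecidableEq κ] (A : Matrix κ κ ℤ)
    (hA : ∀ i j, |A i j| ≤ 1) : |A.det| ≤ ((Fintype.card κ).factorial : ℤ) := by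
  have := det_le (abv := AbsoluteValue.abs) (x := 1) (A := A) hA
  simpa using this

/-- Every prime is at least $2$, and two distinct primes cannot both equal $2$. The strict
inequality matters, since the minors are only known to be at most $n!$. -/
theorem prod_prime_gt {m k : ℕ} (prime : Fin m → ℕ) (hp : ∀ q, (prime q).Prime)
    (hinj : Function.Injective prime) (hm : 2 ≤ m) (hk : k ≤ 2 ^ m) : k < ∏ q, prime q := by
  have h2 : ∏ _q : Fin m, 2 < ∏ q, prime q := by
    apply Finset.prod_lt_prod
    · simp
    · exact fun q _ => (hp q).two_le
    · by_contra! h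
      have h3 : ∀ q, prime q = 2 := fun q => le_antisymm (h q (Finset.mem_univ q)) (hp q).two_le
      have := hinj ((h3 ⟨0, by omega⟩).trans (h3 ⟨1, by omega⟩).symm)
      simp at this
  simp only [Finset.prod_const, Finset.card_univ, Fintype.card_fin] at h2
  omega

theorem exists_prime_not_dvd {m k : ℕ} (prime : Fin m → ℕ) (hp : ∀ q, (prime q).Prime)
    (hinj : Function.Injective prime) (hm : 2 ≤ m) (hk : k ≤ 2 ^ m) (d : ℤ) (hd : d ≠ 0)
    (hdk : |d| ≤ k) : ∃ q, ¬ (prime q : ℤ) ∣ d := by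
  by_contra! h
  have h1 : (∏ q, (prime q)) ∣ d.natAbs := by
    refine Fintype.prod_dvd_of_isRelPrime (fun a b hab => ?_)
      fun q => Int.natCast_dvd.1 (h q)
    exact Nat.coprime_iff_isRelPrime.1
      ((Nat.coprime_primes (hp a) (hp b)).2 fun h' => hab (hinj h'))
  have h2 := Nat.le_of_dvd (Int.natAbs_pos.2 hd) h1
  have h3 := prod_prime_gt prime hp hinj hm hk
  rw [Int.abs_eq_natAbs] at hdk
  omega

/-- The double orthogonal complement of a subspace is the subspace itself, over any field and
without any positivity of the pairing. -/
theorem notMem_span_iff_exists_dotProduct_ne_zero {K κ ι η : Type*} [Field K] [Fintype ι]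
    [DecidableEq ι] (a : κ → ι → K) (v : η → ι → K)
    (hv : (Submodule.span K (Set.range v) : Set (ι → K)) = {u | ∀ s, u ⬝ᵥ a s = 0}) (c : ι → K) :
    (∃ t, v t ⬝ᵥ c ≠ 0) ↔ c ∉ Submodule.span K (Set.range a) := by
  constructor
  · rintro ⟨t, ht⟩ hc
    apply ht
    have h1 : v t ∈ {u | ∀ s, u ⬝ᵥ a s = 0} := by
      rw [← hv]
      exact Submodule.subset_span ⟨t, rfl⟩
    induction hc using Submodule.span_induction with
    | mem x hx => obtain ⟨s, rfl⟩ := hx; exact h1 s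
    | zero => simp
    | add x y _ _ hx hy =>
      by_contra h
      rw [dotProduct_add] at h
      by_cases hx' : v t ⬝ᵥ x = 0
      · by_cases hy' : v t ⬝ᵥ y = 0
        · simp [hx', hy'] at h
        · exact hy' (hy hy')
      · exact hx' (hx hx')
    | smul r x _ hx =>
      by_contra h
      rw [dotProduct_smul] at h
      by_cases hx' : v t ⬝ᵥ x = 0
      · simp [hx'] at h
      · exact hx' (hx hx')
  · intro hc
    by_contra! h
    -- A functional that kills the span but not `c` is the pairing with some `u`; this `u` is
    -- orthogonal to all `a s`, hence a combination of the `v t`, which all kill `c`.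
    obtain ⟨f, hfc, hf⟩ := Submodule.exists_le_ker_of_notMem hc
    obtain ⟨u, rfl⟩ := (dotProductEquiv K ι).surjective f
    simp only [dotProductEquiv_apply_apply] at hfc
    apply hfc
    have hu : u ∈ Submodule.span K (Set.range v) := by
      rw [← SetLike.mem_coe, hv]
      intro s
      simpa using hf (Submodule.subset_span ⟨s, rfl⟩)
    clear hfc hf
    induction hu using Submodule.span_induction with
    | mem x hx => obtain ⟨t, rfl⟩ := hx; exact h t
    | zero => simp
    | add x y _ _ hx hy => rw [add_dotProduct, hx, hy, add_zero]
    | smul r x _ hx => rw [smul_dotProduct, hx, smul_zero]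

theorem chi_eq_map {K : Type*} [Field K] {n k : ℕ} (z : Fin k → Finset (Fin n)) :
    (fun s => chi K (z s)) = ((Matrix.of fun s => chi ℤ (z s)).map (Int.cast : ℤ → K)).row := by
  ext s i
  simp [chi, Matrix.row]

/-- Translates membership in a span into independence of one more vector, which minors can detect
and transfer between fields. -/
theorem linearIndependent_cons_chi {K : Type*} [Field K] {n k : ℕ} (z : Fin k → Finset (Fin n))
    (S : Finset (Fin n)) : (LinearIndependent K
      (fun s => chi K ((Fin.cons S z : Fin (k + 1) → Finset (Fin n)) s)) ↔
      LinearIndependent K (fun s => chi K (z s)) ∧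
        chi K S ∉ Submodule.span K (Set.range fun s => chi K (z s))) := by
  have h : (fun s => chi K ((Fin.cons S z : Fin (k + 1) → Finset (Fin n)) s)) =
      (Fin.cons (chi K S) fun s => chi K (z s) : Fin (k + 1) → Fin n → K) := by
    ext s : 1
    refine Fin.cases ?_ (fun i => ?_) s <;> simp
  rw [h, linearIndependent_finCons]

theorem linearIndependent_real_of_zmod {n k p : ℕ} [Fact p.Prime] (z : Fin k → Finset (Fin n))
    (h : LinearIndependent (ZMod p) fun s => chi (ZMod p) (z s)) :
    LinearIndependent ℝ fun s => chi ℝ (z s) := by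
  rw [chi_eq_map (K := ZMod p)] at h
  obtain ⟨f, hf⟩ := (linearIndependent_map_iff (K := ZMod p) _).1 h
  rw [chi_eq_map (K := ℝ)]
  refine (linearIndependent_map_iff (K := ℝ) _).2 ⟨f, fun h0 => hf ?_⟩
  rw [Int.cast_eq_zero] at h0
  simp [h0]

/-- A nonzero maximal minor has absolute value at most $k!\le n!$, so one of the primes does not
divide it and it survives the reduction. -/
theorem exists_linearIndependent_zmod_of_real {n k m : ℕ} (z : Fin k → Finset (Fin n))
    (prime : Fin m → ℕ) (hp : ∀ q, (prime q).Prime) (hinj : Function.Injective prime)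
    (hm : 2 ≤ m) (hk : n.factorial ≤ 2 ^ m)
    (h : LinearIndependent ℝ fun s => chi ℝ (z s)) :
    ∃ q, LinearIndependent (ZMod (prime q)) fun s => chi (ZMod (prime q)) (z s) := by
  have hkn : k ≤ n := by simpa using h.fintype_card_le_finrank
  rw [chi_eq_map, linearIndependent_map_iff] at h
  obtain ⟨f, hf⟩ := h
  set A := (Matrix.of fun s => chi ℤ (z s)).submatrix id f with hA
  obtain ⟨q, hq⟩ := exists_prime_not_dvd prime hp hinj hm hk A.det (by simpa using hf) (by
    refine (abs_det_le_factorial A fun i j => ?_).trans ?_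
    · simp only [hA, chi, submatrix_apply, of_apply]
      split_ifs <;> simp
    · rw [Fintype.card_fin]
      exact_mod_cast Nat.factorial_le hkn)
  have := Fact.mk (hp q)
  refine ⟨q, ?_⟩
  rw [chi_eq_map (K := ZMod (prime q))]
  refine (linearIndependent_map_iff (K := ZMod (prime q)) _).2 ⟨f, fun h0 => hq ((ZMod.intCast_zmod_eq_zero_iff_dvd _ _).1 h0)⟩

namespace Instance.IsScheme

variable {I : Instance} {z : (l : ℕ) → Fin l → Finset (Fin I.n)}

theorem three_le_m (h : I.IsScheme z) : 3 ≤ I.m ∧ I.n.factorial ≤ 2 ^ I.m := by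
  have h1 : I.n.factorial ≤ 2 ^ I.m := by
    have h2 := h.log_le
    rw [Real.logb_le_iff_le_rpow (by norm_num) (by positivity), Real.rpow_natCast] at h2
    exact_mod_cast h2
  refine ⟨?_, h1⟩
  have h3 : Nat.factorial 3 ≤ I.n.factorial := Nat.factorial_le h.three_le
  by_contra! h4
  have h5 : 2 ^ I.m ≤ 2 ^ 2 := Nat.pow_le_pow_right (by norm_num) (by omega)
  simp [Nat.factorial] at h3 h5
  omega

theorem linearIndependent_chi (h : I.IsScheme z) {l : ℕ} (hl : 1 ≤ l) (hlj : l < I.j) :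
    LinearIndependent ℝ fun s : Fin l => chi ℝ (z l s) := by
  rw [linearIndependent_iff_card_eq_finrank_span, Fintype.card_fin]
  rcases hl.eq_or_lt with rfl | hl
  · have h1 := h.span_one hlj
    unfold spanL at h1
    have h3 := h.three_le
    rw [Set.finrank, h1, finrank_span_singleton]
    intro h2
    simpa [chi] using congrFun h2 ⟨0, by omega⟩
  · exact (h.finrank_span l hl hlj).symm

/-- Primes modulo which the `z l s` become dependent carry zero vectors and never raise a false
alarm. If `chi ℝ S` is outside the span, a prime that preserves the independence of all `l + 1`
vectors also preserves that of the `z l s`, so its vectors form a genuine orthogonal basis. -/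
theorem notMem_spanL_iff (h : I.IsScheme z) {l : ℕ} (hl : 1 ≤ l) (hlj : l < I.j)
    (S : Finset (Fin I.n)) :
    (∃ (q : Fin I.m) (t : Fin (I.n - l)), I.v l q t ⬝ᵥ chi (ZMod (I.prime q)) S ≠ 0) ↔
      chi ℝ S ∉ spanL z l := by
  have hm := h.three_le_m
  constructor
  · rintro ⟨q, t, ht⟩
    have := Fact.mk (h.isPrime q)
    have hind : LinearIndependent (ZMod (I.prime q))
        fun s : Fin l => chi (ZMod (I.prime q)) (z l s) := by
      by_contra hd
      exact ht (by simp [h.orth_zero l hl hlj q hd t])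
    have h1 := (notMem_span_iff_exists_dotProduct_ne_zero _ _ (h.orth_basis l hl hlj q hind).2
      (chi (ZMod (I.prime q)) S)).1 ⟨t, ht⟩
    have h2 := (linearIndependent_cons_chi (K := ZMod (I.prime q)) (z l) S).2 ⟨hind, h1⟩
    exact ((linearIndependent_cons_chi (z l) S).1 (linearIndependent_real_of_zmod _ h2)).2
  · intro hS
    obtain ⟨q, hq⟩ := exists_linearIndependent_zmod_of_real _ I.prime h.isPrime h.prime_injective
      (by omega) hm.2 ((linearIndependent_cons_chi (z l) S).2 ⟨h.linearIndependent_chi hl hlj, hS⟩)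
    have := Fact.mk (h.isPrime q)
    have hq' := (linearIndependent_cons_chi (K := ZMod (I.prime q)) (z l) S).1 hq
    exact ⟨q, (notMem_span_iff_exists_dotProduct_ne_zero _ _
      (h.orth_basis l hl hlj q hq'.1).2 _).2 hq'.2⟩

end Instance.IsScheme

end WVG

/-! ### Explicit constraints and the size of the optimal values. -/

namespace WVG

open Matrix

/-- The coalitions that are constrained in the linear program `i + 1`. -/
def Constrained {n : ℕ} (L : ℕ → Submodule ℝ (Fin n → ℝ)) (i : ℕ) (S : Finset (Fin n)) : Prop :=
  i = 0 ∨ chi ℝ S ∉ L i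

/-- Unrolls the recursion into one list of constraints. The index is shifted: `i` stands for program
`i + 1`, whose coalitions are restricted by `L i`, and `L 0` is never consulted. Only the last
program has a free level. -/
theorem lpP_succ_iff {n : ℕ} (ν : Finset (Fin n) → ℝ) (L : ℕ → Submodule ℝ (Fin n → ℝ))
    (eps : ℕ → ℝ) (l : ℕ) (x : Fin n → ℝ) (e : ℝ) :
    lpP ν L eps (l + 1) x e ↔ (∑ i, x i = ν Finset.univ ∧ ∀ i, 0 ≤ x i) ∧
      ∀ i ≤ l, ∀ S, Constrained L i S →
        ν S + (if i = l then e else eps (i + 1)) ≤ ∑ k ∈ S, x k := by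
  induction l generalizing e with
  | zero => simp [lpP, Constrained, and_comm, and_assoc]
  | succ l ih =>
    rw [lpP, ih]
    constructor
    · rintro ⟨h1, h2, h3⟩
      refine ⟨h2, fun i hi S hS => ?_⟩
      rcases hi.eq_or_lt with rfl | hi
      · rw [if_pos rfl]
        exact h1 S (hS.resolve_left (by omega))
      · rw [if_neg hi.ne]
        have h4 := h3 i (by omega) S hS
        split_ifs at h4 with h5
        · rwa [h5]
        · exact h4
    · rintro ⟨h1, h2⟩
      refine ⟨fun S hS => ?_, h1, fun i hi S hS => ?_⟩
      · simpa using h2 (l + 1) le_rfl S (Or.inr hS)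
      · have h4 := h2 i (by omega) S hS
        rw [if_neg (by omega)] at h4
        split_ifs with h5
        · rwa [h5] at h4
        · exact h4

/-- Nonnegative payoffs with fixed total lie in a box. Compactness is needed to have an extreme
point among the optimal solutions. -/
theorem isCompact_lpP {n : ℕ} (ν : Finset (Fin n) → ℝ) (L : ℕ → Submodule ℝ (Fin n → ℝ))
    (eps : ℕ → ℝ) (l : ℕ) (e : ℝ) : IsCompact {x | lpP ν L eps (l + 1) x e} := by
  refine (isCompact_Icc (a := (0 : Fin n → ℝ)) (b := fun _ => ν Finset.univ)).of_isClosed_subset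
    ?_ ?_
  · simp only [lpP_succ_iff, Set.ofPred_and, Set.ofPred_forall]
    refine ((isClosed_eq (by fun_prop) (by fun_prop)).inter ?_).inter ?_
    · exact isClosed_iInter fun i => isClosed_le (by fun_prop) (by fun_prop)
    · exact isClosed_iInter fun i => isClosed_iInter fun _ => isClosed_iInter fun S =>
        isClosed_iInter fun _ => isClosed_le (by fun_prop) (by fun_prop)
  · intro x hx
    obtain ⟨⟨h1, h2⟩, -⟩ := (lpP_succ_iff ..).1 hx
    refine ⟨fun i => h2 i, fun i => ?_⟩
    show x i ≤ ν Finset.univ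
    rw [← h1]
    exact Finset.single_le_sum (fun k _ => h2 k) (Finset.mem_univ i)

/-- The constraints of the first `l` linear programs, in the variables `x` and `ε₁, …, ε_l`. -/
inductive Row (n l : ℕ) where
  | coalition (i : Fin l) (S : Finset (Fin n))
  | total
  | nonneg (k : Fin n)

namespace Row

variable {n l : ℕ}

/-- Coefficients of a constraint. -/
def coeff : Row n l → Fin n ⊕ Fin l → ℤ
  | coalition i S => Sum.elim (chi ℤ S) fun i' => if i' = i then -1 else 0
  | total => Sum.elim (fun _ => 1) fun _ => 0
  | nonneg k => Sum.elim (fun k' => if k' = k then 1 else 0) fun _ => 0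

/-- Right-hand side of a constraint. -/
noncomputable def rhs (win : Finset (Fin n) → Prop) : Row n l → ℤ
  | coalition _ S => open Classical in if win S then 1 else 0
  | total => open Classical in if win Finset.univ then 1 else 0
  | nonneg _ => 0

/-- Constraints that are present. -/
def Present (L : ℕ → Submodule ℝ (Fin n → ℝ)) : Row n l → Prop
  | coalition i S => Constrained L i S
  | total => True
  | nonneg _ => True

theorem abs_coeff_le (r : Row n l) (k : Fin n ⊕ Fin l) : |r.coeff k| ≤ 1 := by
  cases r <;> cases k <;> simp only [coeff, Sum.elim_inl, Sum.elim_inr, chi] <;> (try split_ifs) <;>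
    simp

theorem abs_rhs_le (win : Finset (Fin n) → Prop) (r : Row n l) : |r.rhs win| ≤ 1 := by
  cases r <;> simp only [rhs] <;> (try split_ifs) <;> simp

/-- Left-hand side of a constraint. -/
def lhs (r : Row n l) (y : Fin n ⊕ Fin l → ℝ) : ℝ := (fun k => (r.coeff k : ℝ)) ⬝ᵥ y

theorem lhs_coalition (i : Fin l) (S : Finset (Fin n)) (y : Fin n ⊕ Fin l → ℝ) :
    (coalition i S).lhs y = ∑ k ∈ S, y (Sum.inl k) - y (Sum.inr i) := by
  simp [lhs, dotProduct, coeff, chi, Finset.sum_ite_mem, sub_eq_add_neg]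

theorem lhs_total (y : Fin n ⊕ Fin l → ℝ) :
    (total : Row n l).lhs y = ∑ k, y (Sum.inl k) := by
  simp [lhs, dotProduct, coeff]

theorem lhs_nonneg (k : Fin n) (y : Fin n ⊕ Fin l → ℝ) :
    (nonneg k : Row n l).lhs y = y (Sum.inl k) := by
  simp [lhs, dotProduct, coeff]

theorem lhs_add_smul (r : Row n l) (y d : Fin n ⊕ Fin l → ℝ) (c : ℝ) :
    r.lhs (y + c • d) = r.lhs y + c * r.lhs d := by
  simp [lhs, dotProduct_add, dotProduct_smul]

instance : Finite (Row n l) := by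
  let f : Row n l → (Fin l × Finset (Fin n)) ⊕ (Unit ⊕ Fin n) := fun
    | coalition i S => Sum.inl (i, S)
    | total => Sum.inr (Sum.inl ())
    | nonneg k => Sum.inr (Sum.inr k)
  refine Finite.of_injective f fun a b h => ?_
  cases a <;> cases b <;> simp_all [f]

end Row

/-- A system of linear equations with a nonsingular matrix whose entries, like those of the right
side, are at most `1` in absolute value has a solution with small numerators and denominators. -/
theorem exists_int_of_mulVec_eq {κ : Type*} [Fintype κ] [DecidableEq κ] (A : Matrix κ κ ℤ)
    (b : κ → ℤ) (hA : ∀ i j, |A i j| ≤ 1) (hb : ∀ i, |b i| ≤ 1) (hdet : A.det ≠ 0) (y : κ → ℝ)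
    (hy : A.map (Int.cast : ℤ → ℝ) *ᵥ y = fun i => (b i : ℝ)) (k : κ) :
    ∃ a d : ℤ, d ≠ 0 ∧ |a| ≤ ((Fintype.card κ).factorial : ℤ) ∧
      |d| ≤ ((Fintype.card κ).factorial : ℤ) ∧ y k * d = a := by
  refine ⟨(A.updateCol k b).det, A.det, hdet, abs_det_le_factorial _ fun i j => ?_,
    abs_det_le_factorial _ hA, ?_⟩
  · rw [updateCol_apply]
    split_ifs
    · exact hb i
    · exact hA i j
  · have h1 : (A.map (Int.cast : ℤ → ℝ)).cramer (fun i => (b i : ℝ)) =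
        (A.map (Int.cast : ℤ → ℝ)).det • y := by
      rw [cramer_eq_adjugate_mulVec, ← hy, mulVec_mulVec, adjugate_mul, smul_mulVec, one_mulVec]
    have h2 := congrFun h1 k
    rw [cramer_apply] at h2
    have h3 : ((A.det : ℤ) : ℝ) = (A.map (Int.cast : ℤ → ℝ)).det :=
      RingHom.map_det (Int.castRingHom ℝ) A
    have h4 : (((A.updateCol k b).det : ℤ) : ℝ) =
        ((A.map (Int.cast : ℤ → ℝ)).updateCol k fun i => (b i : ℝ)).det := by
      refine (RingHom.map_det (Int.castRingHom ℝ) _).trans (congrArg _ ?_)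
      ext i j
      simp only [RingHom.mapMatrix_apply, map_apply, updateCol_apply, Int.coe_castRingHom]
      split_ifs <;> rfl
    rw [h4, h2, h3]
    simp [mul_comm]

section OptimalValue

variable {n : ℕ} (win : Finset (Fin n) → Prop) {ν : Finset (Fin n) → ℝ}
  {L : ℕ → Submodule ℝ (Fin n → ℝ)} {eps : ℕ → ℝ} {l : ℕ}

theorem Row.le_lhs_of_lpP (hν : ∀ S, ν S = open Classical in if win S then 1 else 0)
    {x : Fin n → ℝ} (hx : lpP ν L eps (l + 1) x (eps (l + 1))) (r : Row n (l + 1))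
    (hr : r.Present L) :
    (r.rhs win : ℝ) ≤ r.lhs (Sum.elim x fun i => eps (i + 1)) := by
  obtain ⟨⟨h1, h2⟩, h3⟩ := (lpP_succ_iff ..).1 hx
  cases r with
  | coalition i S =>
    have h4 := h3 i (by omega) S hr
    have h5 : (if (i : ℕ) = l then eps (l + 1) else eps (i + 1)) = eps (i + 1) := by
      split_ifs with h
      · rw [h]
      · rfl
    rw [h5, hν] at h4
    rw [lhs_coalition]
    simp only [rhs, Sum.elim_inl, Sum.elim_inr]
    push_cast
    linarith
  | total =>
    rw [lhs_total]
    simp only [rhs, Sum.elim_inl]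
    rw [h1, hν]
    push_cast
    exact le_rfl
  | nonneg k =>
    rw [lhs_nonneg]
    simpa [rhs] using h2 k

/-- The constraints that are tight at an extreme point of the set of optimal solutions determine
this point together with the optimal values. -/
theorem exists_tight_det_ne_zero (hν : ∀ S, ν S = open Classical in if win S then 1 else 0)
    (hopt : ∀ i ≤ l, IsOptimalValue (lpP ν L eps (i + 1)) (eps (i + 1))) :
    ∃ (y : Fin n ⊕ Fin (l + 1) → ℝ) (f : Fin n ⊕ Fin (l + 1) → Row n (l + 1)),
      (∀ i, y (Sum.inr i) = eps (i + 1)) ∧ (∀ k, (f k).lhs y = (f k).rhs win) ∧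
      (Matrix.of fun k => (f k).coeff).det ≠ 0 := by
  obtain ⟨x₀, hx₀⟩ := (hopt l le_rfl).1
  obtain ⟨x, hx⟩ := (isCompact_lpP ν L eps l (eps (l + 1))).extremePoints_nonempty ⟨x₀, hx₀⟩
  rw [mem_extremePoints] at hx
  obtain ⟨hxF, hext⟩ := hx
  set y : Fin n ⊕ Fin (l + 1) → ℝ := Sum.elim x fun i => eps (i + 1) with hy
  have hle : ∀ r : Row n (l + 1), r.Present L → (r.rhs win : ℝ) ≤ r.lhs y :=
    Row.le_lhs_of_lpP win hν hxF
  have htot : (Row.total : Row n (l + 1)).lhs y = (Row.total : Row n (l + 1)).rhs win := by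
    rw [Row.lhs_total]
    simp only [hy, Sum.elim_inl, Row.rhs]
    rw [((lpP_succ_iff ..).1 hxF).1.1, hν]
    push_cast
    rfl
  let T := {r : Row n (l + 1) // r.Present L ∧ r.lhs y = r.rhs win}
  -- If the tight constraints did not span, some `d ≠ 0` would be orthogonal to all of them. It is
  -- shown that every such `d` vanishes.
  have hspan : Submodule.span ℝ (Set.range fun r : T => fun k => (r.1.coeff k : ℝ)) = ⊤ := by
    by_contra hne
    obtain ⟨φ, hφ, hker⟩ := Submodule.exists_le_ker_of_lt_top _ (lt_top_iff_ne_top.2 hne)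
    obtain ⟨d, rfl⟩ := (dotProductEquiv ℝ _).surjective φ
    apply hφ
    rw [map_eq_zero_iff _ (LinearEquiv.injective _)]
    have hd : ∀ r : Row n (l + 1), r.Present L → r.lhs y = r.rhs win → r.lhs d = 0 := by
      intro r h1 h2
      have := hker (Submodule.subset_span ⟨⟨r, h1, h2⟩, rfl⟩)
      rw [LinearMap.mem_ker, dotProductEquiv_apply_apply, dotProduct_comm] at this
      exact this
    obtain ⟨t, ht, hfeas⟩ : ∃ t : ℝ, 0 < t ∧ ∀ r : Row n (l + 1), r.Present L → ∀ c : ℝ, |c| ≤ t →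
        (r.rhs win : ℝ) ≤ r.lhs (y + c • d) := by
      have h1 : ∀ r : Row n (l + 1), ∃ t : ℝ, 0 < t ∧ (r.Present L → ∀ c : ℝ, |c| ≤ t →
          (r.rhs win : ℝ) ≤ r.lhs (y + c • d)) := by
        intro r
        by_cases hr : r.Present L
        · rcases (hle r hr).eq_or_lt with h2 | h2
          · refine ⟨1, one_pos, fun _ c _ => ?_⟩
            rw [Row.lhs_add_smul, hd r hr h2.symm, h2]
            simp
          -- A constraint with positive slack tolerates a step of slack over rate of change; the `+
          -- 1` avoids a zero denominator.
          · refine ⟨(r.lhs y - r.rhs win) / (|r.lhs d| + 1),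
              div_pos (by linarith) (by positivity), fun _ c hc => ?_⟩
            rw [le_div_iff₀ (by positivity)] at hc
            have h3 := neg_abs_le (c * r.lhs d)
            rw [abs_mul] at h3
            rw [Row.lhs_add_smul]
            nlinarith [abs_nonneg c]
        · exact ⟨1, one_pos, fun h => absurd h hr⟩
      choose t ht hfeas using h1
      have : Nonempty (Row n (l + 1)) := ⟨Row.total⟩
      obtain ⟨r₀, hr₀⟩ := Finite.exists_min t
      exact ⟨t r₀, ht r₀, fun r hr c hc => hfeas r hr c (hc.trans (hr₀ r))⟩
    -- Moving along `d` stays feasible for program `i + 1` only if the earlier levels, which are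
    -- constants there, do not move; its own level may.
    have hlp : ∀ (i : ℕ) (hi : i ≤ l), (∀ i' : Fin (l + 1), i'.1 < i → d (Sum.inr i') = 0) →
        ∀ c : ℝ, |c| ≤ t → lpP ν L eps (i + 1) (fun k => x k + c * d (Sum.inl k))
          (eps (i + 1) + c * d (Sum.inr ⟨i, by omega⟩)) := by
      intro i hi hzero c hc
      refine (lpP_succ_iff ..).2 ⟨⟨?_, fun k => ?_⟩, fun i' hi' S hS => ?_⟩
      · have h1 := hd Row.total trivial htot
        have h2 := Row.lhs_add_smul Row.total y d c
        rw [h1, htot, mul_zero, add_zero, Row.lhs_total] at h2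
        simp only [Pi.add_apply, Pi.smul_apply, smul_eq_mul, hy, Sum.elim_inl, Row.rhs] at h2
        rw [h2, hν]
        push_cast
        rfl
      · have h1 := hfeas (Row.nonneg k) trivial c hc
        rw [Row.lhs_nonneg] at h1
        simpa [Row.rhs, hy] using h1
      · have h1 := hfeas (Row.coalition ⟨i', by omega⟩ S) hS c hc
        rw [Row.lhs_coalition] at h1
        simp only [Pi.add_apply, Pi.smul_apply, smul_eq_mul, hy, Sum.elim_inl, Sum.elim_inr,
          Row.rhs] at h1
        push_cast at h1
        rw [hν]
        rcases hi'.eq_or_lt with rfl | hi'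
        · rw [if_pos rfl]
          linarith
        · rw [if_neg hi'.ne]
          rw [hzero ⟨i', by omega⟩ hi'] at h1
          linarith
    -- One of the two directions `t` and `-t` would raise the level above its optimum unless `d`
    -- vanishes at this level.
    have hinr : ∀ (i : ℕ) (hi : i < l + 1), d (Sum.inr ⟨i, hi⟩) = 0 := by
      intro i
      induction i using Nat.strong_induction_on with
      | _ i ih =>
        intro hi
        have h1 := hlp i (by omega) fun i' hi' => ih i' hi' i'.2
        have h2 := (hopt i (by omega)).2 ⟨_, h1 t (abs_of_pos ht).le⟩
        have h3 := (hopt i (by omega)).2 ⟨_, h1 (-t) (by rw [abs_neg, abs_of_pos ht])⟩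
        nlinarith
    have h1 := hlp l le_rfl fun i' _ => hinr i' i'.2
    rw [hinr l (by omega)] at h1
    have h2 := h1 t (abs_of_pos ht).le
    have h3 := h1 (-t) (by rw [abs_neg, abs_of_pos ht])
    rw [mul_zero, add_zero] at h2 h3
    -- All levels being fixed, `x` is the midpoint of two optimal solutions, so extremality kills
    -- the remaining coordinates of `d`.
    have h4 := (hext _ h2 _ h3 ⟨1 / 2, 1 / 2, by norm_num, by norm_num, by norm_num, by
      ext k
      simp only [Pi.add_apply, Pi.smul_apply, smul_eq_mul]
      ring⟩)
    ext k
    rcases k with k | k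
    · have h5 : x k + t * d (Sum.inl k) = x k := congrFun h4.1 k
      have h6 : t * d (Sum.inl k) = 0 := by linarith
      simpa [ht.ne'] using h6
    · exact hinr k k.2
  obtain ⟨f, hf⟩ := exists_det_ne_zero_of_span_eq_top _ hspan
  refine ⟨y, fun k => (f k).1, fun i => rfl, fun k => (f k).2.2, fun h0 => hf ?_⟩
  have h1 := RingHom.map_det (Int.castRingHom ℝ) (Matrix.of fun k => (f k).1.coeff)
  rw [h0, map_zero] at h1
  exact h1.symm

theorem exists_int_of_isOptimalValue (hν : ∀ S, ν S = open Classical in if win S then 1 else 0)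
    (hopt : ∀ i ≤ l, IsOptimalValue (lpP ν L eps (i + 1)) (eps (i + 1))) :
    ∃ a d : ℤ, d ≠ 0 ∧ |a| ≤ ((n + (l + 1)).factorial : ℤ) ∧
      |d| ≤ ((n + (l + 1)).factorial : ℤ) ∧ eps (l + 1) * d = a := by
  obtain ⟨y, f, h1, h2, h3⟩ := exists_tight_det_ne_zero win hν hopt
  have h4 := exists_int_of_mulVec_eq _ (fun k => (f k).rhs win)
    (fun i j => (f i).abs_coeff_le j) (fun i => (f i).abs_rhs_le win) h3 y
    (funext fun k => h2 k) (Sum.inr (Fin.last l))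
  rw [h1] at h4
  simpa using h4

end OptimalValue

/-- In lowest terms the numerator and the denominator divide those of any other representation; a
zero numerator is treated apart. -/
theorem natAbs_num_le_and_den_le {q : ℚ} {a d : ℤ} {N : ℕ} (hd : d ≠ 0) (ha : |a| ≤ N)
    (hdN : |d| ≤ N) (h : q * d = a) : q.num.natAbs ≤ N ∧ q.den ≤ N := by
  have h1 : q.num * d = a * q.den := by
    have h2 : (q.num : ℚ) / q.den * d = a := by rw [Rat.num_div_den, h]
    have h3 : (q.den : ℚ) ≠ 0 := by exact_mod_cast q.den_ne_zero
    field_simp at h2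
    have h4 : (q.num : ℚ) * d = a * q.den := by linarith
    exact_mod_cast h4
  have hcop : IsCoprime q.num (q.den : ℤ) := by
    rw [Int.isCoprime_iff_nat_coprime]
    exact q.reduced
  rw [Int.abs_eq_natAbs] at ha hdN
  constructor
  · rcases eq_or_ne a 0 with rfl | ha0
    · have h2 : q.num = 0 := by
        have h3 : q.num * d = 0 := by simpa using h1
        exact (mul_eq_zero.1 h3).resolve_right hd
      simp [h2]
    · have h2 : q.num ∣ a := hcop.dvd_of_dvd_mul_right (Dvd.intro _ h1)
      have h3 := Int.natAbs_le_of_dvd_ne_zero h2 ha0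
      omega
  · have h2 : (q.den : ℤ) ∣ d := hcop.symm.dvd_of_dvd_mul_left (Dvd.intro_left _ h1.symm)
    have h3 := Int.natAbs_le_of_dvd_ne_zero h2 hd
    simp only [Int.natAbs_natCast] at h3
    omega

namespace Instance.IsScheme

variable {I : Instance} {z : (l : ℕ) → Fin l → Finset (Fin I.n)}

/-- The system has `n + l` unknowns and `l < j ≤ n`, hence the bound $(2n)!$, whose logarithm is
polynomial in $n$. -/
theorem eps_le_factorial (h : I.IsScheme z) {l : ℕ} (hl : 1 ≤ l) (hlj : l < I.j) :
    (I.eps l).num.natAbs ≤ (2 * I.n).factorial ∧ (I.eps l).den ≤ (2 * I.n).factorial := by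
  obtain ⟨l, rfl⟩ : ∃ l', l = l' + 1 := ⟨l - 1, by omega⟩
  obtain ⟨a, d, hd, ha, hdN, heq⟩ := exists_int_of_isOptimalValue (l := l)
    (fun S : Finset (Fin I.n) => I.W ≤ ∑ i ∈ S, I.w i) (ν := utility I.w I.W) (L := spanL z)
    (eps := fun i => (I.eps i : ℝ)) (fun S => by unfold utility; congr)
    fun i hi => h.optimal (i + 1) (by omega) (by omega)
  have hle : ((I.n + (l + 1)).factorial : ℤ) ≤ ((2 * I.n).factorial : ℕ) := by
    have := h.j_le
    exact_mod_cast Nat.factorial_le (by omega)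
  exact natAbs_num_le_and_den_le hd (ha.trans hle) (hdN.trans hle) (by exact_mod_cast heq)

end Instance.IsScheme

end WVG

namespace WVG

/-! ### Dynamic programming over subsets of an initial segment -/

section DynamicProgramming

variable (Y : ℕ → ℤ) (step : ℕ → ℕ → ℕ) (base : ℕ → ℤ)

/-- Least cost of a run from a given state through the items `i - 1, …, 0`, where taking an item
changes the state and costs `Y`, and a run ending in state `a` costs another `base a`. -/
def dpVal : ℕ → ℕ → ℤ
  | 0, a => base a
  | i + 1, a => min (dpVal i a) (Y i + dpVal i (step i a))

/-- Final state of the run that takes the items of `S`. -/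
def dpRun (S : Finset ℕ) : ℕ → ℕ → ℕ
  | 0, a => a
  | i + 1, a => if i ∈ S then dpRun S i (step i a) else dpRun S i a

theorem dpVal_le (S : Finset ℕ) (i a : ℕ) :
    dpVal Y step base i a ≤
      (∑ k ∈ Finset.range i, if k ∈ S then Y k else 0) + base (dpRun step S i a) := by
  induction i generalizing a with
  | zero => simp [dpVal, dpRun]
  | succ i ih =>
    rw [Finset.sum_range_succ, dpVal, dpRun]
    split_ifs with h
    · have := ih (step i a)
      have := min_le_right (dpVal Y step base i a) (Y i + dpVal Y step base i (step i a))
      linarith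
    · have := ih a
      have := min_le_left (dpVal Y step base i a) (Y i + dpVal Y step base i (step i a))
      linarith

theorem dpRun_congr {S S' : Finset ℕ} {i : ℕ} (h : ∀ k < i, k ∈ S ↔ k ∈ S') (a : ℕ) :
    dpRun step S i a = dpRun step S' i a := by
  induction i generalizing a with
  | zero => rfl
  | succ i ih =>
    simp only [dpRun, h i (Nat.lt_succ_self i), ih fun k hk => h k (hk.trans (Nat.lt_succ_self i))]

/-- With `dpVal_le`, this identifies the recursion with the minimum over all subsets of the first
`i` items. -/
theorem exists_dpVal_eq (i a : ℕ) : ∃ S ⊆ Finset.range i, dpVal Y step base i a =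
    (∑ k ∈ Finset.range i, if k ∈ S then Y k else 0) + base (dpRun step S i a) := by
  induction i generalizing a with
  | zero => exact ⟨∅, by simp, by simp [dpVal, dpRun]⟩
  | succ i ih =>
    rw [dpVal]
    rcases min_choice (dpVal Y step base i a) (Y i + dpVal Y step base i (step i a)) with h | h
    · obtain ⟨S, hS, hv⟩ := ih a
      have hi : i ∉ S := fun hi => by simpa using hS hi
      refine ⟨S, hS.trans (Finset.range_subset_range.2 (Nat.le_succ i)), ?_⟩
      rw [h, Finset.sum_range_succ, dpRun, if_neg hi, if_neg hi, hv, add_zero]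
    · obtain ⟨S, hS, hv⟩ := ih (step i a)
      refine ⟨insert i S, ?_, ?_⟩
      · rw [Finset.range_add_one]
        exact Finset.insert_subset_insert _ hS
      · have hc : ∀ k < i, (k ∈ insert i S ↔ k ∈ S) := fun k hk => by simp [hk.ne]
        have hsum : (∑ k ∈ Finset.range i, if k ∈ insert i S then Y k else 0) =
            ∑ k ∈ Finset.range i, if k ∈ S then Y k else 0 :=
          Finset.sum_congr rfl fun k hk => if_congr (hc k (Finset.mem_range.1 hk)) rfl rfl
        rw [h, Finset.sum_range_succ, dpRun, if_pos (Finset.mem_insert_self i S),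
          if_pos (Finset.mem_insert_self i S), hv, dpRun_congr step hc, hsum]
        ring

/-- The effect on a pair (weight capped at `W`, residue modulo `p`) of taking an item. -/
def capStep (W p : ℕ) (w u : ℕ → ℕ) (i a : ℕ) : ℕ :=
  min (a / p + w i) W * p + (a % p + u i) % p

theorem capStep_lt {W p : ℕ} (hp : 0 < p) (w u : ℕ → ℕ) (i a : ℕ) :
    capStep W p w u i a < (W + 1) * p := by
  have h1 := Nat.mod_lt (a % p + u i) hp
  have h2 : min (a / p + w i) W * p ≤ W * p := Nat.mul_le_mul_right _ (min_le_right _ _)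
  rw [add_mul, one_mul, capStep]
  omega

/-- Capping after each item agrees with capping once at the end, and likewise for residues. The pair
is stored as quotient and remainder by `p`; the bound on `a` says that its weight part is already
capped. -/
theorem dpRun_capStep {W p : ℕ} (hp : 0 < p) (w u : ℕ → ℕ) (S : Finset ℕ) (i a : ℕ)
    (ha : a < (W + 1) * p) : dpRun (capStep W p w u) S i a =
      min (a / p + ∑ k ∈ Finset.range i, if k ∈ S then w k else 0) W * p +
        (a % p + ∑ k ∈ Finset.range i, if k ∈ S then u k else 0) % p := by
  induction i generalizing a with
  | zero =>
    have h1 : a / p ≤ W := Nat.lt_succ_iff.1 ((Nat.div_lt_iff_lt_mul hp).2 ha)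
    simp [dpRun, min_eq_left h1, Nat.div_add_mod']
  | succ i ih =>
    rw [dpRun, Finset.sum_range_succ, Finset.sum_range_succ]
    split_ifs with h
    · rw [ih _ (capStep_lt hp w u i a)]
      have h1 := Nat.mod_lt (a % p + u i) hp
      have h2 : capStep W p w u i a / p = min (a / p + w i) W := by
        rw [capStep, mul_comm, Nat.mul_add_div hp, Nat.div_eq_of_lt h1, add_zero]
      have h3 : capStep W p w u i a % p = (a % p + u i) % p := by
        rw [capStep, mul_comm, Nat.mul_add_mod, Nat.mod_mod]
      rw [h2, h3, Nat.mod_add_mod]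
      congr 1
      · congr 1
        omega
      · congr 1
        omega
    · rw [ih _ ha]
      simp

end DynamicProgramming

/-! ### The program -/

namespace Expr

instance : Add Expr := ⟨op .add⟩
instance : Sub Expr := ⟨op .sub⟩
instance : Mul Expr := ⟨op .mul⟩
instance : Div Expr := ⟨op .div⟩
instance : Mod Expr := ⟨op .mod⟩

/-- Cell `0` of an array. -/
def cell (a : ℕ) : Expr := get a (lit 0)

variable (s : Store) (e e' : Expr)

theorem eval_add : (e + e').eval s = e.eval s + e'.eval s := rfl
theorem eval_sub : (e - e').eval s = e.eval s - e'.eval s := rfl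
theorem eval_mul : (e * e').eval s = e.eval s * e'.eval s := rfl
theorem eval_div : (e / e').eval s = e.eval s / e'.eval s := rfl
theorem eval_mod : (e % e').eval s = e.eval s % e'.eval s := rfl
theorem eval_le : (op .le e e').eval s = if e.eval s ≤ e'.eval s then 1 else 0 := rfl
theorem eval_eq : (op .eq e e').eval s = if e.eval s = e'.eval s then 1 else 0 := rfl
theorem eval_lit (c : ℤ) : (lit c).eval s = c := rfl
theorem eval_get (a : ℕ) : (get a e).eval s = s a (e.eval s).toNat := rfl
theorem eval_cell (a : ℕ) : (cell a).eval s = s a 0 := rfl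

end Expr

namespace Separation

open WVG.Expr WVG.Cmd

/-- The number of players. -/
def nE : Expr := get 0 (lit 0)
/-- The threshold. -/
def wE : Expr := get 0 (lit 1)
/-- The index of the linear program. -/
def jE : Expr := get 0 (lit 2)
/-- The number of primes. -/
def mE : Expr := get 0 (lit 3)

/-! Arrays of the program: `8` scaled common denominator `D`, `9` powers of two, `10` answer, `11`
and `12` violated inequality, `13` total payoff times `D`, `14` weight, `15` table, `16`, `18`, `19`
counters, `17` counter of the pairs of a linear program and a vector, `27` coalition as bit mask,
`28` to `30` auxiliary values. -/

/-- Computes `D` and the powers of two. -/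
def scale : Cmd :=
  (assign 8 (lit 0) (lit 1)).seq <| (assign 9 (lit 0) (lit 1)).seq <|
  upTo 16 nE <| (assign 8 (lit 0) (cell 8 * (get 6 (cell 16) * lit 2))).seq
    (assign 9 (cell 16 + lit 1) (get 9 (cell 16) + get 9 (cell 16)))

/-- Computes the total payoff and the total weight. -/
def total : Cmd :=
  (assign 13 (lit 0) (lit 0)).seq <| (assign 14 (lit 0) (lit 0)).seq <|
  upTo 16 nE <| (assign 13 (lit 0)
      (cell 13 + get 5 (cell 16) * (cell 8 / get 6 (cell 16)))).seq
    (assign 14 (lit 0) (cell 14 + get 1 (cell 16)))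

/-- Checks whether the total payoff is right. -/
def checkTotal : Cmd :=
  (assign 29 (lit 0) (op .le wE (cell 14) * cell 8)).seq <|
  (assign 30 (lit 0) (lit 2 * op .le (cell 13) (cell 29) - lit 1)).seq <|
  (assign 10 (lit 0) (op .eq (cell 13) (cell 29))).seq <|
  when (lit 1 - cell 10) <|
    (assign 12 (lit 0) (lit 0)).seq <|
    (assign 12 (lit 1) (cell 30 * op .le wE (cell 14))).seq <|
    upTo 16 nE (assign 11 (cell 16) (cell 30))

/-- Checks whether payoffs are nonnegative. -/
def checkNonneg : Cmd :=
  upTo 16 nE <| when (op .le (get 5 (cell 16)) (lit (-1))) <|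
    (assign 10 (lit 0) (lit 0)).seq <|
    (assign 12 (lit 0) (lit 0)).seq <|
    (assign 12 (lit 1) (lit 0)).seq <|
    upTo 18 nE (assign 11 (cell 18) (op .eq (cell 18) (cell 16)))

/-- The index of the current linear program, minus one. -/
def lE : Expr := cell 17 / nE / mE
/-- The current prime. -/
def pE : Expr := get 2 (cell 17 / nE % mE)
/-- The number of states of the dynamic program. -/
def zE : Expr := (wE + lit 1) * pE
/-- Whether the current linear program is the last one. -/
def lastE : Expr := op .eq (lE + lit 1) jE
/-- Numerator of the current level. -/
def numE : Expr := lastE * get 0 (lit 4) + get 3 (lE + lit 1)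
/-- Denominator of the current level. -/
def denE : Expr := lastE * get 0 (lit 5) + get 4 (lE + lit 1)

/-- Initializes the table. -/
def tableBase : Cmd :=
  upTo 18 zE <| assign 15 (cell 18)
    ((lit 1 - op .eq (cell 18 % pE) (lit 0) * op .le (lit 1) lE) *
      (lit 0 - (op .le wE (cell 18 / pE) * denE + numE) * cell 8))

/-- The current item. -/
def iE : Expr := cell 19 / zE
/-- The current state. -/
def aE : Expr := cell 19 % zE
/-- Capped weight after taking the current item. -/
def capE : Expr :=
  op .le (aE / pE + get 1 iE) wE * (aE / pE + get 1 iE) +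
    op .le (wE + lit 1) (aE / pE + get 1 iE) * wE

/-- Fills the table. -/
def tableFill : Cmd :=
  upTo 19 (nE * zE) <|
    (assign 29 (lit 0) (get 15 (cell 19))).seq <|
    (assign 30 (lit 0) (denE * (get 5 iE * (cell 8 / get 6 iE)) + get 9 iE +
      get 15 (iE * zE + (capE * pE + (aE % pE + get 7 (cell 17 * nE + iE)) % pE)))).seq <|
    assign 15 (cell 19 + zE) (op .le (cell 29) (cell 30) * cell 29 +
      (lit 1 - op .le (cell 29) (cell 30)) * cell 30)

/-- Writes down the violated inequality of a coalition given by its bit mask. -/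
def report : Cmd :=
  (assign 27 (lit 0) (get 15 (nE * zE) % get 9 nE)).seq <|
  (assign 14 (lit 0) (lit 0)).seq <|
  (upTo 18 nE <| (assign 28 (lit 0) (cell 27 / get 9 (cell 18) % lit 2)).seq <|
    (assign 11 (cell 18) (denE * cell 28)).seq <|
    (assign 14 (lit 0) (cell 14 + get 1 (cell 18) * cell 28))).seq <|
  (assign 12 (lit 0) (lit 0 - lastE * denE)).seq <|
  (assign 12 (lit 1) (op .le wE (cell 14) * denE + get 3 (lE + lit 1))).seq <|
  assign 10 (lit 0) (lit 0)

/-- Looks for a violated inequality in one linear program among the coalitions whose characteristic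
vector is not orthogonal to one vector. -/
def search : Cmd :=
  tableBase.seq <| tableFill.seq <| when (op .le (get 15 (nE * zE)) (lit (-1))) report

/-- Computes the answer. -/
def solve : Cmd :=
  scale.seq <| total.seq <| checkTotal.seq <| checkNonneg.seq <|
    when (cell 10) <| upTo 17 (jE * mE * nE) search

/-- Moves the violated inequality to its destination. -/
def outputInequality : Cmd :=
  (upTo 16 nE (assign 1 (cell 16) (get 11 (cell 16)))).seq <|
  (assign 2 (lit 0) (cell 12)).seq <| assign 2 (lit 1) (get 12 (lit 1))

/-- Moves the answer to its destination. -/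
def outputAnswer : Cmd := assign 0 (lit 0) (cell 10)

/-- The program is split into three phases since the outputs overwrite input arrays: the main phase
reads arrays `0` to `7`, the second still needs the number of players in array `0`, and the answer
replaces that number only at the very end. -/
theorem wf_solve : solve.wf (fun a => decide (a < 8)) = true := by decide

theorem wf_outputInequality : outputInequality.wf (fun a => decide (a < 1)) = true := by decide

theorem wf_outputAnswer : outputAnswer.wf (fun _ => false) = true := by decide

end Separation

end WVG

/-! ### Correctness of the preliminary checks. -/

namespace WVG

theorem Cmd.den_assign (a : ℕ) (i e : Expr) (s : Store) :
    (assign a i e).den s = s.write a (i.eval s).toNat (e.eval s) := rfl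

theorem Cmd.den_seq (c d : Cmd) (s : Store) : (c.seq d).den s = d.den (c.den s) := rfl

theorem Cmd.den_when (e : Expr) (c : Cmd) (s : Store) :
    (when e c).den s = if e.eval s = 0 then s else c.den s := rfl

/-- Hoare rule for loops. The frame condition, that arrays not written by the loop are unchanged, is
supplied to the step and need not be part of the invariant. -/
theorem Cmd.den_upTo_induction {v : ℕ} {b : Expr} {c : Cmd} {s : Store} {N : ℕ}
    (hN : b.eval s = N) (P : ℕ → Store → Prop) (h₀ : P 0 (s.write v 0 0))
    (hstep : ∀ i < N, ∀ s' : Store, s' v 0 = (i : ℕ) →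
      (∀ a, a ∉ v :: c.writes → s' a = s a) → P i s' →
      P (i + 1) ((c.den s').write v 0 (i + 1 : ℕ))) :
    P N ((Cmd.upTo v b c).den s) := by
  rw [Cmd.den, hN, Int.toNat_natCast]
  refine (Cmd.iter_induction (N := N)
    (fun i s' => (∀ a, a ∉ v :: c.writes → s' a = s a) ∧ P i s') ⟨?_, h₀⟩ ?_).2
  · intro a ha
    simp only [List.mem_cons, not_or] at ha
    exact Store.write_of_ne ha.1
  · intro i hi s' hv ⟨h1, h2⟩
    refine ⟨fun a ha => ?_, hstep i hi s' hv h1 h2⟩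
    rw [← h1 a ha]
    simp only [List.mem_cons, not_or] at ha
    rw [Store.write_of_ne ha.1, Cmd.den_of_notMem ha.2]

namespace Instance

variable (I : Instance)

/-- The input arrays of a memory hold the input. -/
def Agree (s : Store) : Prop := ∀ a < 8, s a = I.input a

variable {I}

theorem Agree.den {s : Store} (h : I.Agree s) {c : Cmd}
    (hc : ∀ a < 8, a ∉ c.writes) : I.Agree (c.den s) :=
  fun a ha => (Cmd.den_of_notMem (hc a ha)).trans (h a ha)

theorem Agree.of_forall {s s' : Store} (h : I.Agree s) {l : List ℕ} (hl : ∀ a < 8, a ∉ l)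
    (hs : ∀ a, a ∉ l → s' a = s a) : I.Agree s' :=
  fun a ha => (hs a (hl a ha)).trans (h a ha)

variable (I)

/-- The common denominator used by the program. -/
def scaled : ℤ := ∏ k ∈ Finset.range I.n, (I.input 6 k * 2)

/-- The total payoff, scaled. -/
def scaledTotal : ℤ := ∑ k ∈ Finset.range I.n, I.input 5 k * (I.scaled / I.input 6 k)

/-- The total weight. -/
def totalWeight : ℤ := ∑ k ∈ Finset.range I.n, I.input 1 k

end Instance

namespace Separation

open WVG.Expr WVG.Cmd

variable {I : Instance} {s : Store}

theorem eval_nE (h : I.Agree s) : nE.eval s = (I.n : ℕ) := by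
  rw [nE, eval_get, h 0 (by norm_num)]; rfl

theorem eval_wE (h : I.Agree s) : wE.eval s = (I.W : ℕ) := by
  rw [wE, eval_get, h 0 (by norm_num)]; rfl

theorem eval_jE (h : I.Agree s) : jE.eval s = (I.j : ℕ) := by
  rw [jE, eval_get, h 0 (by norm_num)]; rfl

theorem eval_mE (h : I.Agree s) : mE.eval s = (I.m : ℕ) := by
  rw [mE, eval_get, h 0 (by norm_num)]; rfl

theorem den_scale (h : I.Agree s) :
    scale.den s 8 0 = I.scaled ∧ ∀ k ≤ I.n, scale.den s 9 k = 2 ^ k := by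
  simp only [scale, den_seq, den_assign, eval_lit, Int.toNat_zero]
  set s₁ := (s.write 8 0 1).write 9 0 1 with hs₁
  have h₁ : I.Agree s₁ := fun a ha => by
    rw [hs₁, Store.write_of_ne (by omega), Store.write_of_ne (by omega), h a ha]
  refine den_upTo_induction (eval_nE h₁) (fun i s' =>
    s' 8 0 = ∏ k ∈ Finset.range i, (I.input 6 k * 2) ∧ ∀ k ≤ i, s' 9 k = 2 ^ k) ?_ ?_
  · simp [hs₁, Store.write_of_ne, Store.write_same]
  · rintro i hi s' hv hs' ⟨h8, h9⟩
    have h' : I.Agree s' := h₁.of_forall (by decide) hs'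
    simp only [den_seq, den_assign, eval_lit, Int.toNat_zero, eval_mul, eval_add, eval_get, eval_cell, hv]
    constructor
    · simp [Store.write_of_ne, Store.write_same, h8, hv, h' 6, Finset.prod_range_succ]
    · intro k hk
      have h0 : ((i : ℤ) + 1).toNat = i + 1 := by omega
      simp only [Store.write_of_ne, Store.write_same, ne_eq, Nat.reduceEqDiff, not_false_eq_true, hv, Int.toNat_natCast, h0, h9 i le_rfl]
      split_ifs with hk'
      · rw [hk']; ring
      · exact h9 k (by omega)

theorem den_total (h : I.Agree s) (h8 : s 8 0 = I.scaled) :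
    total.den s 13 0 = I.scaledTotal ∧ total.den s 14 0 = I.totalWeight := by
  simp only [total, den_seq, den_assign, eval_lit, Int.toNat_zero]
  set s₁ := (s.write 13 0 0).write 14 0 0 with hs₁
  have h₁ : I.Agree s₁ := fun a ha => by
    rw [hs₁, Store.write_of_ne (by omega), Store.write_of_ne (by omega), h a ha]
  have h8₁ : s₁ 8 0 = I.scaled := by
    rw [hs₁, Store.write_of_ne (by omega), Store.write_of_ne (by omega), h8]
  refine den_upTo_induction (eval_nE h₁) (fun i s' =>
    s' 13 0 = ∑ k ∈ Finset.range i, I.input 5 k * (I.scaled / I.input 6 k) ∧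
    s' 14 0 = ∑ k ∈ Finset.range i, I.input 1 k) ?_ ?_
  · simp [hs₁, Store.write_of_ne, Store.write_same]
  · rintro i hi s' hv hs' ⟨h13, h14⟩
    have h' : I.Agree s' := h₁.of_forall (by decide) hs'
    have h8' : s' 8 0 = I.scaled := by rw [hs' 8 (by decide), h8₁]
    simp [den_seq, den_assign, eval_lit, eval_mul, eval_add, eval_div, eval_get, eval_cell,
      Store.write_of_ne, Store.write_same, h13, h14, hv, h8', h' 5, h' 6, h' 1,
      Finset.sum_range_succ]

/-- The answer is still positive and `P` holds, or a violated inequality has been found; its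
coefficients satisfy `V`. -/
def State (P : Prop) (V : (ℕ → ℤ) → ℤ → ℤ → Prop) (n : ℕ) (s : Store) : Prop :=
  (s 10 0 = 1 ∧ P) ∨ (s 10 0 = 0 ∧ ∃ a : ℕ → ℤ, (∀ k < n, s 11 k = a k) ∧ V a (s 12 0) (s 12 1))

theorem den_upTo_fill {v a : ℕ} {e : Expr} {f : ℕ → ℤ} (hva : v ≠ a) {N : ℕ} (hN : nE.eval s = N)
    (he : ∀ i < N, ∀ s' : Store, s' v 0 = (i : ℕ) → (∀ b, b ∉ [v, a] → s' b = s b) →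
      e.eval s' = f i) :
    ∀ k < N, (upTo v nE (assign a (cell v) e)).den s a k = f k := by
  refine den_upTo_induction hN (fun i s' => ∀ k < i, s' a k = f k) (by simp) ?_
  intro i hi s' hv hs' hP k hk
  rw [Store.write_of_ne hva.symm, den_assign, eval_cell, hv, Store.write_same, Int.toNat_natCast,
    he i hi s' hv hs']
  split_ifs with h
  · rw [h]
  · exact hP k (by omega)

/-- A violated equation is violated in one direction, and the sign `g` selects it: `1` if the total
is too small and `-1` if it is too large. The predicate `V` is arbitrary, so that the analysis of
the program does not involve the linear programs. -/
theorem den_checkTotal (h : I.Agree s) (h8 : s 8 0 = I.scaled) (h13 : s 13 0 = I.scaledTotal)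
    (h14 : s 14 0 = I.totalWeight) {V : (ℕ → ℤ) → ℤ → ℤ → Prop}
    (hV : ∀ ν : ℤ, ν = (if (I.W : ℤ) ≤ I.totalWeight then 1 else 0) →
      I.scaledTotal ≠ ν * I.scaled →
      V (fun _ => 2 * (if I.scaledTotal ≤ ν * I.scaled then 1 else 0) - 1) 0
        ((2 * (if I.scaledTotal ≤ ν * I.scaled then 1 else 0) - 1) * ν)) :
    State (I.scaledTotal = (if (I.W : ℤ) ≤ I.totalWeight then 1 else 0) * I.scaled) V I.n
      (checkTotal.den s) := by
  set ν : ℤ := if (I.W : ℤ) ≤ I.totalWeight then 1 else 0 with hν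
  set g : ℤ := 2 * (if I.scaledTotal ≤ ν * I.scaled then 1 else 0) - 1 with hg
  have hV' := hV ν hν
  simp only [checkTotal, den_seq, den_assign, den_when, eval_lit, Int.toNat_zero]
  set s₁ := s.write 29 0 _ with hs₁
  have e1 : s₁ = s.write 29 0 (ν * I.scaled) := by
    rw [hs₁]
    simp only [eval_mul, eval_le, eval_wE h, eval_cell, h8, h14, hν]
  set s₂ := s₁.write 30 0 _ with hs₂
  have e2 : s₂ = s₁.write 30 0 g := by
    rw [hs₂, hg]
    simp only [eval_mul, eval_sub, eval_le, eval_cell, eval_lit, e1, Store.write_same,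
      Store.write_of_ne, ne_eq, Nat.reduceEqDiff, not_false_eq_true, h13,
      if_true]
  set s₃ := s₂.write 10 0 _ with hs₃
  have e3 : s₃ = s₂.write 10 0 (if I.scaledTotal = ν * I.scaled then 1 else 0) := by
    rw [hs₃]
    simp only [eval_eq, eval_cell, e2, e1, Store.write_same,
      Store.write_of_ne, ne_eq, Nat.reduceEqDiff, not_false_eq_true, h13,
      if_true]
  have h₃ : I.Agree s₃ := fun a ha => by
    rw [e3, e2, e1, Store.write_of_ne (by omega), Store.write_of_ne (by omega),
      Store.write_of_ne (by omega), h a ha]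
  have h10 : s₃ 10 0 = if I.scaledTotal = ν * I.scaled then 1 else 0 := by
    rw [e3, Store.write_same, if_pos rfl]
  have h30 : s₃ 30 0 = g := by
    rw [e3, Store.write_of_ne (by omega), e2, Store.write_same, if_pos rfl]
  have h14' : s₃ 14 0 = I.totalWeight := by
    rw [e3, e2, e1, Store.write_of_ne (by omega), Store.write_of_ne (by omega),
      Store.write_of_ne (by omega), h14]
  rw [eval_sub, eval_cell, eval_lit, h10]
  by_cases heq : I.scaledTotal = ν * I.scaled
  · rw [if_pos heq] at h10 ⊢
    rw [if_pos (by norm_num)]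
    exact Or.inl ⟨h10, heq⟩
  · rw [if_neg heq] at h10 ⊢
    rw [if_neg (by norm_num)]
    set s₄ := s₃.write 12 0 0 with hs₄
    set s₅ := s₄.write 12 _ _ with hs₅
    have e5 : s₅ = s₄.write 12 1 (g * ν) := by
      rw [hs₅]
      have h₄ : I.Agree s₄ := fun a ha => by rw [hs₄, Store.write_of_ne (by omega), h₃ a ha]
      simp only [eval_mul, eval_le, eval_cell, eval_wE h₄]
      rw [hs₄, Store.write_of_ne (by omega), Store.write_of_ne (by omega), h30, h14']
      rfl
    have h₅ : I.Agree s₅ := fun a ha => by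
      rw [e5, hs₄, Store.write_of_ne (by omega), Store.write_of_ne (by omega), h₃ a ha]
    have hw : ∀ a, a ∉ [16, 11] → (upTo 16 nE (assign 11 (cell 16) (cell 30))).den s₅ a = s₅ a :=
      fun a ha => den_of_notMem ha
    refine Or.inr ⟨?_, fun _ => g, ?_, ?_⟩
    · rw [hw 10 (by decide), e5, hs₄, Store.write_of_ne (by omega), Store.write_of_ne (by omega),
        h10]
    · refine den_upTo_fill (by norm_num) (eval_nE h₅) fun i _ s' _ hs' => ?_
      rw [eval_cell, hs' 30 (by decide), e5, hs₄, Store.write_of_ne (by omega),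
        Store.write_of_ne (by omega), h30]
    · have h0 : s₅ 12 0 = 0 := by rw [e5, hs₄]; simp [Store.write_same]
      have h1 : s₅ 12 1 = g * ν := by rw [e5]; simp [Store.write_same]
      rw [hw 12 (by decide), h0, h1]
      exact hV' heq

theorem den_checkNonneg (h : I.Agree s) {P : Prop} {V : (ℕ → ℤ) → ℤ → ℤ → Prop}
    (hs : State P V I.n s)
    (hV : ∀ k < I.n, I.input 5 k < 0 → V (fun i => if i = k then 1 else 0) 0 0) :
    State (P ∧ ∀ k < I.n, 0 ≤ I.input 5 k) V I.n (checkNonneg.den s) := by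
  refine den_upTo_induction (eval_nE h)
    (fun i => State (P ∧ ∀ k < i, 0 ≤ I.input 5 k) V I.n) ?_ ?_
  · simpa [State, Store.write_of_ne] using hs
  · intro i hi s' hv hs' hP
    have h' : I.Agree s' := h.of_forall (by decide) hs'
    have hiff : ∀ s'' : Store, State (P ∧ ∀ k < i + 1, 0 ≤ I.input 5 k) V I.n s'' →
        State (P ∧ ∀ k < i + 1, 0 ≤ I.input 5 k) V I.n (s''.write 16 0 (i + 1 : ℕ)) := by
      intro s'' hs''
      simpa [State, Store.write_of_ne] using hs''
    refine hiff _ ?_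
    have he : (get 5 (cell 16)).eval s' = I.input 5 i := by
      rw [eval_get, eval_cell, hv, Int.toNat_natCast, h' 5 (by norm_num)]
    rw [den_when, eval_le, he, eval_lit]
    -- For an integer numerator, being negative means being at most `-1`.
    by_cases hneg : I.input 5 i ≤ -1
    · rw [if_pos hneg, if_neg (by norm_num)]
      simp only [den_seq, den_assign, eval_lit, Int.toNat_zero]
      set s₄ := ((s'.write 10 0 0).write 12 0 0).write 12 _ 0 with hs₄
      have hw : ∀ a, a ∉ [18, 11] →
          (upTo 18 nE (assign 11 (cell 18) (op .eq (cell 18) (cell 16)))).den s₄ a = s₄ a :=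
        fun a ha => den_of_notMem ha
      have h₄ : I.Agree s₄ := fun a ha => by
        rw [hs₄, Store.write_of_ne (by omega), Store.write_of_ne (by omega),
          Store.write_of_ne (by omega), h' a ha]
      refine Or.inr ⟨?_, fun k => if k = i then 1 else 0, ?_, ?_⟩
      · rw [hw 10 (by decide), hs₄]
        simp [Store.write_of_ne, Store.write_same]
      · refine den_upTo_fill (by norm_num) (eval_nE h₄) fun k _ s'' hv' hs'' => ?_
        have h16 : s'' 16 0 = i := by
          rw [hs'' 16 (by decide), hs₄, Store.write_of_ne (by omega), Store.write_of_ne (by omega),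
            Store.write_of_ne (by omega), hv]
        rw [eval_eq, eval_cell, eval_cell, hv', h16]
        simp
      · rw [hw 12 (by decide), hs₄]
        simpa [Store.write_same] using hV i hi (by omega)
    · rw [if_neg hneg, if_pos rfl]
      rcases hP with ⟨h1, h2, h3⟩ | h1
      · refine Or.inl ⟨h1, h2, fun k hk => ?_⟩
        rcases (Nat.lt_succ_iff.1 hk).eq_or_lt with rfl | hk
        · omega
        · exact h3 k hk
      · exact Or.inr h1

end Separation

end WVG

/-! ### Correctness of the table and of the reported inequality. -/

namespace WVG

namespace Instance

variable (I : Instance)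

/-- The index, minus one, of the linear program that belongs to a cell block of array `7`. -/
def lp (y : ℕ) : ℕ := y / I.n / I.m

/-- The prime that belongs to a cell block of array `7`. -/
def prm (y : ℕ) : ℕ := (I.input 2 (y / I.n % I.m)).toNat

/-- The entries of a cell block of array `7`. -/
def vec (y k : ℕ) : ℕ := (I.input 7 (y * I.n + k)).toNat

/-- The weights. -/
def wt (k : ℕ) : ℕ := (I.input 1 k).toNat

/-- Numerator of the level of a linear program. -/
def lvlNum (y : ℕ) : ℤ :=
  (if I.lp y + 1 = I.j then 1 else 0) * I.input 0 4 + I.input 3 (I.lp y + 1)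

/-- Denominator of the level of a linear program. -/
def lvlDen (y : ℕ) : ℤ :=
  (if I.lp y + 1 = I.j then 1 else 0) * I.input 0 5 + I.input 4 (I.lp y + 1)

/-- Number of states of the dynamic program. -/
def states (y : ℕ) : ℕ := (I.W + 1) * I.prm y

/-- Cost of a player in the dynamic program. -/
def itemCost (y k : ℕ) : ℤ :=
  I.lvlDen y * (I.input 5 k * (I.scaled / I.input 6 k)) + 2 ^ k

/-- Cost of a final state in the dynamic program. -/
def stateCost (y a : ℕ) : ℤ :=
  (1 - (if a % I.prm y = 0 then 1 else 0) * if 1 ≤ I.lp y then 1 else 0) *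
    (0 - ((if I.W ≤ a / I.prm y then 1 else 0) * I.lvlDen y + I.lvlNum y) * I.scaled)

/-- Value function of the dynamic program. -/
def value (y : ℕ) : ℕ → ℕ → ℤ :=
  dpVal (I.itemCost y) (capStep I.W (I.prm y) I.wt (I.vec y)) (I.stateCost y)

variable {I}

theorem input_one_eq (k : ℕ) : I.input 1 k = I.wt k := by
  refine (Int.toNat_of_nonneg ?_).symm
  simp only [input]
  split_ifs <;> positivity

theorem input_two_eq (y : ℕ) : I.input 2 (y / I.n % I.m) = I.prm y := by
  refine (Int.toNat_of_nonneg ?_).symm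
  simp only [input]
  split_ifs <;> positivity

theorem input_seven_eq (y k : ℕ) : I.input 7 (y * I.n + k) = I.vec y k := by
  refine (Int.toNat_of_nonneg ?_).symm
  simp only [input]
  split_ifs <;> positivity

end Instance

theorem sum_two_pow_lt (S : Finset ℕ) (n : ℕ) :
    (∑ k ∈ Finset.range n, if k ∈ S then 2 ^ k else 0) < 2 ^ n := by
  induction n with
  | zero => simp
  | succ n ih =>
    rw [Finset.sum_range_succ, pow_succ]
    split_ifs <;> omega

/-- Terms above `i` contribute even multiples of $2^i$ and those below sum to less than $2^i$. -/
theorem sum_two_pow_div_mod (S : Finset ℕ) {n i : ℕ} (hi : i < n) :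
    (∑ k ∈ Finset.range n, if k ∈ S then 2 ^ k else 0) / 2 ^ i % 2 = if i ∈ S then 1 else 0 := by
  induction n with
  | zero => omega
  | succ n ih =>
    rw [Finset.sum_range_succ]
    rcases (Nat.lt_succ_iff.1 hi).eq_or_lt with rfl | hi
    · have h := sum_two_pow_lt S i
      split_ifs with h1
      · rw [Nat.add_div_right _ (by positivity), Nat.div_eq_of_lt h]
      · rw [add_zero, Nat.div_eq_of_lt h]
    · rw [← ih hi]
      obtain ⟨d, rfl⟩ : ∃ d, n = i + (d + 1) := ⟨n - i - 1, by omega⟩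
      have h : (if i + (d + 1) ∈ S then 2 ^ (i + (d + 1)) else 0) =
          2 ^ i * (2 * if i + (d + 1) ∈ S then 2 ^ d else 0) := by
        split_ifs
        · rw [pow_add, pow_succ]; ring
        · simp
      rw [h, Nat.add_mul_div_left _ _ (by positivity), Nat.add_mul_mod_self_left]

namespace Separation

open WVG.Expr WVG.Cmd Instance

variable {I : Instance}

/-- The memory is ready for the search in a cell block of array `7`. -/
structure Ready (I : Instance) (y : ℕ) (s : Store) : Prop where
  agree : I.Agree s
  scaled : s 8 0 = I.scaled
  pow : ∀ k ≤ I.n, s 9 k = 2 ^ k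
  block : s 17 0 = y

variable {y : ℕ} {s : Store}

theorem Ready.of_forall {s' : Store} (h : Ready I y s) {l : List ℕ}
    (hl : ∀ a < 8, a ∉ l) (hl' : ∀ a ∈ [8, 9, 17], a ∉ l) (hs : ∀ a, a ∉ l → s' a = s a) :
    Ready I y s' where
  agree := h.agree.of_forall hl hs
  scaled := by rw [hs 8 (hl' 8 (by simp)), h.scaled]
  pow := by rw [hs 9 (hl' 9 (by simp))]; exact h.pow
  block := by rw [hs 17 (hl' 17 (by simp)), h.block]

theorem Ready.write {a i : ℕ} {x : ℤ} (h : Ready I y s) (ha : a ∉ [8, 9, 17]) (ha' : 8 ≤ a) :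
    Ready I y (s.write a i x) := by
  simp only [List.mem_cons, List.not_mem_nil, or_false, not_or] at ha
  refine h.of_forall (l := [a]) (fun b hb => by simp; omega) (fun b hb => ?_)
    fun b hb => Store.write_of_ne (by simpa using hb)
  simp only [List.mem_cons, List.not_mem_nil, or_false] at hb ⊢
  omega

theorem Ready.eval_lE (h : Ready I y s) : lE.eval s = (I.lp y : ℕ) := by
  rw [lE, eval_div, eval_div, eval_cell, h.block, eval_nE h.agree, eval_mE h.agree, Instance.lp]
  push_cast
  rfl

theorem Ready.eval_pE (h : Ready I y s) : pE.eval s = (I.prm y : ℕ) := by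
  rw [pE, eval_get, eval_mod, eval_div, eval_cell, h.block, eval_nE h.agree, eval_mE h.agree,
    ← input_two_eq, h.agree 2 (by norm_num)]
  rfl

theorem Ready.eval_zE (h : Ready I y s) : zE.eval s = (I.states y : ℕ) := by
  rw [zE, eval_mul, eval_add, eval_wE h.agree, h.eval_pE, eval_lit, states]
  push_cast
  rfl

theorem Ready.eval_lastE (h : Ready I y s) :
    lastE.eval s = if I.lp y + 1 = I.j then 1 else 0 := by
  rw [lastE, eval_eq, eval_add, h.eval_lE, eval_lit, eval_jE h.agree]
  refine if_congr ?_ rfl rfl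
  norm_cast

theorem Ready.eval_get_succ (h : Ready I y s) {a : ℕ} (ha : a < 8) :
    (get a (lE + lit 1)).eval s = I.input a (I.lp y + 1) := by
  rw [eval_get, eval_add, h.eval_lE, eval_lit, h.agree a ha]
  rfl

theorem Ready.eval_numE (h : Ready I y s) : numE.eval s = I.lvlNum y := by
  rw [numE, eval_add, eval_mul, h.eval_lastE, h.eval_get_succ (by norm_num), eval_get,
    h.agree 0 (by norm_num)]
  rfl

theorem Ready.eval_denE (h : Ready I y s) : denE.eval s = I.lvlDen y := by
  rw [denE, eval_add, eval_mul, h.eval_lastE, h.eval_get_succ (by norm_num), eval_get,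
    h.agree 0 (by norm_num)]
  rfl

theorem den_tableBase (h : Ready I y s) :
    ∀ a < I.states y, tableBase.den s 15 a = I.stateCost y a := by
  refine den_upTo_induction h.eval_zE (fun i s' => ∀ a < i, s' 15 a = I.stateCost y a) (by simp) ?_
  intro i hi s' hv hs' hP a ha
  have h' : Ready I y s' := h.of_forall (by decide) (by decide) hs'
  rw [Store.write_of_ne (by norm_num), den_assign, Store.write_same, eval_cell, hv,
    Int.toNat_natCast]
  split_ifs with hai
  · subst hai
    simp only [eval_mul, eval_sub, eval_add, eval_eq, eval_le, eval_mod, eval_div, eval_lit,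
      eval_cell, hv, h'.eval_pE, h'.eval_lE, eval_wE h'.agree, h'.eval_denE, h'.eval_numE,
      h'.scaled, stateCost]
    norm_cast
  · exact hP a (by omega)

/-- The minimum is spelled out with two complementary comparisons, as the machine has no such
operation. -/
theorem Ready.eval_capE {i : ℕ} (h : Ready I y s) (h19 : s 19 0 = i) :
    capE.eval s = (min (i % I.states y / I.prm y + I.wt (i / I.states y)) I.W : ℕ) := by
  have he : (aE / pE + get 1 iE).eval s =
      (i % I.states y / I.prm y + I.wt (i / I.states y) : ℕ) := by
    rw [eval_add, eval_div, aE, eval_mod, h.eval_pE, h.eval_zE, eval_cell, h19, iE, eval_get,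
      eval_div, h.eval_zE, eval_cell, h19, h.agree 1 (by norm_num), ← Int.natCast_div,
      Int.toNat_natCast, input_one_eq]
    push_cast
    rfl
  simp only [capE, eval_add _ (op BinOp.le _ _ * _), eval_mul, eval_le, he, eval_wE h.agree]
  rw [eval_add, eval_wE h.agree, eval_lit]
  generalize i % I.states y / I.prm y + I.wt (i / I.states y) = c
  split_ifs <;> push_cast <;> omega

/-- Cell `i * Z + a` holds the value of state `a` with `i` items left. A single loop over the linear
index `f` writes cell `f + Z`, and the two cells it reads lie in row `f / Z`, which is already
complete. -/
theorem den_tableFill (h : Ready I y s) (hp : 0 < I.prm y)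
    (h15 : ∀ a < I.states y, s 15 a = I.stateCost y a) :
    ∀ f < I.n * I.states y + I.states y,
      tableFill.den s 15 f = I.value y (f / I.states y) (f % I.states y) := by
  set Z := I.states y with hZ
  have hZ0 : 0 < Z := Nat.mul_pos (Nat.succ_pos _) hp
  have hN : (nE * zE).eval s = (I.n * Z : ℕ) := by
    rw [eval_mul, eval_nE h.agree, h.eval_zE]
    push_cast
    rfl
  refine den_upTo_induction hN
    (fun i s' => ∀ f < i + Z, s' 15 f = I.value y (f / Z) (f % Z)) ?_ ?_
  · intro f hf
    rw [zero_add] at hf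
    rw [Store.write_of_ne (by norm_num), h15 f hf, Nat.div_eq_of_lt hf, Nat.mod_eq_of_lt hf]
    rfl
  · intro f hf s' hv hs' hP f' hf'
    have h' : Ready I y s' := h.of_forall (by decide) (by decide) hs'
    have hi : f / Z < I.n := (Nat.div_lt_iff_lt_mul hZ0).2 hf
    set i := f / Z with hi_def
    set a := f % Z with ha_def
    have haZ : a < Z := Nat.mod_lt _ hZ0
    have hfi : i * Z + a = f := Nat.div_add_mod' f Z
    set b := capStep I.W (I.prm y) I.wt (I.vec y) i a with hb
    have hbZ : b < Z := capStep_lt hp _ _ _ _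
    rw [Store.write_of_ne (by norm_num)]
    simp only [den_seq, den_assign, eval_lit, Int.toNat_zero]
    set s₁ := s'.write 29 0 _ with hs₁
    have e1 : s₁ = s'.write 29 0 (I.value y i a) := by
      rw [hs₁, eval_get, eval_cell, hv, Int.toNat_natCast, hP f (by omega)]
    have h₁ : Ready I y s₁ := h'.write (by decide) (by norm_num)
    set s₂ := s₁.write 30 0 _ with hs₂
    have h19 : s₁ 19 0 = f := by rw [e1, Store.write_of_ne (by norm_num), hv]
    have hiE : iE.eval s₁ = (i : ℕ) := by
      rw [iE, eval_div, eval_cell, h19, h₁.eval_zE]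
      rfl
    have haE : aE.eval s₁ = (a : ℕ) := by
      rw [aE, eval_mod, eval_cell, h19, h₁.eval_zE]
      rfl
    have hvec : (get 7 (cell 17 * nE + iE)).eval s₁ = (I.vec y i : ℕ) := by
      rw [← input_seven_eq, eval_get, eval_add, eval_mul, eval_cell, h₁.block, eval_nE h₁.agree,
        hiE, h₁.agree 7 (by norm_num)]
      norm_cast
    have hidx : (iE * zE + (capE * pE + (aE % pE + get 7 (cell 17 * nE + iE)) % pE)).eval s₁ =
        (i * Z + b : ℕ) := by
      simp only [eval_add _ (iE * zE), eval_add _ (capE * pE), eval_add _ (aE % pE), eval_mul, eval_mod,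
        hiE, haE, hvec, h₁.eval_zE, h₁.eval_capE h19, h₁.eval_pE, hb, capStep]
      push_cast
      rfl
    have e2 : s₂ = s₁.write 30 0 (I.itemCost y i + I.value y i b) := by
      rw [hs₂, eval_add, eval_add, eval_get _ _ 15, hidx, Int.toNat_natCast, eval_mul, eval_mul,
        eval_div, eval_get, eval_get, eval_get, hiE, Int.toNat_natCast, eval_cell, h₁.scaled,
        h₁.eval_denE, h₁.pow i hi.le, h₁.agree 5 (by norm_num), h₁.agree 6 (by norm_num), e1,
        Store.write_of_ne (by norm_num), hP (i * Z + b) (by omega)]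
      have h1 : (i * Z + b) / Z = i := by
        rw [mul_comm, Nat.mul_add_div hZ0, Nat.div_eq_of_lt hbZ, add_zero]
      have h2 : (i * Z + b) % Z = b := by
        rw [mul_comm, Nat.mul_add_mod, Nat.mod_eq_of_lt hbZ]
      rw [h1, h2]
      rfl
    have h₂ : Ready I y s₂ := h₁.write (by decide) (by norm_num)
    have h19' : s₂ 19 0 = f := by rw [e2, Store.write_of_ne (by norm_num), h19]
    have h29 : s₂ 29 0 = I.value y i a := by
      rw [e2, Store.write_of_ne (by norm_num), e1, Store.write_same, if_pos rfl]
    have h30 : s₂ 30 0 = I.itemCost y i + I.value y i b := by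
      rw [e2, Store.write_same, if_pos rfl]
    have h15' : s₂ 15 = s' 15 := by
      rw [e2, e1, Store.write_of_ne (by norm_num), Store.write_of_ne (by norm_num)]
    have haddr : (cell 19 + zE).eval s₂ = (f + Z : ℕ) := by
      rw [eval_add, eval_cell, h19', h₂.eval_zE]
      push_cast
      rfl
    rw [Store.write_same, haddr, Int.toNat_natCast, h15']
    split_ifs with hff
    · have h1 : f' / Z = i + 1 := by rw [hff, Nat.add_div_right _ hZ0]
      have h2 : f' % Z = a := by rw [hff, Nat.add_mod_right]
      have h3 : I.value y (i + 1) a = min (I.value y i a) (I.itemCost y i + I.value y i b) := rfl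
      rw [h1, h2, h3]
      simp only [eval_add, eval_mul, eval_sub, eval_le, eval_lit, eval_cell, h29, h30]
      split_ifs with h4
      · rw [min_eq_left h4]; ring
      · rw [min_eq_right (by omega)]; ring
    · exact hP f' (by omega)

/-- The inequality is the constraint of `S` cleared of the denominator of its level. In the last
program the level is a variable and gets a coefficient; in earlier ones it is a constant on the
right-hand side. Array `3` being zero at index `j` makes one formula serve both cases. -/
theorem den_report (h : Ready I y s) (S : Finset ℕ)
    (h15 : s 15 (I.n * I.states y) % 2 ^ I.n =
      ((∑ k ∈ Finset.range I.n, if k ∈ S then 2 ^ k else 0 : ℕ) : ℤ)) :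
    report.den s 10 0 = 0 ∧
    (∀ k < I.n, report.den s 11 k = I.lvlDen y * if k ∈ S then 1 else 0) ∧
    report.den s 12 0 = 0 - (if I.lp y + 1 = I.j then 1 else 0) * I.lvlDen y ∧
    report.den s 12 1 =
      (if I.W ≤ ∑ k ∈ Finset.range I.n, if k ∈ S then I.wt k else 0 then 1 else 0) * I.lvlDen y +
        I.input 3 (I.lp y + 1) := by
  set M := ∑ k ∈ Finset.range I.n, if k ∈ S then 2 ^ k else 0 with hM
  simp only [report, den_seq, den_assign, eval_lit, Int.toNat_zero]
  set s₁ := s.write 27 0 _ with hs₁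
  have e1 : s₁ = s.write 27 0 M := by
    rw [hs₁, eval_mod, eval_get, eval_mul, eval_nE h.agree, h.eval_zE, eval_get, eval_nE h.agree,
      Int.toNat_natCast, h.pow _ le_rfl, ← h15]
    norm_cast
  set s₂ := s₁.write 14 0 0 with hs₂
  have h₂ : Ready I y s₂ := (h.write (by decide) (by norm_num)).write (by decide) (by norm_num)
  have h27 : s₂ 27 0 = M := by
    rw [hs₂, Store.write_of_ne (by norm_num), e1, Store.write_same, if_pos rfl]
  set s₃ := (upTo 18 nE _).den s₂ with hs₃
  have hfr : ∀ a, a ∉ [18, 28, 11, 14] → s₃ a = s₂ a := fun a ha => by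
    rw [hs₃]
    exact den_of_notMem ha
  have h₃ : Ready I y s₃ := h₂.of_forall (by decide) (by decide) hfr
  obtain ⟨h11, h14⟩ : (∀ k < I.n, s₃ 11 k = I.lvlDen y * if k ∈ S then 1 else 0) ∧
      s₃ 14 0 = ((∑ k ∈ Finset.range I.n, if k ∈ S then I.wt k else 0 : ℕ) : ℤ) := by
    rw [hs₃]
    refine den_upTo_induction (eval_nE h₂.agree) (fun i s' =>
      (∀ k < i, s' 11 k = I.lvlDen y * if k ∈ S then 1 else 0) ∧
      s' 14 0 = ((∑ k ∈ Finset.range i, if k ∈ S then I.wt k else 0 : ℕ) : ℤ)) ?_ ?_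
    · refine ⟨by simp, ?_⟩
      rw [Store.write_of_ne (by norm_num), hs₂, Store.write_same]
      simp
    · rintro i hi s' hv hs' ⟨h11, h14⟩
      have h' : Ready I y s' := h₂.of_forall (by decide) (by decide) hs'
      simp only [den_seq, den_assign, eval_lit, Int.toNat_zero]
      set t₁ := s'.write 28 0 _ with ht₁
      have f1 : t₁ = s'.write 28 0 (if i ∈ S then 1 else 0) := by
        rw [ht₁, eval_mod, eval_div, eval_get, eval_cell, eval_cell, eval_lit, hv,
          Int.toNat_natCast, h'.pow i hi.le, hs' 27 (by decide), h27]
        have := sum_two_pow_div_mod S hi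
        rw [← hM] at this
        have h2 : ((M : ℤ) / 2 ^ i % 2) = ((M / 2 ^ i % 2 : ℕ) : ℤ) := by push_cast; rfl
        rw [h2, this]
        push_cast
        rfl
      have k₁ : Ready I y t₁ := h'.write (by decide) (by norm_num)
      have t18 : t₁ 18 0 = i := by rw [f1, Store.write_of_ne (by norm_num), hv]
      have t28 : t₁ 28 0 = if i ∈ S then 1 else 0 := by rw [f1, Store.write_same, if_pos rfl]
      have t11 : t₁ 11 = s' 11 := by rw [f1, Store.write_of_ne (by norm_num)]
      have t14 : t₁ 14 = s' 14 := by rw [f1, Store.write_of_ne (by norm_num)]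
      rw [eval_mul, k₁.eval_denE, eval_cell, eval_cell, t18, t28, Int.toNat_natCast]
      set t₂ := t₁.write 11 i _ with ht₂
      have k₂ : Ready I y t₂ := k₁.write (by decide) (by norm_num)
      constructor
      · intro k hk
        rw [Store.write_of_ne (by norm_num), Store.write_of_ne (by norm_num), ht₂,
          Store.write_same, t11]
        split_ifs with hki hkS hkS <;> first
          | (subst hki; simp_all)
          | (have := h11 k (by omega); simp_all)
      · rw [Store.write_of_ne (by norm_num), Store.write_same, if_pos rfl, eval_add, eval_mul,
          eval_cell, eval_cell, eval_get, eval_cell, k₂.agree 1 (by norm_num), ht₂,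
          Store.write_of_ne (by norm_num), Store.write_of_ne (by norm_num),
          Store.write_of_ne (by norm_num), t14, t18, t28, h14, Int.toNat_natCast, input_one_eq,
          Finset.sum_range_succ]
        push_cast
        congr 1
        split_ifs <;> simp
  rw [eval_sub, eval_lit, eval_mul, h₃.eval_lastE, h₃.eval_denE]
  set s₄ := s₃.write 12 0 _ with hs₄
  have h₄ : Ready I y s₄ := h₃.write (by decide) (by norm_num)
  have h14' : s₄ 14 0 = s₃ 14 0 := by rw [hs₄, Store.write_of_ne (by norm_num)]
  rw [eval_add, eval_mul, eval_le, eval_wE h₄.agree, eval_cell, h14', h14, h₄.eval_denE,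
    h₄.eval_get_succ (by norm_num)]
  refine ⟨by simp [Store.write_same], fun k hk => ?_, ?_, ?_⟩
  · rw [Store.write_of_ne (by norm_num), Store.write_of_ne (by norm_num), hs₄,
      Store.write_of_ne (by norm_num), h11 k hk]
  · rw [Store.write_of_ne (by norm_num), Store.write_same, if_neg (by simp), hs₄,
      Store.write_same, if_pos rfl]
  · rw [Store.write_of_ne (by norm_num), Store.write_same, if_pos (by simp)]
    norm_cast

end Separation

end WVG

/-! ### Correctness of the search. -/

namespace WVG

namespace Instance

variable (I : Instance)

/-- Sum over the players in a coalition. -/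
abbrev sumOver {M : Type*} [AddCommMonoid M] (S : Finset ℕ) (f : ℕ → M) : M :=
  ∑ k ∈ Finset.range I.n, if k ∈ S then f k else 0

/-- The coalitions that are examined in a cell block of array `7`. -/
def Examined (y : ℕ) (S : Finset ℕ) : Prop :=
  I.lp y = 0 ∨ I.sumOver S (I.vec y) % I.prm y ≠ 0

/-- Scaled excess of a coalition over the level required in a linear program. -/
def slack (y : ℕ) (S : Finset ℕ) : ℤ :=
  I.lvlDen y * I.sumOver S (fun k => I.input 5 k * (I.scaled / I.input 6 k)) -
    ((if I.W ≤ I.sumOver S I.wt then 1 else 0) * I.lvlDen y + I.lvlNum y) * I.scaled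

variable {I}

/-- The factor $2^n$ clears the lowest $n$ bits of all scaled payoffs and levels, leaving room for a
bit mask. -/
theorem scaled_eq : I.scaled = (∏ k ∈ Finset.range I.n, I.input 6 k) * 2 ^ I.n := by
  rw [scaled, Finset.prod_mul_distrib, Finset.prod_const, Finset.card_range]

theorem input_six_dvd {k : ℕ} (hk : k < I.n) :
    I.input 6 k ∣ ∏ k ∈ Finset.range I.n, I.input 6 k :=
  Finset.dvd_prod_of_mem _ (Finset.mem_range.2 hk)

theorem two_pow_dvd_scaled_div {k : ℕ} (hk : k < I.n) :
    (2 : ℤ) ^ I.n ∣ I.scaled / I.input 6 k := by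
  rw [scaled_eq, mul_comm, Int.mul_ediv_assoc _ (input_six_dvd hk)]
  exact Dvd.intro _ rfl

theorem two_pow_dvd_sumOver (S : Finset ℕ) : (2 : ℤ) ^ I.n ∣
    I.sumOver S (fun k => I.input 5 k * (I.scaled / I.input 6 k)) := by
  refine Finset.dvd_sum fun k hk => ?_
  split_ifs
  · exact (two_pow_dvd_scaled_div (Finset.mem_range.1 hk)).mul_left _
  · exact dvd_zero _

/-- For an examined coalition the cost of its run is its slack plus its bit mask. Otherwise the
final state costs nothing, which leaves the scaled payoff plus the mask. In the first program no
residue is tested. -/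
theorem run_cost_eq {y : ℕ} (hp : 0 < I.prm y) (S : Finset ℕ) :
    (∑ k ∈ Finset.range I.n, if k ∈ S then I.itemCost y k else 0) +
        I.stateCost y (dpRun (capStep I.W (I.prm y) I.wt (I.vec y)) S I.n 0) =
      (open Classical in if I.Examined y S then I.slack y S else
        I.lvlDen y * I.sumOver S (fun k => I.input 5 k * (I.scaled / I.input 6 k))) +
      ((I.sumOver S (fun k => 2 ^ k) : ℕ) : ℤ) := by
  have h1 : (∑ k ∈ Finset.range I.n, if k ∈ S then I.itemCost y k else 0) =
      I.lvlDen y * I.sumOver S (fun k => I.input 5 k * (I.scaled / I.input 6 k)) +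
        ((I.sumOver S (fun k => 2 ^ k) : ℕ) : ℤ) := by
    rw [sumOver, sumOver, Finset.mul_sum, Nat.cast_sum, ← Finset.sum_add_distrib]
    refine Finset.sum_congr rfl fun k _ => ?_
    split_ifs
    · rw [itemCost]; push_cast; rfl
    · simp
  have h2 : dpRun (capStep I.W (I.prm y) I.wt (I.vec y)) S I.n 0 =
      min (I.sumOver S I.wt) I.W * I.prm y + I.sumOver S (I.vec y) % I.prm y := by
    rw [dpRun_capStep hp _ _ _ _ _ (Nat.mul_pos (Nat.succ_pos _) hp)]
    simp
  have hlt := Nat.mod_lt (I.sumOver S (I.vec y)) hp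
  have h3 : dpRun (capStep I.W (I.prm y) I.wt (I.vec y)) S I.n 0 / I.prm y =
      min (I.sumOver S I.wt) I.W := by
    rw [h2, mul_comm, Nat.mul_add_div hp, Nat.div_eq_of_lt hlt, add_zero]
  have h4 : dpRun (capStep I.W (I.prm y) I.wt (I.vec y)) S I.n 0 % I.prm y =
      I.sumOver S (I.vec y) % I.prm y := by
    rw [h2, mul_comm, Nat.mul_add_mod, Nat.mod_mod]
  have h5 : (if I.W ≤ min (I.sumOver S I.wt) I.W then (1 : ℤ) else 0) =
      if I.W ≤ I.sumOver S I.wt then 1 else 0 := by simp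
  rw [h1, stateCost, h3, h4, h5]
  by_cases hE : I.Examined y S
  · have h6 : ((1 : ℤ) - (if I.sumOver S (I.vec y) % I.prm y = 0 then 1 else 0) *
        if 1 ≤ I.lp y then 1 else 0) = 1 := by
      rcases hE with h | h
      · simp [h]
      · rw [if_neg h, zero_mul, sub_zero]
    rw [if_pos hE, h6, slack]
    ring
  · have h6 : ((1 : ℤ) - (if I.sumOver S (I.vec y) % I.prm y = 0 then 1 else 0) *
        if 1 ≤ I.lp y then 1 else 0) = 0 := by
      simp only [Examined, not_or, not_not] at hE
      rw [if_pos hE.2, if_pos (by omega)]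
      norm_num
    rw [if_neg hE, h6]
    ring

end Instance

/-- A negative multiple of `N` is at most `-N`, so adding less than `N` cannot change its sign, and
the remainder is what was added. -/
theorem emod_eq_of_dvd_of_lt {N c M : ℤ} (hc : N ∣ c) (h0 : 0 ≤ M) (hM : M < N) :
    (c + M) % N = M ∧ (c + M < 0 ↔ c < 0) := by
  obtain ⟨d, rfl⟩ := hc
  refine ⟨by rw [Int.mul_add_emod_self_left, Int.emod_eq_of_lt h0 hM], fun h => by linarith,
    fun h => ?_⟩
  have hd : d < 0 := by
    by_contra! hd
    have := mul_nonneg (h0.trans hM.le) hd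
    linarith
  nlinarith

namespace Separation

open WVG.Expr WVG.Cmd Instance

variable {I : Instance} {y : ℕ} {s : Store}

/-- The minimum is negative exactly if some examined coalition has negative slack. Nonnegative
payoffs are essential: they keep coalitions that are not examined from producing a negative value,
so the sign check must come first. -/
theorem den_search (h : Ready I y s) (hp : 0 < I.prm y) (hx : ∀ k < I.n, 0 ≤ I.input 5 k)
    (hd : ∀ k < I.n, 0 ≤ I.input 6 k) (hl : 0 ≤ I.lvlDen y)
    {P : Prop} {V : (ℕ → ℤ) → ℤ → ℤ → Prop} (hs : State P V I.n s)
    (hV : ∀ S ⊆ Finset.range I.n, I.Examined y S → I.slack y S < 0 →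
      V (fun k => I.lvlDen y * if k ∈ S then 1 else 0)
        (0 - (if I.lp y + 1 = I.j then 1 else 0) * I.lvlDen y)
        ((if I.W ≤ I.sumOver S I.wt then 1 else 0) * I.lvlDen y + I.input 3 (I.lp y + 1))) :
    State (P ∧ ∀ S ⊆ Finset.range I.n, I.Examined y S → 0 ≤ I.slack y S) V I.n
      (search.den s) := by
  rw [search, den_seq, den_seq, den_when]
  have hfr₁ : ∀ a, a ∉ tableBase.writes → tableBase.den s a = s a := fun a ha => den_of_notMem ha
  have h₁ : Ready I y (tableBase.den s) := h.of_forall (by decide) (by decide) hfr₁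
  have h15 := den_tableFill h₁ hp (den_tableBase h)
  set s₂ := tableFill.den (tableBase.den s) with hs₂
  have hfr₂ : ∀ a, a ∉ tableFill.writes → s₂ a = tableBase.den s a := fun a ha => den_of_notMem ha
  have h₂ : Ready I y s₂ := h₁.of_forall (by decide) (by decide) hfr₂
  have hZ0 : 0 < I.states y := Nat.mul_pos (Nat.succ_pos _) hp
  have hval := h15 (I.n * I.states y) (by omega)
  rw [Nat.mul_div_cancel _ hZ0, Nat.mul_mod_left] at hval
  have hcell : (get 15 (nE * zE)).eval s₂ = I.value y I.n 0 := by
    rw [← hval, eval_get, eval_mul, eval_nE h₂.agree, h₂.eval_zE]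
    norm_cast
  have hsc : (2 : ℤ) ^ I.n ∣ I.scaled := by
    rw [scaled_eq]
    exact Dvd.intro_left _ rfl
  have hsl : ∀ S, (2 : ℤ) ^ I.n ∣ I.slack y S := fun S =>
    dvd_sub ((two_pow_dvd_sumOver S).mul_left _) (hsc.mul_left _)
  have hmask : ∀ S, ((I.sumOver S (fun k => 2 ^ k) : ℕ) : ℤ) < 2 ^ I.n := fun S => by
    exact_mod_cast sum_two_pow_lt S I.n
  rw [eval_le, hcell, eval_lit]
  by_cases hneg : I.value y I.n 0 ≤ -1
  · rw [if_pos hneg, if_neg (by norm_num)]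
    obtain ⟨S, hS, hcost⟩ := exists_dpVal_eq (I.itemCost y)
      (capStep I.W (I.prm y) I.wt (I.vec y)) (I.stateCost y) I.n 0
    rw [run_cost_eq hp] at hcost
    -- Otherwise the cost would be a nonnegative payoff plus a nonnegative mask.
    have hE : I.Examined y S := by
      by_contra hE
      rw [if_neg hE] at hcost
      have h1 : 0 ≤ I.sumOver S (fun k => I.input 5 k * (I.scaled / I.input 6 k)) := by
        refine Finset.sum_nonneg fun k hk => ?_
        have hk' := Finset.mem_range.1 hk
        split_ifs
        · refine mul_nonneg (hx k hk') (Int.ediv_nonneg ?_ (hd k hk'))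
          exact Finset.prod_nonneg fun i hi =>
            mul_nonneg (hd i (Finset.mem_range.1 hi)) (by norm_num)
        · exact le_rfl
      have h2 := mul_nonneg hl h1
      have h3 : I.value y I.n 0 = _ := hcost
      have h4 : (0 : ℤ) ≤ ((I.sumOver S (fun k => 2 ^ k) : ℕ) : ℤ) := Nat.cast_nonneg _
      omega
    rw [if_pos hE] at hcost
    have hcost' : I.value y I.n 0 = _ := hcost
    obtain ⟨e1, e2⟩ := emod_eq_of_dvd_of_lt (hsl S) (Nat.cast_nonneg _) (hmask S)
    obtain ⟨r1, r2, r3, r4⟩ := den_report h₂ S (by rw [hval, hcost', e1])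
    refine Or.inr ⟨r1, _, r2, ?_⟩
    rw [r3, r4]
    exact hV S hS hE (e2.1 (by omega))
  · rw [if_neg hneg, if_pos rfl]
    have hst : ∀ a ∈ [10, 11, 12], s₂ a = s a := by
      intro a ha
      simp only [List.mem_cons, List.not_mem_nil, or_false] at ha
      rcases ha with rfl | rfl | rfl <;>
        rw [hfr₂ _ (by decide), hfr₁ _ (by decide)]
    rw [State, hst 10 (by simp), hst 11 (by simp), hst 12 (by simp)]
    rcases hs with ⟨h1, h2⟩ | h1
    · refine Or.inl ⟨h1, h2, fun S hS hE => ?_⟩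
      have h3 := dpVal_le (I.itemCost y) (capStep I.W (I.prm y) I.wt (I.vec y))
        (I.stateCost y) S I.n 0
      rw [run_cost_eq hp, if_pos hE] at h3
      have h4 : I.value y I.n 0 ≤ _ := h3
      obtain ⟨-, e2⟩ := emod_eq_of_dvd_of_lt (hsl S) (Nat.cast_nonneg _) (hmask S)
      by_contra! h5
      have := e2.2 h5
      omega
    · exact Or.inr h1

/-- A single counter `y` encodes program, prime and vector. Blocks of the first program repeat one
and the same test. -/
theorem den_solve (hm : ∀ y, 0 < I.n → 0 < I.m → 0 < I.prm y) (hn : 0 < I.n) (hm' : 0 < I.m)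
    (hd : ∀ k < I.n, 0 ≤ I.input 6 k) (hl : ∀ y < I.j * I.m * I.n, 0 ≤ I.lvlDen y)
    {V : (ℕ → ℤ) → ℤ → ℤ → Prop}
    (hV₁ : ∀ ν : ℤ, ν = (if (I.W : ℤ) ≤ I.totalWeight then 1 else 0) →
      I.scaledTotal ≠ ν * I.scaled →
      V (fun _ => 2 * (if I.scaledTotal ≤ ν * I.scaled then 1 else 0) - 1) 0
        ((2 * (if I.scaledTotal ≤ ν * I.scaled then 1 else 0) - 1) * ν))
    (hV₂ : ∀ k < I.n, I.input 5 k < 0 → V (fun i => if i = k then 1 else 0) 0 0)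
    (hV₃ : ∀ y < I.j * I.m * I.n, ∀ S ⊆ Finset.range I.n, I.Examined y S → I.slack y S < 0 →
      V (fun k => I.lvlDen y * if k ∈ S then 1 else 0)
        (0 - (if I.lp y + 1 = I.j then 1 else 0) * I.lvlDen y)
        ((if I.W ≤ I.sumOver S I.wt then 1 else 0) * I.lvlDen y + I.input 3 (I.lp y + 1))) :
    State ((I.scaledTotal = (if (I.W : ℤ) ≤ I.totalWeight then 1 else 0) * I.scaled ∧
        ∀ k < I.n, 0 ≤ I.input 5 k) ∧ ∀ y < I.j * I.m * I.n, ∀ S ⊆ Finset.range I.n,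
          I.Examined y S → 0 ≤ I.slack y S) V I.n (solve.den I.input) := by
  rw [solve, den_seq, den_seq, den_seq, den_seq, den_when]
  have h₀ : I.Agree I.input := fun _ _ => rfl
  obtain ⟨a8, a9⟩ := den_scale h₀
  have h₁ : I.Agree (scale.den I.input) := h₀.den (by decide)
  set s₁ := scale.den I.input
  obtain ⟨b13, b14⟩ := den_total h₁ a8
  have h₂ : I.Agree (total.den s₁) := h₁.den (by decide)
  have f₂ : ∀ a, a ∉ total.writes → total.den s₁ a = s₁ a := fun a ha => den_of_notMem ha
  set s₂ := total.den s₁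
  have b8 : s₂ 8 0 = I.scaled := by rw [f₂ 8 (by decide), a8]
  have c := den_checkTotal h₂ b8 b13 b14 hV₁
  have h₃ : I.Agree (checkTotal.den s₂) := h₂.den (by decide)
  have f₃ : ∀ a, a ∉ checkTotal.writes → checkTotal.den s₂ a = s₂ a :=
    fun a ha => den_of_notMem ha
  set s₃ := checkTotal.den s₂
  have d := den_checkNonneg h₃ c hV₂
  have h₄ : I.Agree (checkNonneg.den s₃) := h₃.den (by decide)
  have f₄ : ∀ a, a ∉ checkNonneg.writes → checkNonneg.den s₃ a = s₃ a :=
    fun a ha => den_of_notMem ha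
  set s₄ := checkNonneg.den s₃
  rw [eval_cell]
  rcases d with ⟨d10, d'⟩ | d
  · rw [d10, if_neg one_ne_zero]
    have hN : (jE * mE * nE).eval s₄ = (I.j * I.m * I.n : ℕ) := by
      rw [eval_mul, eval_mul, eval_nE h₄, eval_mE h₄, eval_jE h₄]
      push_cast
      rfl
    refine den_upTo_induction hN (fun i => State ((I.scaledTotal =
      (if (I.W : ℤ) ≤ I.totalWeight then 1 else 0) * I.scaled ∧ ∀ k < I.n, 0 ≤ I.input 5 k) ∧
      ∀ y < i, ∀ S ⊆ Finset.range I.n, I.Examined y S → 0 ≤ I.slack y S) V I.n) ?_ ?_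
    · refine Or.inl ⟨?_, d', by simp⟩
      rw [Store.write_of_ne (by norm_num), d10]
    · intro y hy s' hv hs' hP
      have hR : Ready I y s' := by
        refine ⟨h₄.of_forall (by decide) hs', ?_, ?_, hv⟩
        · rw [hs' 8 (by decide), f₄ 8 (by decide), f₃ 8 (by decide), b8]
        · rw [hs' 9 (by decide), f₄ 9 (by decide), f₃ 9 (by decide), f₂ 9 (by decide)]
          exact a9
      have hnext := den_search hR (hm y hn hm') d'.2 hd (hl y hy) hP (hV₃ y hy)
      have hw : ∀ a ∈ [10, 11, 12], ((search.den s').write 17 0 (y + 1 : ℕ)) a =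
          search.den s' a := by
        intro a ha
        exact Store.write_of_ne (by rintro rfl; simp at ha)
      rw [State, hw 10 (by simp), hw 11 (by simp), hw 12 (by simp)]
      rcases hnext with ⟨e1, ⟨e2, e3⟩, e4⟩ | e
      · refine Or.inl ⟨e1, e2, fun y' hy' => ?_⟩
        rcases (Nat.lt_succ_iff.1 hy').eq_or_lt with rfl | hy'
        · exact e4
        · exact e3 y' hy'
      · exact Or.inr e
  · rw [d.1, if_pos rfl]
    exact Or.inr d

theorem den_output {P : Prop} {V : (ℕ → ℤ) → ℤ → ℤ → Prop} {n : ℕ} (hn : s 0 0 = (n : ℕ))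
    (hs : State P V n s) :
    (outputAnswer.den (outputInequality.den s) 0 0 = 1 ∧ P) ∨
    (outputAnswer.den (outputInequality.den s) 0 0 = 0 ∧ ∃ a : ℕ → ℤ,
      (∀ k < n, outputAnswer.den (outputInequality.den s) 1 k = a k) ∧
      V a (outputAnswer.den (outputInequality.den s) 2 0)
        (outputAnswer.den (outputInequality.den s) 2 1)) := by
  have hN : nE.eval s = (n : ℕ) := by rw [nE, eval_get]; exact hn
  have h1 : ∀ k < n, (upTo 16 nE (assign 1 (cell 16) (get 11 (cell 16)))).den s 1 k = s 11 k :=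
    den_upTo_fill (by norm_num) hN fun i _ s' hv hs' => by
      rw [eval_get, eval_cell, hv, Int.toNat_natCast, hs' 11 (by decide)]
  have hw : ∀ a, a ∉ [16, 1] →
      (upTo 16 nE (assign 1 (cell 16) (get 11 (cell 16)))).den s a = s a :=
    fun a ha => den_of_notMem ha
  have e0 : outputAnswer.den (outputInequality.den s) 0 0 = s 10 0 := by
    rw [outputAnswer, den_assign, eval_lit, Int.toNat_zero, Store.write_same, if_pos rfl, eval_cell]
    have : outputInequality.den s 10 = s 10 := den_of_notMem (by decide)
    rw [this]
  have e1 : outputAnswer.den (outputInequality.den s) 1 =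
      (upTo 16 nE (assign 1 (cell 16) (get 11 (cell 16)))).den s 1 := by
    rw [den_of_notMem (c := outputAnswer) (by decide)]
    rw [outputInequality, den_seq, den_seq, den_assign, den_assign, Store.write_of_ne (by norm_num),
      Store.write_of_ne (by norm_num)]
  have e2 : outputAnswer.den (outputInequality.den s) 2 0 = s 12 0 ∧
      outputAnswer.den (outputInequality.den s) 2 1 = s 12 1 := by
    rw [den_of_notMem (c := outputAnswer) (by decide)]
    simp [outputInequality, den_seq, den_assign, Store.write_same, Store.write_of_ne, eval_lit,
      eval_cell, eval_get, hw 12 (by decide)]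
  rw [e0, e1, e2.1, e2.2]
  rcases hs with hs | ⟨h10, a, h11, hV⟩
  · exact Or.inl hs
  · exact Or.inr ⟨h10, a, fun k hk => (h1 k hk).trans (h11 k hk), hV⟩

end Separation

end WVG

/-! ### From memory contents to the linear program. -/

namespace WVG

open Matrix

theorem dotProduct_chi_ne_zero_iff {n p : ℕ} [NeZero p] (v : Fin n → ZMod p) (S : Finset (Fin n)) :
    v ⬝ᵥ chi (ZMod p) S ≠ 0 ↔ (∑ k ∈ S, (v k).val) % p ≠ 0 := by
  have h : v ⬝ᵥ chi (ZMod p) S = ((∑ k ∈ S, (v k).val : ℕ) : ZMod p) := by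
    simp [dotProduct, chi, Finset.sum_ite_mem]
  rw [h, Ne, ZMod.natCast_eq_zero_iff, Nat.dvd_iff_mod_eq_zero]

namespace Instance

variable {I : Instance}

/-- A coalition as a set of natural numbers. -/
def toNats (S : Finset (Fin I.n)) : Finset ℕ := S.map Fin.valEmbedding

theorem toNats_subset (S : Finset (Fin I.n)) : toNats S ⊆ Finset.range I.n := by
  intro k hk
  obtain ⟨i, -, rfl⟩ := Finset.mem_map.1 hk
  exact Finset.mem_range.2 i.2

theorem mem_toNats {S : Finset (Fin I.n)} {i : Fin I.n} : (i : ℕ) ∈ toNats S ↔ i ∈ S := by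
  simp [toNats, Fin.val_inj]

theorem exists_toNats {S : Finset ℕ} (hS : S ⊆ Finset.range I.n) :
    ∃ T : Finset (Fin I.n), toNats T = S := by
  refine ⟨Finset.univ.filter fun i : Fin I.n => (i : ℕ) ∈ S, ?_⟩
  ext k
  simp only [toNats, Finset.mem_map, Finset.mem_filter, Finset.mem_univ, true_and,
    Fin.valEmbedding_apply]
  exact ⟨fun ⟨i, hi, hk⟩ => hk ▸ hi, fun hk => ⟨⟨k, Finset.mem_range.1 (hS hk)⟩, hk, rfl⟩⟩

theorem sumOver_toNats {M : Type*} [AddCommMonoid M] (S : Finset (Fin I.n)) (f : ℕ → M) :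
    I.sumOver (toNats S) f = ∑ i ∈ S, f i := by
  rw [sumOver, Finset.sum_range, ← Finset.sum_filter]
  refine Finset.sum_congr ?_ fun _ _ => rfl
  ext i
  simp [mem_toNats]

theorem wt_val (i : Fin I.n) : I.wt i = I.w i := by
  simp [wt, input]

theorem sumOver_wt (S : Finset (Fin I.n)) : I.sumOver (toNats S) I.wt = ∑ i ∈ S, I.w i := by
  rw [sumOver_toNats]
  exact Finset.sum_congr rfl fun i _ => wt_val i

theorem input_five_val (i : Fin I.n) : I.input 5 i = (I.x i).num := by
  simp [input]

theorem input_six_val (i : Fin I.n) : I.input 6 i = (I.x i).den := by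
  simp [input]

theorem scaled_pos : 0 < I.scaled := by
  refine Finset.prod_pos fun k hk => ?_
  have h := input_six_val (I := I) ⟨k, Finset.mem_range.1 hk⟩
  rw [h]
  have := (I.x ⟨k, Finset.mem_range.1 hk⟩).den_pos
  positivity

theorem input_five_mul (i : Fin I.n) :
    ((I.input 5 i * (I.scaled / I.input 6 i) : ℤ) : ℝ) = I.x i * I.scaled := by
  obtain ⟨d, hd⟩ : I.input 6 i ∣ I.scaled := by
    rw [scaled_eq]
    exact (input_six_dvd i.2).mul_right _
  have h0 : (I.input 6 i : ℤ) ≠ 0 := by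
    rw [input_six_val]
    exact_mod_cast (I.x i).den_ne_zero
  rw [hd, Int.mul_ediv_cancel_left _ h0, input_five_val, input_six_val]
  have h1 : ((I.x i : ℚ) : ℝ) * ((I.x i).den : ℝ) = (I.x i).num := by
    exact_mod_cast Rat.mul_den_eq_num (I.x i)
  push_cast
  rw [← mul_assoc, h1]

theorem scaledTotal_eq : (I.scaledTotal : ℝ) = (∑ i, (I.x i : ℝ)) * I.scaled := by
  rw [scaledTotal, Finset.sum_range, Int.cast_sum, Finset.sum_mul]
  exact Finset.sum_congr rfl fun i _ => input_five_mul i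

theorem totalWeight_eq : I.totalWeight = ((∑ i, I.w i : ℕ) : ℤ) := by
  rw [totalWeight, Finset.sum_range, Nat.cast_sum]
  refine Finset.sum_congr rfl fun i _ => ?_
  rw [input_one_eq, wt_val]

theorem utility_eq (S : Finset (Fin I.n)) : utility I.w I.W S =
    ((if I.W ≤ I.sumOver (toNats S) I.wt then 1 else 0 : ℤ) : ℝ) := by
  rw [sumOver_wt, utility]
  push_cast
  rfl

variable (I) in
/-- The level required in the linear program `i + 1`. -/
def lvl (i : ℕ) : ℚ := if i + 1 = I.j then I.ε else I.eps (i + 1)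

/-- Array `3` stores levels for indices below `j` only, so the two summands are never present
together. -/
theorem lvlNum_eq {y : ℕ} (hy : I.lp y < I.j) : I.lvlNum y = (I.lvl (I.lp y)).num := by
  have h4 : I.input 0 4 = I.ε.num := rfl
  have h3 : I.input 3 (I.lp y + 1) = if 1 ≤ I.lp y + 1 ∧ I.lp y + 1 < I.j then
    (I.eps (I.lp y + 1)).num else 0 := rfl
  rw [lvlNum, lvl, h4, h3]
  split_ifs <;> omega

theorem lvlDen_eq {y : ℕ} (hy : I.lp y < I.j) : I.lvlDen y = (I.lvl (I.lp y)).den := by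
  have h4 : I.input 0 5 = I.ε.den := rfl
  have h3 : I.input 4 (I.lp y + 1) = if 1 ≤ I.lp y + 1 ∧ I.lp y + 1 < I.j then
    ((I.eps (I.lp y + 1)).den : ℤ) else 0 := rfl
  rw [lvlDen, lvl, h4, h3]
  split_ifs <;> omega

theorem lp_lt {y : ℕ} (hy : y < I.j * I.m * I.n) : I.lp y < I.j := by
  rw [lp, Nat.div_div_eq_div_mul]
  refine Nat.div_lt_of_lt_mul ?_
  rwa [mul_comm, mul_comm I.n, ← mul_assoc]

/-- The slack is a positive multiple of the true surplus in the constraint, hence has the same sign.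
-/
theorem slack_eq {y : ℕ} (hy : I.lp y < I.j) (S : Finset (Fin I.n)) :
    (I.slack y (toNats S) : ℝ) = (I.scaled * (I.lvl (I.lp y)).den : ℝ) *
      (∑ i ∈ S, (I.x i : ℝ) - (utility I.w I.W S + (I.lvl (I.lp y) : ℝ))) := by
  have h1 : ((I.lvl (I.lp y) : ℚ) : ℝ) * ((I.lvl (I.lp y)).den : ℝ) = (I.lvl (I.lp y)).num := by
    exact_mod_cast Rat.mul_den_eq_num (I.lvl (I.lp y))
  have h2 : ((∑ i ∈ S, I.input 5 i * (I.scaled / I.input 6 i) : ℤ) : ℝ) =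
      (∑ i ∈ S, (I.x i : ℝ)) * I.scaled := by
    rw [Int.cast_sum, Finset.sum_mul]
    exact Finset.sum_congr rfl fun i _ => input_five_mul i
  rw [slack, lvlNum_eq hy, lvlDen_eq hy, utility_eq, sumOver_toNats]
  rw [Int.cast_sub, Int.cast_mul, h2, Int.cast_mul, Int.cast_add, Int.cast_mul, ← h1,
    Int.cast_natCast]
  ring

/-- Contents of array `7` in terms of the position in the array of vectors. -/
def vecCell (I : Instance) (l q t k : ℕ) : ℤ :=
  if h : (1 ≤ l ∧ l < I.j) ∧ q < I.m ∧ t < I.n - l ∧ k < I.n then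
    ((I.v l ⟨q, h.2.1⟩ ⟨t, h.2.2.1⟩ ⟨k, h.2.2.2⟩).val : ℤ)
  else 0

theorem vec_eq_vecCell (y : ℕ) (k : Fin I.n) :
    I.vec y k = (I.vecCell (I.lp y) (y / I.n % I.m) (y % I.n) k).toNat := by
  have h : ∀ c, I.input 7 c = I.vecCell (c / I.n / I.n / I.m) (c / I.n / I.n % I.m)
    (c / I.n % I.n) (c % I.n) := fun _ => rfl
  have hn : 0 < I.n := k.pos
  have h1 : (y * I.n + k) / I.n = y := by
    rw [mul_comm, Nat.mul_add_div hn, Nat.div_eq_of_lt k.2, add_zero]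
  have h2 : (y * I.n + k) % I.n = k := by
    rw [mul_comm, Nat.mul_add_mod, Nat.mod_eq_of_lt k.2]
  rw [vec, h, h1, h2, lp]

theorem vecCell_eq {l : ℕ} (hl : 1 ≤ l) (hlj : l < I.j) (q : Fin I.m) (t : Fin (I.n - l))
    (k : Fin I.n) : (I.vecCell l q t k).toNat = (I.v l q t k).val := by
  rw [vecCell, dif_pos ⟨⟨hl, hlj⟩, q.2, t.2, k.2⟩]
  rfl

theorem prm_eq {y : ℕ} (q : Fin I.m) (hq : y / I.n % I.m = q) : I.prm y = I.prime q := by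
  rw [prm, hq]
  simp [input]

namespace IsScheme

variable {z : (l : ℕ) → Fin l → Finset (Fin I.n)}

theorem constrained_of_examined (h : I.IsScheme z) {y : ℕ} (hy : I.lp y < I.j) {S : Finset (Fin I.n)}
    (hE : I.Examined y (toNats S)) : Constrained (spanL z) (I.lp y) S := by
  rcases Nat.eq_zero_or_pos (I.lp y) with h0 | h0
  · exact Or.inl h0
  · right
    have hE := hE.resolve_left h0.ne'
    have hm := h.three_le_m.1
    let q : Fin I.m := ⟨y / I.n % I.m, Nat.mod_lt _ (by omega)⟩
    have := NeZero.mk (h.isPrime q).ne_zero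
    rw [prm_eq q rfl, sumOver_toNats] at hE
    by_cases ht : y % I.n < I.n - I.lp y
    · refine (h.notMem_spanL_iff h0 hy S).1 ⟨q, ⟨y % I.n, ht⟩, ?_⟩
      have hsum : ∑ k ∈ S, (I.v (I.lp y) q ⟨y % I.n, ht⟩ k).val = ∑ k ∈ S, I.vec y k := by
        refine Finset.sum_congr rfl fun k _ => ?_
        rw [vec_eq_vecCell, ← vecCell_eq h0 hy q ⟨y % I.n, ht⟩ k]
      rw [dotProduct_chi_ne_zero_iff, hsum]
      exact hE
    -- Vector indices from `n - l` on are padding: their cells are zero, so no coalition is examined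
    -- there.
    · exfalso
      apply hE
      rw [Finset.sum_eq_zero, Nat.zero_mod]
      intro k _
      rw [vec_eq_vecCell, vecCell, dif_neg fun h => ht h.2.2.1]
      rfl

theorem exists_examined (h : I.IsScheme z) {l : ℕ} (hl : l < I.j) {S : Finset (Fin I.n)}
    (hS : Constrained (spanL z) l S) :
    ∃ y < I.j * I.m * I.n, I.lp y = l ∧ I.Examined y (toNats S) := by
  have hm := h.three_le_m.1
  have hn := h.three_le
  rcases Nat.eq_zero_or_pos l with rfl | h0
  · have : I.lp 0 = 0 := by simp [lp]
    exact ⟨0, Nat.mul_pos (Nat.mul_pos hl (by omega)) (by omega), this, Or.inl this⟩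
  · obtain ⟨q, t, hqt⟩ := (h.notMem_spanL_iff h0 hl S).2 (hS.resolve_left h0.ne')
    have := NeZero.mk (h.isPrime q).ne_zero
    have ht := t.2
    have hq := q.2
    have e1 : ((l * I.m + q) * I.n + t) / I.n = l * I.m + q := by
      rw [mul_comm, Nat.mul_add_div (by omega), Nat.div_eq_of_lt (by omega), add_zero]
    have e2 : ((l * I.m + q) * I.n + t) % I.n = t := by
      rw [mul_comm, Nat.mul_add_mod, Nat.mod_eq_of_lt (by omega)]
    have e3 : (l * I.m + q) / I.m = l := by
      rw [mul_comm, Nat.mul_add_div (by omega), Nat.div_eq_of_lt hq, add_zero]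
    have e4 : (l * I.m + q) % I.m = q := by
      rw [mul_comm, Nat.mul_add_mod, Nat.mod_eq_of_lt hq]
    -- The address of the block in which the input stores the vector with indices `l`, `q`, `t`.
    refine ⟨(l * I.m + q) * I.n + t, ?_, by rw [lp, e1, e3], Or.inr ?_⟩
    · have h1 : (l + 1) * I.m ≤ I.j * I.m := Nat.mul_le_mul_right _ hl
      have h2 : (l * I.m + q + 1) * I.n ≤ I.j * I.m * I.n := Nat.mul_le_mul_right _ (by
        rw [add_mul, one_mul] at h1
        omega)
      rw [add_mul _ 1, one_mul] at h2
      omega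
    · rw [prm_eq q (by rw [e1, e4]), sumOver_toNats]
      have hsum : ∑ k ∈ S, I.vec ((l * I.m + q) * I.n + t) k = ∑ k ∈ S, (I.v l q t k).val := by
        refine Finset.sum_congr rfl fun k _ => ?_
        rw [vec_eq_vecCell, lp, e1, e2, e3, e4, vecCell_eq h0 hl]
      rw [hsum]
      exact (dotProduct_chi_ne_zero_iff _ _).1 hqt

theorem feasPbar_iff (h : I.IsScheme z) (x : Fin I.n → ℝ) (e : ℝ) : I.feasPbar z I.j x e ↔
    (∑ i, x i = utility I.w I.W Finset.univ ∧ ∀ i, 0 ≤ x i) ∧ ∀ i < I.j, ∀ S,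
      Constrained (spanL z) i S →
        utility I.w I.W S + (if i + 1 = I.j then e else I.eps (i + 1)) ≤ ∑ k ∈ S, x k := by
  have hkey : I.feasPbar z I.j x e ↔ I.feasP z I.j x e := by
    have h1 := h.one_le_j
    have h2 := fun l hl hlj S => h.notMem_spanL_iff (l := l) hl hlj S
    generalize I.j = j at h1 h2
    rcases j with _ | _ | l
    · omega
    · rfl
    · simp only [feasPbar, feasP, lpP]
      refine and_congr_left fun _ => forall_congr' fun S => ?_
      rw [h2 (l + 1) (by omega) (by omega) S]
  obtain ⟨l, hl⟩ : ∃ l, I.j = l + 1 := ⟨I.j - 1, by have := h.one_le_j; omega⟩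
  rw [hkey, hl, feasP, lpP_succ_iff]
  simp only [Nat.lt_succ_iff, Nat.succ_inj]

/-- The arbitrary predicate `V` is specialized here to "valid for all feasible points and violated
by the given one". The three premises then say that total, sign and coalition constraints yield such
inequalities. -/
theorem solves_of_state (h : I.IsScheme z) {s : Store}
    (hs : ∀ V : (ℕ → ℤ) → ℤ → ℤ → Prop,
      (∀ ν : ℤ, ν = (if (I.W : ℤ) ≤ I.totalWeight then 1 else 0) →
        I.scaledTotal ≠ ν * I.scaled →
        V (fun _ => 2 * (if I.scaledTotal ≤ ν * I.scaled then 1 else 0) - 1) 0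
          ((2 * (if I.scaledTotal ≤ ν * I.scaled then 1 else 0) - 1) * ν)) →
      (∀ k < I.n, I.input 5 k < 0 → V (fun i => if i = k then 1 else 0) 0 0) →
      (∀ y < I.j * I.m * I.n, ∀ S ⊆ Finset.range I.n, I.Examined y S → I.slack y S < 0 →
        V (fun k => I.lvlDen y * if k ∈ S then 1 else 0)
          (0 - (if I.lp y + 1 = I.j then 1 else 0) * I.lvlDen y)
          ((if I.W ≤ I.sumOver S I.wt then 1 else 0) * I.lvlDen y + I.input 3 (I.lp y + 1))) →
      (s 0 0 = 1 ∧ (I.scaledTotal = (if (I.W : ℤ) ≤ I.totalWeight then 1 else 0) * I.scaled ∧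
        ∀ k < I.n, 0 ≤ I.input 5 k) ∧ ∀ y < I.j * I.m * I.n, ∀ S ⊆ Finset.range I.n,
          I.Examined y S → 0 ≤ I.slack y S) ∨
      (s 0 0 = 0 ∧ ∃ a : ℕ → ℤ, (∀ k < I.n, s 1 k = a k) ∧ V a (s 2 0) (s 2 1))) :
    SolvesSeparation (I.feasPbar z I.j) (fun k => (I.x k : ℝ)) (I.ε : ℝ) s := by
  have hD : (0 : ℝ) < I.scaled := by exact_mod_cast scaled_pos
  have hν : ((if (I.W : ℤ) ≤ I.totalWeight then 1 else 0 : ℤ) : ℝ) =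
      utility I.w I.W Finset.univ := by
    rw [totalWeight_eq, utility]
    norm_cast
  have hden : ∀ y, 0 < ((I.lvl (I.lp y)).den : ℝ) := fun y => by
    exact_mod_cast (I.lvl (I.lp y)).den_pos
  have hx : ∀ k : Fin I.n, 0 ≤ I.input 5 k ↔ (0 : ℝ) ≤ I.x k := fun k => by
    rw [input_five_val, Rat.num_nonneg]
    exact_mod_cast Iff.rfl
  have hres := hs (fun a b d =>
    (∀ (x' : Fin I.n → ℝ) (e' : ℝ), I.feasPbar z I.j x' e' →
      (d : ℝ) ≤ ∑ k : Fin I.n, (a k : ℝ) * x' k + (b : ℝ) * e') ∧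
    ∑ k : Fin I.n, (a k : ℝ) * (I.x k : ℝ) + (b : ℝ) * (I.ε : ℝ) < d) ?_ ?_ ?_
  · rcases hres with ⟨h0, ⟨h1, h2⟩, h3⟩ | ⟨h0, a, ha, h1, h2⟩
    · refine Or.inl ⟨h0, (h.feasPbar_iff _ _).2 ⟨⟨?_, fun i => (hx i).1 (h2 i i.2)⟩, ?_⟩⟩
      · have h4 : (I.scaledTotal : ℝ) = _ := congrArg (Int.cast : ℤ → ℝ) h1
        rw [Int.cast_mul, hν, scaledTotal_eq] at h4
        exact mul_right_cancel₀ hD.ne' h4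
      · intro i hi S hS
        obtain ⟨y, hy, rfl, hE⟩ := h.exists_examined hi hS
        have h4 : (0 : ℝ) ≤ (I.slack y (toNats S) : ℝ) := by
          exact_mod_cast h3 y hy _ (toNats_subset S) hE
        rw [slack_eq hi] at h4
        have h5 := nonneg_of_mul_nonneg_right h4 (mul_pos hD (hden y))
        rw [lvl] at h5
        split_ifs with h6
        · rw [if_pos h6] at h5
          linarith
        · rw [if_neg h6] at h5
          linarith
    · refine Or.inr ⟨h0, fun x' e' hF => ?_, ?_⟩
      · rw [Finset.sum_congr rfl fun k _ => by rw [ha k k.2]]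
        exact h1 x' e' hF
      · rw [Finset.sum_congr rfl fun k _ => by rw [ha k k.2]]
        exact h2
  · intro ν hν' hne
    have hne' : (I.scaledTotal : ℝ) ≠ ν * I.scaled := by exact_mod_cast hne
    rw [← hν', ] at hν
    have hT := scaledTotal_eq (I := I)
    constructor
    · intro x' e' hF
      have h1 := ((h.feasPbar_iff _ _).1 hF).1.1
      rw [← Finset.mul_sum, h1, ← hν]
      push_cast
      linarith
    · rw [← Finset.mul_sum]
      have hle : I.scaledTotal ≤ ν * I.scaled ↔ (∑ i, (I.x i : ℝ)) * I.scaled ≤ ν * I.scaled := by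
        rw [← hT]
        exact_mod_cast Iff.rfl
      rw [hT] at hne'
      have hne'' : ∑ i, (I.x i : ℝ) ≠ ν := fun h => hne' (by rw [h])
      by_cases hc : I.scaledTotal ≤ ν * I.scaled
      · rw [if_pos hc]
        have h1 := lt_of_le_of_ne (le_of_mul_le_mul_right (hle.1 hc) hD) hne''
        push_cast
        linarith
      · rw [if_neg hc]
        have h1 := lt_of_mul_lt_mul_right (not_le.1 fun h => hc (hle.2 h)) hD.le
        push_cast
        linarith
  · intro k hk hneg
    have hsum : ∀ x' : Fin I.n → ℝ,
        ∑ i : Fin I.n, ((if (i : ℕ) = k then 1 else 0 : ℤ) : ℝ) * x' i = x' ⟨k, hk⟩ := by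
      intro x'
      rw [Finset.sum_eq_single ⟨k, hk⟩]
      · simp
      · intro b _ hb
        rw [if_neg fun h => hb (Fin.ext h)]
        simp
      · simp
    have h1 := (hx ⟨k, hk⟩).not.1 (not_le.2 hneg)
    constructor
    · intro x' e' hF
      rw [hsum]
      simpa using ((h.feasPbar_iff _ _).1 hF).1.2 ⟨k, hk⟩
    · rw [hsum]
      simpa using h1
  · intro y hy S' hS' hE hsl
    obtain ⟨S, rfl⟩ := exists_toNats hS'
    have hlp := lp_lt hy
    have hC := h.constrained_of_examined hlp hE
    have hsum : ∀ x' : Fin I.n → ℝ,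
        ∑ k : Fin I.n, ((I.lvlDen y * if (k : ℕ) ∈ toNats S then 1 else 0 : ℤ) : ℝ) * x' k =
          ((I.lvl (I.lp y)).den : ℝ) * ∑ k ∈ S, x' k := by
      intro x'
      rw [lvlDen_eq hlp, Finset.mul_sum, ← Finset.sum_filter_add_sum_filter_not Finset.univ (· ∈ S)]
      rw [Finset.filter_univ_mem, Finset.sum_congr rfl (g := fun k =>
        ((I.lvl (I.lp y)).den : ℝ) * x' k) fun k hk => by simp [mem_toNats, hk]]
      rw [add_eq_left]
      refine Finset.sum_eq_zero fun k hk => ?_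
      have : k ∉ S := by simpa using hk
      simp [mem_toNats, this]
    have hsl' : (I.slack y (toNats S) : ℝ) < 0 := by exact_mod_cast hsl
    rw [slack_eq hlp] at hsl'
    have hlt := neg_of_mul_neg_right hsl' (mul_pos hD (hden y)).le
    have hmul : ((I.lvl (I.lp y) : ℚ) : ℝ) * ((I.lvl (I.lp y)).den : ℝ) =
        (I.lvl (I.lp y)).num := by
      exact_mod_cast Rat.mul_den_eq_num (I.lvl (I.lp y))
    have h3 : I.input 3 (I.lp y + 1) = if 1 ≤ I.lp y + 1 ∧ I.lp y + 1 < I.j then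
      (I.eps (I.lp y + 1)).num else 0 := rfl
    -- The reported right-hand side is utility plus level, times the denominator, except that in the
    -- last program the level has moved to the left-hand side.
    have hd : (((if I.W ≤ I.sumOver (toNats S) I.wt then 1 else 0) * I.lvlDen y +
        I.input 3 (I.lp y + 1) : ℤ) : ℝ) = utility I.w I.W S * (I.lvl (I.lp y)).den +
          if I.lp y + 1 = I.j then 0 else
            (I.lvl (I.lp y) : ℝ) * ((I.lvl (I.lp y)).den : ℝ) := by
      rw [utility_eq, hmul, h3, lvlDen_eq hlp, Int.cast_add, Int.cast_mul, Int.cast_natCast]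
      congr 1
      by_cases hj : I.lp y + 1 = I.j
      · rw [if_pos hj, if_neg (by omega), Int.cast_zero]
      · rw [if_neg hj, if_pos (by omega), lvl, if_neg hj]
    have hb : ((0 - (if I.lp y + 1 = I.j then 1 else 0) * I.lvlDen y : ℤ) : ℝ) =
        if I.lp y + 1 = I.j then -((I.lvl (I.lp y)).den : ℝ) else 0 := by
      rw [lvlDen_eq hlp]
      split_ifs <;> simp
    have hpos := hden y
    constructor
    · intro x' e' hF
      have h1 := ((h.feasPbar_iff _ _).1 hF).2 _ hlp S hC
      rw [hsum, hd, hb]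
      by_cases hj : I.lp y + 1 = I.j
      · simp only [if_pos hj] at h1 ⊢
        nlinarith
      · have hl : I.lvl (I.lp y) = I.eps (I.lp y + 1) := by rw [lvl, if_neg hj]
        simp only [if_neg hj, ← hl] at h1 ⊢
        nlinarith
    · rw [hsum, hd, hb]
      by_cases hj : I.lp y + 1 = I.j
      · have hl : I.lvl (I.lp y) = I.ε := by rw [lvl, if_pos hj]
        simp only [if_pos hj]
        rw [hl] at hlt hpos ⊢
        nlinarith
      · simp only [if_neg hj]
        nlinarith

end IsScheme

end Instance

end WVG

/-! ### Sizes of the input and the polynomial running time. -/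

namespace WVG

theorem eval_mono_nat (Q : Polynomial ℕ) {a b : ℕ} (h : a ≤ b) : Q.eval a ≤ Q.eval b := by
  rw [Polynomial.eval_eq_sum_range, Polynomial.eval_eq_sum_range]
  gcongr

namespace Cmd

/-- Bound for the bit lengths after the execution of a command. -/
noncomputable def sizePoly (ro : ℕ → Bool) (c : Cmd) (M B₀ B : Polynomial ℕ) : Polynomial ℕ :=
  B + c.steps.comp M * Polynomial.C (c.stepCoeff ro) * B₀

/-- Bound for the cost of a command. -/
noncomputable def timePoly (ro : ℕ → Bool) (c : Cmd) (M B₀ B : Polynomial ℕ) : Polynomial ℕ :=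
  c.steps.comp M * (Polynomial.C (c.stepCoeff ro) * (c.sizePoly ro M B₀ B + B₀) ^ 2)

theorem exec_den_poly {ro : ℕ → Bool} {c : Cmd} {M B₀ B : Polynomial ℕ} {N : ℕ} {s : Store}
    (hwf : c.wf ro = true) (hM : c.LoopBound ro s (M.eval N))
    (hs : s.Bounded ro (B₀.eval N) (B.eval N)) :
    ∃ t, Exec c.compile s t (c.den s) ∧ t ≤ (c.timePoly ro M B₀ B).eval N ∧
      (c.den s).Bounded ro (B₀.eval N) ((c.sizePoly ro M B₀ B).eval N) := by
  simpa [timePoly, sizePoly, Polynomial.eval_comp] using exec_den c hwf le_rfl hM hs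

end Cmd

/-- $(2n)!\le(2n)^{2n}\le 2^{4n^2}$; one more bit makes the inequality strict and another one is the
sign bit. -/
theorem bitLen_natCast_le_of_le_factorial {a : ℤ} {n : ℕ} (h : a.natAbs ≤ (2 * n).factorial) :
    bitLen a ≤ 4 * n ^ 2 + 2 := by
  rw [bitLen_le_iff]
  calc a.natAbs ≤ (2 * n) ^ (2 * n) := h.trans (Nat.factorial_le_pow _)
    _ ≤ (2 ^ (2 * n)) ^ (2 * n) := Nat.pow_le_pow_left Nat.lt_two_pow_self.le _
    _ = 2 ^ (4 * n ^ 2) := by rw [← pow_mul]; ring_nf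
    _ < 2 ^ (4 * n ^ 2 + 1) := Nat.pow_lt_pow_right (by norm_num) (by omega)

namespace Instance

variable {I : Instance}

/-- Size of an instance. -/
def size (I : Instance) : ℕ := I.n + ∑ i, I.w i + I.W + I.pointSize

theorem ratSize_x_le (k : Fin I.n) : ratSize (I.x k) ≤ I.size := by
  have h : ratSize (I.x k) ≤ ∑ k, ratSize (I.x k) :=
    Finset.single_le_sum (f := fun k => ratSize (I.x k)) (fun _ _ => Nat.zero_le _)
      (Finset.mem_univ k)
  rw [size, pointSize]
  omega

theorem ratSize_eps_le : ratSize I.ε ≤ I.size := by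
  rw [size, pointSize]
  omega

theorem n_le_size : I.n ≤ I.size := by
  rw [size]
  omega

theorem W_le_size : I.W ≤ I.size := by
  rw [size]
  omega

theorem w_le_size (k : Fin I.n) : I.w k ≤ I.size := by
  have h : I.w k ≤ ∑ k, I.w k := Finset.single_le_sum (fun _ _ => Nat.zero_le _) (Finset.mem_univ k)
  rw [size]
  omega

namespace IsScheme

variable {z : (l : ℕ) → Fin l → Finset (Fin I.n)}

/-- The number of primes is no part of the size, but distinct primes up to `q` are at most `q + 1`
many. -/
theorem m_le (h : I.IsScheme z) {q : ℕ} (hq : ∀ i, I.prime i ≤ q) : I.m ≤ q + 1 := by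
  have h1 : Function.Injective fun i : Fin I.m =>
      (⟨I.prime i, Nat.lt_succ_of_le (hq i)⟩ : Fin (q + 1)) := fun a b hab =>
    h.prime_injective (Fin.mk.inj_iff.1 hab)
  simpa using Fintype.card_le_of_injective _ h1

/-- Weights, threshold and primes are bounded by value, the point by its encoding, and the levels by
the Cramer bound. -/
theorem bitLen_input_le (h : I.IsScheme z) {q : ℕ} (hq : ∀ i, I.prime i ≤ q) (a i : ℕ) :
    bitLen (I.input a i) ≤ 4 * I.size ^ 2 + I.size + q + 3 := by
  have hm := h.m_le hq
  have hn := n_le_size (I := I)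
  have hW := W_le_size (I := I)
  have hj := h.j_le
  have hnat : ∀ k : ℕ, k ≤ I.size + q + 1 →
      bitLen (k : ℤ) ≤ 4 * I.size ^ 2 + I.size + q + 3 := fun k hk => by
    have := bitLen_natCast_le k
    omega
  have h0 := hnat 0 (by omega)
  have heps : ∀ b : ℤ, b.natAbs ≤ (2 * I.n).factorial →
      bitLen b ≤ 4 * I.size ^ 2 + I.size + q + 3 := fun b hb => by
    have h1 := bitLen_natCast_le_of_le_factorial hb
    have h2 : I.n ^ 2 ≤ I.size ^ 2 := Nat.pow_le_pow_left hn 2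
    omega
  have hrat : ∀ r : ℚ, ratSize r ≤ I.size →
      bitLen r.num ≤ 4 * I.size ^ 2 + I.size + q + 3 ∧
      bitLen (r.den : ℤ) ≤ 4 * I.size ^ 2 + I.size + q + 3 := fun r hr => by
    rw [ratSize] at hr
    omega
  have hε := hrat _ (ratSize_eps_le (I := I))
  rw [input.eq_def]
  split
  · exact hnat _ (by omega)
  · exact hnat _ (by omega)
  · exact hnat _ (by omega)
  · exact hnat _ (by omega)
  · exact hε.1
  · exact hε.2
  · split_ifs with hk
    · exact hnat _ (by have := w_le_size (I := I) ⟨_, hk⟩; omega)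
    · exact h0
  · split_ifs with hk
    · exact hnat _ (by have := hq ⟨_, hk⟩; omega)
    · exact h0
  · split_ifs with hk
    · exact heps _ (h.eps_le_factorial hk.1 hk.2).1
    · exact h0
  · split_ifs with hk
    · exact heps _ (by simpa using (h.eps_le_factorial hk.1 hk.2).2)
    · exact h0
  · split_ifs with hk
    · exact (hrat _ (ratSize_x_le ⟨_, hk⟩)).1
    · exact h0
  · split_ifs with hk
    · exact (hrat _ (ratSize_x_le ⟨_, hk⟩)).2
    · exact h0
  · dsimp only
    split_ifs with hk
    · have := NeZero.mk (h.isPrime ⟨_, hk.2.1⟩).ne_zero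
      refine hnat _ ((ZMod.val_lt _).le.trans ((hq _).trans (by omega)))
    · exact h0
  · exact h0

end IsScheme

end Instance

namespace Separation

open WVG.Expr WVG.Cmd Instance

variable {I : Instance}

theorem loopBound_solve {q M : ℕ} (hq : ∀ i, I.prime i ≤ q) (hn : I.n ≤ M)
    (hjmn : I.j * I.m * I.n ≤ M) (hst : (I.W + 1) * q ≤ M) (hnst : I.n * ((I.W + 1) * q) ≤ M) :
    solve.LoopBound (fun a => decide (a < 8)) I.input M := by
  have hag : ∀ s' : Store, (∀ a, decide (a < 8) = true → s' a = I.input a) → I.Agree s' :=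
    fun s' hs' a ha => hs' a (by simpa using ha)
  have h1 : ∀ s' : Store, (∀ a, decide (a < 8) = true → s' a = I.input a) → nE.eval s' ≤ M := by
    intro s' hs'
    rw [eval_nE (hag s' hs')]
    exact_mod_cast hn
  have hz : ∀ s' : Store, (∀ a, decide (a < 8) = true → s' a = I.input a) →
      ∃ k : ℕ, zE.eval s' = k ∧ k ≤ (I.W + 1) * q := by
    intro s' hs'
    -- The cell of array `2` that is read depends on a writable counter; the bound holds for every
    -- cell, so the value of the counter is irrelevant.
    have h2 : ∀ i, ∃ k : ℕ, I.input 2 i = k ∧ k ≤ q := by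
      intro i
      by_cases hi : i < I.m
      · exact ⟨I.prime ⟨i, hi⟩, by simp [input, hi], hq _⟩
      · exact ⟨0, by simp [input, hi], Nat.zero_le _⟩
    rw [zE, eval_mul, eval_add, eval_wE (hag s' hs'), eval_lit, pE, eval_get,
      hag s' hs' 2 (by norm_num)]
    obtain ⟨k, hk, hkq⟩ := h2 ((cell 17 / nE % mE).eval s').toNat
    rw [hk]
    exact ⟨(I.W + 1) * k, by push_cast; rfl, Nat.mul_le_mul_left _ hkq⟩
  have h3 : ∀ s' : Store, (∀ a, decide (a < 8) = true → s' a = I.input a) → zE.eval s' ≤ M := by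
    intro s' hs'
    obtain ⟨k, hk, hkq⟩ := hz s' hs'
    rw [hk]
    exact_mod_cast hkq.trans hst
  have h4 : ∀ s' : Store, (∀ a, decide (a < 8) = true → s' a = I.input a) →
      (nE * zE).eval s' ≤ M := by
    intro s' hs'
    obtain ⟨k, hk, hkq⟩ := hz s' hs'
    rw [eval_mul, eval_nE (hag s' hs'), hk]
    exact_mod_cast (Nat.mul_le_mul_left _ hkq).trans hnst
  have h5 : ∀ s' : Store, (∀ a, decide (a < 8) = true → s' a = I.input a) →
      (jE * mE * nE).eval s' ≤ M := by
    intro s' hs'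
    rw [eval_mul, eval_mul, eval_nE (hag s' hs'), eval_jE (hag s' hs'), eval_mE (hag s' hs')]
    exact_mod_cast hjmn
  simp only [solve, scale, total, checkTotal, checkNonneg, search, tableBase, tableFill, report,
    LoopBound, true_and, and_true]
  exact ⟨h1, h1, h1, ⟨h1, h1⟩, h5, h3, h4, h1⟩

theorem den_solve_output (h : ∃ z, I.IsScheme z) {V : (ℕ → ℤ) → ℤ → ℤ → Prop}
    (hV₁ : ∀ ν : ℤ, ν = (if (I.W : ℤ) ≤ I.totalWeight then 1 else 0) →
      I.scaledTotal ≠ ν * I.scaled →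
      V (fun _ => 2 * (if I.scaledTotal ≤ ν * I.scaled then 1 else 0) - 1) 0
        ((2 * (if I.scaledTotal ≤ ν * I.scaled then 1 else 0) - 1) * ν))
    (hV₂ : ∀ k < I.n, I.input 5 k < 0 → V (fun i => if i = k then 1 else 0) 0 0)
    (hV₃ : ∀ y < I.j * I.m * I.n, ∀ S ⊆ Finset.range I.n, I.Examined y S → I.slack y S < 0 →
      V (fun k => I.lvlDen y * if k ∈ S then 1 else 0)
        (0 - (if I.lp y + 1 = I.j then 1 else 0) * I.lvlDen y)
        ((if I.W ≤ I.sumOver S I.wt then 1 else 0) * I.lvlDen y + I.input 3 (I.lp y + 1))) :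
    (outputAnswer.den (outputInequality.den (solve.den I.input)) 0 0 = 1 ∧
      (I.scaledTotal = (if (I.W : ℤ) ≤ I.totalWeight then 1 else 0) * I.scaled ∧
        ∀ k < I.n, 0 ≤ I.input 5 k) ∧ ∀ y < I.j * I.m * I.n, ∀ S ⊆ Finset.range I.n,
          I.Examined y S → 0 ≤ I.slack y S) ∨
    (outputAnswer.den (outputInequality.den (solve.den I.input)) 0 0 = 0 ∧ ∃ a : ℕ → ℤ,
      (∀ k < I.n, outputAnswer.den (outputInequality.den (solve.den I.input)) 1 k = a k) ∧
      V a (outputAnswer.den (outputInequality.den (solve.den I.input)) 2 0)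
        (outputAnswer.den (outputInequality.den (solve.den I.input)) 2 1)) := by
  obtain ⟨z, h⟩ := h
  have hn := h.three_le
  have hm := h.three_le_m.1
  refine den_output ?_ (den_solve ?_ (by omega) (by omega) ?_ ?_ hV₁ hV₂ hV₃)
  · rw [den_of_notMem (notMem_writes wf_solve (by decide))]
    rfl
  · intro y _ hm
    rw [prm_eq ⟨y / I.n % I.m, Nat.mod_lt _ hm⟩ rfl]
    exact (h.isPrime _).pos
  · intro k hk
    rw [input_six_val ⟨k, hk⟩]
    positivity
  · intro y hy
    rw [lvlDen_eq (lp_lt hy)]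
    positivity

/-- The program that solves the separation problem. -/
def prog : Prog := .seq (.seq solve.compile outputInequality.compile) outputAnswer.compile

end Separation

end WVG

open WVG
theorem lemma4 :
    ∃ p : Prog, ∀ Q : Polynomial ℕ, ∃ T : Polynomial ℕ,
      ∀ (I : Instance) (z : (l : ℕ) → Fin l → Finset (Fin I.n)),
        I.IsScheme z → (∀ q, I.prime q ≤ Q.eval I.n) →
        ∃ (t : ℕ) (s : Store),
          Exec p I.input t s ∧
          t ≤ T.eval (I.n + ∑ i, I.w i + I.W + I.pointSize) ∧
          SolvesSeparation (I.feasPbar z I.j) (fun k => (I.x k : ℝ)) (I.ε : ℝ) s := by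
  -- The program is independent of `Q`; only the time bound depends on it.
  refine ⟨Separation.prog, fun Q => ?_⟩
  let ro₁ : ℕ → Bool := fun a => decide (a < 8)
  let ro₂ : ℕ → Bool := fun a => decide (a < 1)
  let ro₃ : ℕ → Bool := fun _ => false
  -- Covers the longest loops: the at most $n\cdot(q+1)\cdot n$ blocks and the $n(W+1)q$ cells of
  -- the table, where $q$ bounds the primes.
  let M : Polynomial ℕ := (Polynomial.X + 1) ^ 2 * (Q + 1)
  let B₀ : Polynomial ℕ := 4 * Polynomial.X ^ 2 + Polynomial.X + Q + 3
  let B₁ := Separation.solve.sizePoly ro₁ M B₀ B₀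
  let B₂ := Separation.outputInequality.sizePoly ro₂ M B₁ B₁
  refine ⟨Separation.solve.timePoly ro₁ M B₀ B₀ +
    Separation.outputInequality.timePoly ro₂ M B₁ B₁ +
    Separation.outputAnswer.timePoly ro₃ M B₂ B₂, fun I z h hQ => ?_⟩
  change ∃ t s, _ ∧ t ≤ Polynomial.eval I.size _ ∧ _
  have hq : ∀ i, I.prime i ≤ Q.eval I.size :=
    fun i => (hQ i).trans (eval_mono_nat Q Instance.n_le_size)
  have hM : M.eval I.size = (I.size + 1) ^ 2 * (Q.eval I.size + 1) := by simp [M]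
  have hB₀ : B₀.eval I.size = 4 * I.size ^ 2 + I.size + Q.eval I.size + 3 := by simp [B₀]
  have hn := Instance.n_le_size (I := I)
  have hW := Instance.W_le_size (I := I)
  have hin : I.input.Bounded ro₁ (B₀.eval I.size) (B₀.eval I.size) := by
    rw [hB₀]
    exact ⟨by omega, fun a _ i => h.bitLen_input_le hq a i, h.bitLen_input_le hq⟩
  have hnM : I.n ≤ M.eval I.size := by
    rw [hM]
    nlinarith [Nat.zero_le (Q.eval I.size * (I.size + 1) ^ 2)]
  obtain ⟨t₁, e₁, l₁, b₁⟩ := Cmd.exec_den_poly Separation.wf_solve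
    (Separation.loopBound_solve hq hnM (by
        rw [hM]
        calc I.j * I.m * I.n ≤ (I.size + 1) * (Q.eval I.size + 1) * (I.size + 1) := by
              gcongr
              · have := h.j_le; omega
              · exact h.m_le hq
              · omega
          _ = _ := by ring) (by
        rw [hM]
        calc (I.W + 1) * Q.eval I.size ≤ (I.size + 1) ^ 2 * (Q.eval I.size + 1) := by
              gcongr
              · calc I.W + 1 ≤ I.size + 1 := by omega
                  _ ≤ _ := Nat.le_self_pow two_ne_zero _
              · omega) (by
        rw [hM]
        calc I.n * ((I.W + 1) * Q.eval I.size) ≤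
              (I.size + 1) * ((I.size + 1) * (Q.eval I.size + 1)) := by
              gcongr <;> omega
          _ = _ := by ring)) hin
  -- The result of the first phase becomes the data of the second, so its bit bound now plays the
  -- role of `B₀`; the same happens once more for the third phase.
  have b₁' : (Separation.solve.den I.input).Bounded ro₂ (B₁.eval I.size) (B₁.eval I.size) :=
    ⟨(bitLen_pos _).trans (b₁.all 0 0), fun a _ => b₁.all a, b₁.all⟩
  obtain ⟨t₂, e₂, l₂, b₂⟩ := Cmd.exec_den_poly (M := M) Separation.wf_outputInequality
    ⟨⟨fun s' hs' => by
      have h0 : s' 0 = I.input 0 := (hs' 0 rfl).trans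
        (Cmd.den_of_notMem (Cmd.notMem_writes Separation.wf_solve (by decide)))
      rw [Separation.nE, Expr.eval_get, h0]
      exact Int.ofNat_le.2 hnM, trivial⟩, trivial, trivial⟩ b₁'
  have b₂' : (Separation.outputInequality.den (Separation.solve.den I.input)).Bounded ro₃
      (B₂.eval I.size) (B₂.eval I.size) :=
    ⟨(bitLen_pos _).trans (b₂.all 0 0), fun a _ => b₂.all a, b₂.all⟩
  obtain ⟨t₃, e₃, l₃, -⟩ := Cmd.exec_den_poly (M := M) (c := Separation.outputAnswer)
    Separation.wf_outputAnswer trivial b₂'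
  refine ⟨_, _, Exec.seq (Exec.seq e₁ e₂) e₃, ?_, h.solves_of_state fun V hV₁ hV₂ hV₃ =>
    Separation.den_solve_output ⟨z, h⟩ hV₁ hV₂ hV₃⟩
  rw [Polynomial.eval_add, Polynomial.eval_add]
  exact add_le_add (add_le_add l₁ l₂) l₃
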